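/- \textbf{Setting.} Let $T>0$. Let $f\in C^2_b(\mathbb R)$ with $\inf f>0$; let $\sigma:\mathbb R\to\mathbb R$ be Lipschitz and bounded with $\inf\sigma>0$; let $\bar\gamma:\mathbb R\to\mathbb R$ be continuous with $\iota\le\bar\gamma\le 1/f-\iota$ for some $\iota>0$. Let $g:\mathbb R\to\mathbb R$ be lower semicontinuous, with $g^-$ bounded and $g^+$ of linear growth. Let $\hat g:=(g-\bar\Gamma)^{\rm conc}+\bar\Gamma$, where $\bar\Gamma\in C^2$ satisfies $\bar\Gamma''=\bar\gamma$ and ${}^{\rm conc}$ denotes the concave envelope, and assume that $\hat g$ is uniformly continuous. The pricing equation is $$\min\Big\{-\partial_t\varphi-\frac{\sigma^2\,\partial^2_{xx}\varphi}{2(1-f\,\partial^2_{xx}\varphi)}\,,\ \bar\gamma-\partial^2_{xx}\varphi\Big\}=0\ \text{ on }[0,T)\times\mathbb R,\qquad \varphi(T,\cdot)=\hat g\ \text{ on }\mathbb R.\tag{E}$$ \textbf{Bounds.} Let $c_0>0$, $c_1\ge0$ be such that $-c_0\le\hat g(x)\le c_0+c_1|x|$ for all $x$, let $\eta\in(0,\iota\wedge\inf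 f^{-1})$ (where $f^{-1}=1/f$), $\tilde\Gamma(x):=\eta x^2/2$, $A:=T\sup\frac{\sigma^2\bar\gamma}{2(1-f\bar\gamma)}$, and put $\underline w:=\inf g$, $\overline w:=(1+2c_0+c_1|\cdot|-\tilde\Gamma)^{\rm conc}+\tilde\Gamma+1+A$. \textbf{Scheme.} Let $h=(h_t,h_x)\in(0,1)^2$ and $\underline x<\overline x$ be such that $n_th_t=T$ and $n_xh_x=\overline x-\underline x$ for some $n_t,n_x\in\mathbb N$. Let $t_i:=ih_t$, $x_j:=\underline x+jh_x$ and $\pi_h:=\{(t_i,x_j):0\le i\le n_t,\ 0\le j\le n_x\}$. With $$G^h(t,x,y,\phi):=\frac{\phi(t+h_t,x+h_x)+\phi(t+h_t,x-h_x)-2y}{h_x^2},$$ $$L^h_1:=-\frac{\phi(t+h_t,x)-y}{h_t}-\frac{\sigma^2(x)G^h}{2(1-f(x)G^h)},\qquad L_2^h:=\bar\gamma(x)-G^h,$$ $$S(h,t,x,y,\phi):=\max\big\{y-\overline w(x),\ \min\{y-\underline w,\ L^h_1(t,x,y,\phi),\ L^h_2(t,x,y,\phi)\}\big\},$$ the scheme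 for $\mathrm v^h:\pi_h\to\mathbb R$ is $$S(h,t_i,x_j,\mathrm v^h(t_i,x_j),\mathrm v^h)=0\quad\text{for } i<n_t,\ 1\le j\le n_x-1,$$ and $\mathrm v^h(t_i,x_j)=\hat g(x_j)$ if $i=n_t$ or $j\in\{0,n_x\}$. \textbf{Theorem.} (i) For all such $h,\underline x,\overline x$ the scheme has a unique solution $\mathrm v^h$ on $\pi_h$. (ii) Equation (E) has a unique continuous viscosity solution $\mathrm v$ with linear growth on $[0,T]\times\mathbb R$. As $h_t/h_x^2\to0$, $h_x\to0$, $\underline x\to-\infty$ and $\overline x\to+\infty$, $\mathrm v^h$ converges to $\mathrm v$ locally uniformly on $[0,T]\times\mathbb R$; that is, for all $R,\varepsilon>0$ there are $\delta,L>0$ such that $h_t/h_x^2<\delta$, $h_x<\delta$, $\underline x\le-L$ and $\overline x\ge L$ imply $|\mathrm v^h-\mathrm v|<\varepsilon$ at all points $(t,x)\in\pi_h$ with $|x|\le R$. -/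

import Mathlib

open Set

namespace GammaHedging

noncomputable section

/-- Concave envelope of `u`: the infimum of all concave functions lying above `u`. -/
def concEnv (u : ℝ → ℝ) (x : ℝ) : ℝ :=
  sInf {y | ∃ w : ℝ → ℝ, ConcaveOn ℝ univ w ∧ (∀ z, u z ≤ w z) ∧ y = w x}

/-- Face-lift `ĝ = (g - Γ)^conc + Γ` of the payoff `g`, where `Γ'' = γ̄`. -/
def faceLift (Γ g : ℝ → ℝ) (x : ℝ) : ℝ :=
  concEnv (fun z => g z - Γ z) x + Γ x

/-- The pricing operator
`F(x, q, M) = min {-q - σ²(x) M / (2 (1 - f(x) M)), γ̄(x) - M}`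
(`q` stands for `∂ₜφ`, `M` for `∂ₓₓφ`). If `1 - f(x) M ≤ 0`, then `M > γ̄(x)` and the second
term is negative, so the singularity of the first one plays no role. -/
def pricingOp (f σ γ : ℝ → ℝ) (x q M : ℝ) : ℝ :=
  min (-q - σ x ^ 2 * M / (2 * (1 - f x * M))) (γ x - M)

/-- `F[φ](t, x)` for a twice continuously differentiable function `φ` of `(t, x)`. -/
def pricingOpOn (f σ γ : ℝ → ℝ) (φ : ℝ × ℝ → ℝ) (t x : ℝ) : ℝ :=
  pricingOp f σ γ x (deriv (fun s => φ (s, x)) t) (iteratedDeriv 2 (fun z => φ (t, z)) x)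

/-- Viscosity subsolution of `F[φ] 1_{[0,T)} + (φ - G) 1_{T} = 0` on `[0,T] × ℝ`. -/
structure IsViscSubsolution (T : ℝ) (f σ γ G : ℝ → ℝ) (v : ℝ × ℝ → ℝ) : Prop where
  interior : ∀ φ : ℝ × ℝ → ℝ, ContDiff ℝ 2 φ → ∀ t x : ℝ, 0 ≤ t → t < T →
    IsLocalMaxOn (fun p => v p - φ p) (Ico 0 T ×ˢ univ) (t, x) →
    pricingOpOn f σ γ φ t x ≤ 0
  terminal : ∀ x : ℝ, v (T, x) - G x ≤ 0

/-- Viscosity supersolution of `F[φ] 1_{[0,T)} + (φ - G) 1_{T} = 0` on `[0,T] × ℝ`. -/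
structure IsViscSupersolution (T : ℝ) (f σ γ G : ℝ → ℝ) (v : ℝ × ℝ → ℝ) : Prop where
  interior : ∀ φ : ℝ × ℝ → ℝ, ContDiff ℝ 2 φ → ∀ t x : ℝ, 0 ≤ t → t < T →
    IsLocalMinOn (fun p => v p - φ p) (Ico 0 T ×ˢ univ) (t, x) →
    0 ≤ pricingOpOn f σ γ φ t x
  terminal : ∀ x : ℝ, 0 ≤ v (T, x) - G x

/-- `v` has linear growth on `[0,T] × ℝ`, uniformly in time. -/
def HasLinearGrowth (T : ℝ) (v : ℝ × ℝ → ℝ) : Prop :=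
  ∃ C : ℝ, ∀ t ∈ Icc 0 T, ∀ x : ℝ, |v (t, x)| ≤ C * (1 + |x|)

/-- Continuous viscosity solution with linear growth on `[0,T] × ℝ` of the pricing equation with
terminal value `G`. (Values of `v` outside `[0,T] × ℝ` are irrelevant.) -/
structure IsPricingSolution (T : ℝ) (f σ γ G : ℝ → ℝ) (v : ℝ × ℝ → ℝ) : Prop where
  continuousOn : ContinuousOn v (Icc 0 T ×ˢ univ)
  linearGrowth : HasLinearGrowth T v
  sub : IsViscSubsolution T f σ γ G v
  super : IsViscSupersolution T f σ γ G v

/-- Lower bound `w̲ = inf g`. -/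
def lowerBd (g : ℝ → ℝ) : ℝ := ⨅ x, g x

/-- `A = T sup (σ² γ̄ / (2 (1 - f γ̄)))`. -/
def constA (T : ℝ) (f σ γ : ℝ → ℝ) : ℝ :=
  T * ⨆ x, σ x ^ 2 * γ x / (2 * (1 - f x * γ x))

/-- Upper bound `w̄ = (1 + 2c₀ + c₁|·| - Γ̃)^conc + Γ̃ + 1 + A`, with `Γ̃(x) = η x² / 2`. -/
def upperBd (T : ℝ) (f σ γ : ℝ → ℝ) (c₀ c₁ η : ℝ) (x : ℝ) : ℝ :=
  concEnv (fun z => 1 + 2 * c₀ + c₁ * |z| - η * z ^ 2 / 2) x + η * x ^ 2 / 2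
    + 1 + constA T f σ γ

/-- Discrete second derivative, with centre value `y` taken at the current time. -/
def discG (ht hx t x y : ℝ) (φ : ℝ × ℝ → ℝ) : ℝ :=
  (φ (t + ht, x + hx) + φ (t + ht, x - hx) - 2 * y) / hx ^ 2

/-- The discretised parabolic operator. -/
def discL₁ (f σ : ℝ → ℝ) (ht hx t x y : ℝ) (φ : ℝ × ℝ → ℝ) : ℝ :=
  -((φ (t + ht, x) - y) / ht)
    - σ x ^ 2 * discG ht hx t x y φ / (2 * (1 - f x * discG ht hx t x y φ))

/-- The discretised gamma constraint. -/
def discL₂ (γ : ℝ → ℝ) (ht hx t x y : ℝ) (φ : ℝ × ℝ → ℝ) : ℝ :=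
  γ x - discG ht hx t x y φ

/-- The scheme operator `S(h, t, x, y, φ) = (y - w̄) ∨ ((y - w̲) ∧ min (L₁, L₂))`,
truncated between a lower bound `wlo` and an upper bound `whi`. -/
def schemeOp (f σ γ : ℝ → ℝ) (wlo : ℝ) (whi : ℝ → ℝ) (ht hx t x y : ℝ)
    (φ : ℝ × ℝ → ℝ) : ℝ :=
  max (y - whi x)
    (min (y - wlo) (min (discL₁ f σ ht hx t x y φ) (discL₂ γ ht hx t x y φ)))

/-- Admissible mesh: `h = (ht, hx) ∈ (0,1)²`, with `nt` time steps filling `[0,T]` and `nx` space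
steps filling `[xlo, xhi]`. -/
structure IsMesh (T ht hx xlo xhi : ℝ) (nt nx : ℕ) : Prop where
  ht_pos : 0 < ht
  ht_lt_one : ht < 1
  hx_pos : 0 < hx
  hx_lt_one : hx < 1
  xlo_lt_xhi : xlo < xhi
  time_steps : nt * ht = T
  space_steps : nx * hx = xhi - xlo

/-- The grid `{(i ht, xlo + j hx) : i ≤ nt, j ≤ nx}`. -/
def grid (ht hx xlo : ℝ) (nt nx : ℕ) : Set (ℝ × ℝ) :=
  {p | ∃ i j : ℕ, i ≤ nt ∧ j ≤ nx ∧ p = (i * ht, xlo + j * hx)}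

/-- `u` solves the scheme: the equation `S = 0` holds at the inner nodes, and `u = G` at the nodes
of the terminal date and of the two lateral boundaries. Only the values of `u` on the grid
matter. -/
structure IsSchemeSolution (f σ γ G : ℝ → ℝ) (wlo : ℝ) (whi : ℝ → ℝ)
    (ht hx xlo : ℝ) (nt nx : ℕ) (u : ℝ × ℝ → ℝ) : Prop where
  inner : ∀ i j : ℕ, i < nt → 1 ≤ j → j < nx →
    schemeOp f σ γ wlo whi ht hx (i * ht) (xlo + j * hx) (u (i * ht, xlo + j * hx)) u = 0
  boundary : ∀ i j : ℕ, i ≤ nt → j ≤ nx → (i = nt ∨ j = 0 ∨ j = nx) →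
    u (i * ht, xlo + j * hx) = G (xlo + j * hx)

end

end GammaHedging

/-! The argument is of Barles–Souganidis type, but comparison rests on approximating supersolutions
by smooth strict ones rather than on doubling of variables.

Convexity. For `M ≤ γ`, the nonlinearity `σ²M / (2(1 - fM))` is the maximum over `s` of `s²M/2 - (s
- σ)²/(2f)`, reached at `s = σ/(1 - fM)`, which stays in a bounded interval (`dual_le`, `dual_eq`,
`optimal_mem`). At each `x`, the jets `(q, M)` of supersolutions thus form an intersection of
half-planes, which is convex and stable under lowering `q` or `M`.

Scheme. By this monotonicity a node equation has exactly one root (`existsUnique_node`), and only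
values one time level later enter it, so (i) follows by backward induction. Explicit discrete
barriers show that the truncations never act and that the solutions grow linearly, uniformly in the
mesh.

Convergence. The lower relaxed limit `w` of the discrete solutions is a supersolution with terminal
value `ĝ`. Near any point `p`, a supersolution with these terminal data has a smooth strict
supersolution `W` with `W p < w p + ε`, above `ĝ` at time `T` and above any prescribed linear growth
near `|x| = R` (`exists_barrier`). By consistency `W` is a discrete supersolution on fine meshes, so
it dominates the discrete solutions (`discrete_lt_of_super`). Hence the upper relaxed limit is at
most `w`: the limit is continuous, solves the equation, and convergence is locally uniform. The same
`W` dominates every subsolution, and any other solution, being a supersolution, dominates the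
discrete solutions; this gives uniqueness.

Smoothing. `W` is a convex combination of a mollification of `w`, extended beyond `T`, and a
quadratic strict supersolution. Viscosity inequalities cannot be convolved directly, so they are
first put in integrated form: a bound on second differences (`second_diff_le_of_super`), and
domination of Gaussian averages of later values for each fixed `s` (`heat_inequality`), obtained by
comparison with explicit heat flows of cosine polynomials. Both survive averaging over shifts, and
on a smooth function they give back pointwise inequalities. -/

namespace GammaHedging
-- Dual form and monotonicity of the operator; the equation at one node.
noncomputable section

/-- Quantitative standing assumptions on the coefficients of the pricing equation. -/
structure CoeffBounds (f σ γ : ℝ → ℝ) (f₀ s₀ ι : ℝ) : Prop where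
  f_cont : Continuous f
  σ_cont : Continuous σ
  γ_cont : Continuous γ
  f₀_pos : 0 < f₀
  f_ge : ∀ x, f₀ ≤ f x
  σ_pos : ∀ x, 0 < σ x
  σ_le : ∀ x, σ x ≤ s₀
  ι_pos : 0 < ι
  γ_ge : ∀ x, ι ≤ γ x
  γ_le : ∀ x, γ x ≤ 1 / f x - ι

/-- Cost of using the volatility `s` instead of `σ x`; the nonlinearity of the pricing equation is
`sup_s (s² M / 2 - ctrlCost s)`. -/
def ctrlCost (f σ : ℝ → ℝ) (s x : ℝ) : ℝ := (s - σ x) ^ 2 / (2 * f x)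

theorem pricingOp_nonneg_iff {f σ γ : ℝ → ℝ} {x q M : ℝ} :
    0 ≤ pricingOp f σ γ x q M ↔ M ≤ γ x ∧ q + σ x ^ 2 * M / (2 * (1 - f x * M)) ≤ 0 := by
  unfold pricingOp
  rw [le_min_iff]
  constructor
  · rintro ⟨h1, h2⟩; constructor <;> linarith
  · rintro ⟨h1, h2⟩; constructor <;> linarith

theorem pricingOp_pos_iff {f σ γ : ℝ → ℝ} {x q M : ℝ} :
    0 < pricingOp f σ γ x q M ↔ M < γ x ∧ q + σ x ^ 2 * M / (2 * (1 - f x * M)) < 0 := by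
  unfold pricingOp
  rw [lt_min_iff]
  constructor
  · rintro ⟨h1, h2⟩; constructor <;> linarith
  · rintro ⟨h1, h2⟩; constructor <;> linarith

namespace CoeffBounds

variable {f σ γ : ℝ → ℝ} {f₀ s₀ ι : ℝ} (C : CoeffBounds f σ γ f₀ s₀ ι)
include C

theorem f_pos (x : ℝ) : 0 < f x := C.f₀_pos.trans_le (C.f_ge x)

theorem s₀_pos : 0 < s₀ := (C.σ_pos 0).trans_le (C.σ_le 0)

/-- Uniform distance to the singularity, from `f M ≤ f γ ≤ 1 - ι f`. -/
theorem gap {x M : ℝ} (hM : M ≤ γ x) : ι * f₀ ≤ 1 - f x * M := by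
  have hf := C.f_pos x
  have h1 : f x * M ≤ f x * (1 / f x - ι) :=
    mul_le_mul_of_nonneg_left (hM.trans (C.γ_le x)) hf.le
  have h2 : f x * (1 / f x - ι) = 1 - f x * ι := by field_simp
  have h3 : f₀ * ι ≤ f x * ι := mul_le_mul_of_nonneg_right (C.f_ge x) C.ι_pos.le
  linarith

theorem gap_pos {x M : ℝ} (hM : M ≤ γ x) : 0 < 1 - f x * M :=
  (mul_pos C.ι_pos C.f₀_pos).trans_le (C.gap hM)

theorem γ_bound (x : ℝ) : γ x ≤ 1 / f₀ := by
  have := C.γ_le x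
  have h : 1 / f x ≤ 1 / f₀ := one_div_le_one_div_of_le C.f₀_pos (C.f_ge x)
  linarith [C.ι_pos]

/-- The nonlinearity is the supremum of the affine functions `M ↦ s² M / 2 - ctrlCost s`. -/
theorem dual_le {x M : ℝ} (hM : M ≤ γ x) (s : ℝ) :
    s ^ 2 / 2 * M - ctrlCost f σ s x ≤ σ x ^ 2 * M / (2 * (1 - f x * M)) := by
  have hf := C.f_pos x
  have hg := C.gap_pos hM
  unfold ctrlCost
  -- Completing the square in `s`: the defect is a square over a positive denominator.
  have : σ x ^ 2 * M / (2 * (1 - f x * M)) - (s ^ 2 / 2 * M - (s - σ x) ^ 2 / (2 * f x))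
      = (s * (1 - f x * M) - σ x) ^ 2 / (2 * f x * (1 - f x * M)) := by
    obtain ⟨d, hd⟩ : ∃ d, d = 1 - f x * M := ⟨_, rfl⟩
    have hM' : M = (1 - d) / f x := by rw [hd]; field_simp; ring
    rw [← hd] at hg ⊢
    rw [hM']
    field_simp
    ring
  have h2 : 0 ≤ (s * (1 - f x * M) - σ x) ^ 2 / (2 * f x * (1 - f x * M)) := by positivity
  linarith

/-- The square in the proof of `dual_le` vanishes at this `s`. -/
theorem dual_eq {x M : ℝ} (hM : M ≤ γ x) :
    (σ x / (1 - f x * M)) ^ 2 / 2 * M - ctrlCost f σ (σ x / (1 - f x * M)) x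
      = σ x ^ 2 * M / (2 * (1 - f x * M)) := by
  have hf := C.f_pos x
  have hg := C.gap_pos hM
  unfold ctrlCost
  field_simp
  ring

theorem optimal_mem {x M : ℝ} (hM : M ≤ γ x) :
    σ x / (1 - f x * M) ∈ Icc 0 (s₀ / (ι * f₀)) := by
  have hg := C.gap_pos hM
  refine ⟨div_nonneg (C.σ_pos x).le hg.le, ?_⟩
  exact div_le_div₀ C.s₀_pos.le (C.σ_le x) (mul_pos C.ι_pos C.f₀_pos) (C.gap hM)

/-- Linear description of the admissible jets of supersolutions. -/
theorem le_of_nonneg {x q M : ℝ} (h : 0 ≤ pricingOp f σ γ x q M) (s : ℝ) :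
    q + s ^ 2 / 2 * M ≤ ctrlCost f σ s x := by
  obtain ⟨h1, h2⟩ := pricingOp_nonneg_iff.1 h
  have := C.dual_le h1 s
  linarith

/-- Converse of `le_of_nonneg` with a margin. A compact range of `s` suffices, since it contains the
maximiser; this allows moduli of continuity uniform in `s`. -/
theorem pos_of_lt {x q M κ : ℝ} (hκ : 0 < κ) (hM : M ≤ γ x - κ)
    (h : ∀ s ∈ Icc 0 (s₀ / (ι * f₀)), q + s ^ 2 / 2 * M ≤ ctrlCost f σ s x - κ) :
    0 < pricingOp f σ γ x q M := by
  have hM' : M ≤ γ x := by linarith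
  refine pricingOp_pos_iff.2 ⟨by linarith, ?_⟩
  have := h _ (C.optimal_mem hM')
  have h2 := C.dual_eq hM'
  linarith

/-- A maximum of affine functions with slopes `s²/2 ≥ 0`: the maximiser for `M` is a competitor for
`M'`. -/
theorem nonlin_mono {x M M' : ℝ} (h : M ≤ M') (hM : M' ≤ γ x) :
    σ x ^ 2 * M / (2 * (1 - f x * M)) ≤ σ x ^ 2 * M' / (2 * (1 - f x * M')) := by
  rw [← C.dual_eq (h.trans hM)]
  refine le_trans ?_ (C.dual_le hM (σ x / (1 - f x * M)))
  have : 0 ≤ (σ x / (1 - f x * M)) ^ 2 / 2 := by positivity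
  have := mul_le_mul_of_nonneg_left h this
  linarith

theorem nonneg_mono {x q q' M M' : ℝ} (h : 0 ≤ pricingOp f σ γ x q' M') (hq : q ≤ q')
    (hM : M ≤ M') : 0 ≤ pricingOp f σ γ x q M := by
  obtain ⟨h1, h2⟩ := pricingOp_nonneg_iff.1 h
  have := C.nonlin_mono hM h1
  exact pricingOp_nonneg_iff.2 ⟨hM.trans h1, by linarith⟩

theorem pos_mono {x q q' M M' : ℝ} (h : 0 ≤ pricingOp f σ γ x q' M') (hq : q < q')
    (hM : M < M') : 0 < pricingOp f σ γ x q M := by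
  obtain ⟨h1, h2⟩ := pricingOp_nonneg_iff.1 h
  have := C.nonlin_mono hM.le h1
  exact pricingOp_pos_iff.2 ⟨hM.trans_le h1, by linarith⟩

theorem pos_mono' {x q q' M M' : ℝ} (h : 0 < pricingOp f σ γ x q' M') (hq : q ≤ q')
    (hM : M ≤ M') : 0 < pricingOp f σ γ x q M := by
  obtain ⟨h1, h2⟩ := pricingOp_pos_iff.1 h
  have := C.nonlin_mono hM h1.le
  exact pricingOp_pos_iff.2 ⟨hM.trans_lt h1, by linarith⟩

/-- By monotonicity the worst case is `M = γ x`, where the cost is nonnegative and both the optimal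
`s` and `γ` are bounded. -/
theorem nonlin_le {x M : ℝ} (hM : M ≤ γ x) :
    σ x ^ 2 * M / (2 * (1 - f x * M)) ≤ (s₀ / (ι * f₀)) ^ 2 / (2 * f₀) := by
  refine (C.nonlin_mono hM le_rfl).trans ?_
  have hp : 0 < 1 - f x * γ x := C.gap_pos le_rfl
  rw [← C.dual_eq (M := γ x) le_rfl]
  obtain ⟨h0, h1⟩ := C.optimal_mem (x := x) (M := γ x) le_rfl
  have hγ0 : 0 ≤ γ x := C.ι_pos.le.trans (C.γ_ge x)
  have hc : 0 ≤ ctrlCost f σ (σ x / (1 - f x * γ x)) x := by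
    have := C.f_pos x
    unfold ctrlCost; positivity
  have h2 : (σ x / (1 - f x * γ x)) ^ 2 / 2 * γ x ≤ (s₀ / (ι * f₀)) ^ 2 / 2 * (1 / f₀) := by
    apply mul_le_mul _ (C.γ_bound x) hγ0 (by positivity)
    gcongr
  have h3 : (s₀ / (ι * f₀)) ^ 2 / 2 * (1 / f₀) = (s₀ / (ι * f₀)) ^ 2 / (2 * f₀) := by
    have := C.f₀_pos.ne'
    field_simp
  linarith

/-- Upper bound for the time derivative of a supersolution. -/
theorem rate_le {x q M : ℝ} (h : 0 ≤ pricingOp f σ γ x q M) : q ≤ s₀ ^ 2 / (2 * f₀) := by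
  have h1 := C.le_of_nonneg h 0
  have h2 : ctrlCost f σ 0 x ≤ s₀ ^ 2 / (2 * f₀) := by
    unfold ctrlCost
    have := C.f₀_pos
    have h3 := C.σ_pos x
    have h4 := C.σ_le x
    apply div_le_div₀ (by positivity) _ (by positivity) (by linarith [C.f_ge x])
    nlinarith
  simp at h1
  linarith

/-- This sign makes the lower truncation harmless: at a node where the floor is reached, both
differences are nonnegative. -/
theorem nonpos_of_jet_nonneg {x q M : ℝ} (hq : 0 ≤ q) (hM : 0 ≤ M) :
    pricingOp f σ γ x q M ≤ 0 := by
  by_contra h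
  push Not at h
  obtain ⟨h1, h2⟩ := pricingOp_pos_iff.1 h
  have := C.gap_pos h1.le
  have : 0 ≤ σ x ^ 2 * M / (2 * (1 - f x * M)) := by positivity
  linarith

theorem continuous_ctrlCost : Continuous fun p : ℝ × ℝ => ctrlCost f σ p.1 p.2 := by
  unfold ctrlCost
  refine Continuous.div (by have := C.σ_cont; fun_prop) (by have := C.f_cont; fun_prop) ?_
  intro p
  have := C.f_pos p.2
  positivity

section root

variable {x a b ht hx : ℝ} (hht : 0 < ht) (hhx : 0 < hx)
include hht hhx

/-- Raising the central value strictly lowers both discrete derivatives. Below, `a` stands for the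
sum of the two lateral values at the next time level and `b` for the central one. -/
theorem node_pos_of_lt {y y' : ℝ} (hy : y < y')
    (h : 0 ≤ pricingOp f σ γ x ((b - y) / ht) ((a - 2 * y) / hx ^ 2)) :
    0 < pricingOp f σ γ x ((b - y') / ht) ((a - 2 * y') / hx ^ 2) := by
  refine C.pos_mono h ?_ ?_ <;> gcongr

theorem exists_node_root (wlo : ℝ) : ∃ z, min (z - wlo)
    (pricingOp f σ γ x ((b - z) / ht) ((a - 2 * z) / hx ^ 2)) = 0 := by
  set N : ℝ → ℝ := fun z => min (z - wlo)
    (pricingOp f σ γ x ((b - z) / ht) ((a - 2 * z) / hx ^ 2)) with hN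
  set y0 := (a - γ x * hx ^ 2) / 2 with hy0
  set Q := (s₀ / (ι * f₀)) ^ 2 / (2 * f₀)
  set Y := max y0 (max wlo (b + Q * ht)) with hY
  have hMle : ∀ y, y0 ≤ y → (a - 2 * y) / hx ^ 2 ≤ γ x := by
    intro y hy
    rw [div_le_iff₀ (by positivity)]
    linarith
  have hc : ContinuousOn N (Icc y0 Y) := by
    refine ContinuousOn.inf (by fun_prop) ?_
    unfold pricingOp
    refine ContinuousOn.inf ?_ (by fun_prop)
    refine ContinuousOn.sub (by fun_prop) ?_
    refine ContinuousOn.div (by fun_prop) (by fun_prop) ?_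
    intro y hy
    have := C.gap_pos (hMle y hy.1)
    positivity
  have h1 : N y0 ≤ 0 := by
    refine (min_le_right _ _).trans ((min_le_right _ _).trans ?_)
    have : (a - 2 * y0) / hx ^ 2 = γ x := by
      rw [hy0]; field_simp; ring
    rw [this]; simp
  have h2 : 0 ≤ N Y := by
    have hY1 : y0 ≤ Y := le_max_left _ _
    have hY2 : wlo ≤ Y := (le_max_left _ _).trans (le_max_right _ _)
    have hY3 : b + Q * ht ≤ Y := (le_max_right _ _).trans (le_max_right _ _)
    refine le_min (by linarith) (pricingOp_nonneg_iff.2 ⟨hMle Y hY1, ?_⟩)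
    have := C.nonlin_le (hMle Y hY1)
    have : (b - Y) / ht ≤ -Q := by
      rw [div_le_iff₀ hht]; linarith
    linarith
  obtain ⟨z, _, hz⟩ := intermediate_value_Icc (le_max_left _ _ : y0 ≤ Y) hc ⟨h1, h2⟩
  exact ⟨z, hz⟩

/-- The part without the upper truncation is negative before its root `z` and positive after it,
although it need not be monotone across the singularity. The cap `whi` then moves the root to `min
whi z`. -/
theorem existsUnique_node (wlo whi : ℝ) : ∃! y, max (y - whi) (min (y - wlo)
    (pricingOp f σ γ x ((b - y) / ht) ((a - 2 * y) / hx ^ 2))) = 0 := by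
  set N : ℝ → ℝ := fun z => min (z - wlo)
    (pricingOp f σ γ x ((b - z) / ht) ((a - 2 * z) / hx ^ 2)) with hN
  obtain ⟨z, hz⟩ := C.exists_node_root (x := x) (a := a) (b := b) hht hhx wlo
  change N z = 0 at hz
  have hmono : ∀ y y', y < y' → 0 ≤ N y → 0 < N y' := by
    intro y y' hy h
    obtain ⟨h1, h2⟩ := le_min_iff.1 h
    exact lt_min (by linarith) (C.node_pos_of_lt hht hhx hy h2)
  have hneg : ∀ y, y < z → N y < 0 := by
    intro y hy
    by_contra h
    push Not at h
    exact absurd hz (hmono y z hy h).ne'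
  refine ⟨min whi z, ?_, ?_⟩
  · change max (min whi z - whi) (N (min whi z)) = 0
    rcases le_or_gt z whi with h | h
    · rw [min_eq_right h, hz]; exact max_eq_right (by linarith)
    · rw [min_eq_left h.le, sub_self]; exact max_eq_left (hneg _ h).le
  · intro y hy
    change max (y - whi) (N y) = 0 at hy
    have h1 : y - whi ≤ 0 := hy ▸ le_max_left _ _
    have h2 : N y ≤ 0 := hy ▸ le_max_right _ _
    have h3 : y ≤ z := by
      by_contra h
      push Not at h
      exact absurd h2 (not_le.2 (hmono z y h hz.ge))
    rcases max_choice (y - whi) (N y) with h | h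
    · rw [h] at hy
      rw [min_eq_left] <;> linarith
    · rw [h] at hy
      have : z ≤ y := by
        by_contra h'
        push Not at h'
        exact absurd hy (hneg y h').ne
      rw [min_eq_right] <;> linarith

end root

end CoeffBounds

end
end GammaHedging

/-! ### The scheme on the grid: solvability, discrete maximum principles, inactive truncations. -/

namespace GammaHedging
noncomputable section

theorem schemeOp_eq (f σ γ : ℝ → ℝ) (wlo : ℝ) (whi : ℝ → ℝ) (ht hx t x y : ℝ) (φ : ℝ × ℝ → ℝ) :
    schemeOp f σ γ wlo whi ht hx t x y φ = max (y - whi x) (min (y - wlo)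
      (pricingOp f σ γ x ((φ (t + ht, x) - y) / ht) (discG ht hx t x y φ))) := rfl

theorem grid_finite (ht hx xlo : ℝ) (nt nx : ℕ) : (grid ht hx xlo nt nx).Finite := by
  have : grid ht hx xlo nt nx ⊆ (fun p : ℕ × ℕ => ((p.1 : ℝ) * ht, xlo + (p.2 : ℝ) * hx)) ''
      (Set.Iic nt ×ˢ Set.Iic nx) := by
    rintro z ⟨i, j, hi, hj, rfl⟩
    exact ⟨(i, j), ⟨hi, hj⟩, rfl⟩
  exact (((Set.finite_Iic nt).prod (Set.finite_Iic nx)).image _).subset this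

section grid

variable {T ht hx xlo xhi : ℝ} {nt nx : ℕ} (hm : IsMesh T ht hx xlo xhi nt nx)
include hm

theorem grid_mem_Icc {z : ℝ × ℝ} (hz : z ∈ grid ht hx xlo nt nx) :
    z.1 ∈ Icc 0 T ∧ z.2 ∈ Icc xlo xhi := by
  obtain ⟨i, j, hi, hj, rfl⟩ := hz
  have h1 := hm.ht_pos
  have h2 := hm.hx_pos
  have h3 : (i : ℝ) ≤ nt := by exact_mod_cast hi
  have h4 : (j : ℝ) ≤ nx := by exact_mod_cast hj
  refine ⟨⟨by positivity, ?_⟩, ⟨?_, ?_⟩⟩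
  · rw [← hm.time_steps]; exact mul_le_mul_of_nonneg_right h3 h1.le
  · simp only [le_add_iff_nonneg_right]; positivity
  · have := hm.space_steps
    have h5 : (j : ℝ) * hx ≤ nx * hx := by gcongr
    simp only; linarith

theorem grid_interior {z : ℝ × ℝ} (hz : z ∈ grid ht hx xlo nt nx) (h1 : z.1 < T)
    (h2 : xlo < z.2) (h3 : z.2 < xhi) :
    ∃ i j : ℕ, i < nt ∧ 1 ≤ j ∧ j < nx ∧ z = (i * ht, xlo + j * hx) := by
  obtain ⟨i, j, hi, hj, rfl⟩ := hz
  have hht := hm.ht_pos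
  have hhx := hm.hx_pos
  refine ⟨i, j, ?_, ?_, ?_, rfl⟩
  · rw [← hm.time_steps] at h1
    exact_mod_cast lt_of_mul_lt_mul_right h1 hht.le
  · rcases Nat.eq_zero_or_pos j with h | h
    · simp [h] at h2
    · exact h
  · have h4 : xlo + j * hx < xlo + nx * hx := by rw [hm.space_steps]; simpa using h3
    exact_mod_cast lt_of_mul_lt_mul_right (lt_of_add_lt_add_left h4) hhx.le

theorem grid_neighbors {z : ℝ × ℝ} (hz : z ∈ grid ht hx xlo nt nx) (h1 : z.1 < T)
    (h2 : xlo < z.2) (h3 : z.2 < xhi) :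
    (z.1 + ht, z.2) ∈ grid ht hx xlo nt nx ∧ (z.1 + ht, z.2 + hx) ∈ grid ht hx xlo nt nx ∧
      (z.1 + ht, z.2 - hx) ∈ grid ht hx xlo nt nx := by
  obtain ⟨i, j, hi, hj, hj', rfl⟩ := grid_interior hm hz h1 h2 h3
  refine ⟨⟨i + 1, j, by omega, by omega, ?_⟩, ⟨i + 1, j + 1, by omega, by omega, ?_⟩,
    ⟨i + 1, j - 1, by omega, by omega, ?_⟩⟩
  · ext <;> push_cast <;> ring
  · ext <;> push_cast <;> ring
  · ext <;> push_cast [Nat.cast_sub hj] <;> ring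

theorem grid_time_le {z : ℝ × ℝ} (hz : z ∈ grid ht hx xlo nt nx) (h1 : z.1 < T) :
    z.1 + ht ≤ T := by
  obtain ⟨i, j, hi, hj, rfl⟩ := hz
  rw [← hm.time_steps] at h1 ⊢
  have hi' : i < nt := by exact_mod_cast lt_of_mul_lt_mul_right h1 hm.ht_pos.le
  have : ((i + 1 : ℕ) : ℝ) ≤ nt := by exact_mod_cast hi'
  have := mul_le_mul_of_nonneg_right this hm.ht_pos.le
  push_cast at this
  simp only
  linarith

/-- Backward induction along the time levels of the grid. -/
theorem grid_backward_induction {Q : ℝ × ℝ → Prop}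
    (hT : ∀ z ∈ grid ht hx xlo nt nx, z.1 = T → Q z)
    (hstep : ∀ z ∈ grid ht hx xlo nt nx, z.1 < T →
      (∀ z' ∈ grid ht hx xlo nt nx, z'.1 = z.1 + ht → Q z') → Q z) :
    ∀ z ∈ grid ht hx xlo nt nx, Q z := by
  have key : ∀ k : ℕ, ∀ i j : ℕ, i + k = nt → j ≤ nx → Q (i * ht, xlo + j * hx) := by
    intro k
    induction k with
    | zero =>
      intro i j hi hj
      refine hT _ ⟨i, j, by omega, hj, rfl⟩ ?_
      rw [← hm.time_steps]; simp at hi; simp [hi]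
    | succ k ih =>
      intro i j hi hj
      refine hstep _ ⟨i, j, by omega, hj, rfl⟩ ?_ ?_
      · rw [← hm.time_steps]
        have : (i : ℝ) < nt := by exact_mod_cast (by omega : i < nt)
        exact mul_lt_mul_of_pos_right this hm.ht_pos
      · rintro _ ⟨i', j', hi', hj', rfl⟩ h
        have h' : (i' : ℝ) * ht = (i + 1 : ℕ) * ht := by push_cast; simp only at h; linarith
        have h'' : (i' : ℝ) = (i + 1 : ℕ) := mul_right_cancel₀ hm.ht_pos.ne' h'
        have h3 : i' = i + 1 := by exact_mod_cast h''
        exact ih i' j' (by omega) hj'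
  rintro _ ⟨i, j, hi, hj, rfl⟩
  exact key (nt - i) i j (by omega) hj

end grid

section solution

variable {f σ γ G : ℝ → ℝ} {f₀ s₀ ι : ℝ} (C : CoeffBounds f σ γ f₀ s₀ ι)
variable {T ht hx xlo xhi : ℝ} {nt nx : ℕ} (hm : IsMesh T ht hx xlo xhi nt nx)
variable {wlo : ℝ} {whi : ℝ → ℝ} {u : ℝ × ℝ → ℝ}

theorem IsSchemeSolution.inner_eq
    (hu : IsSchemeSolution f σ γ G wlo whi ht hx xlo nt nx u)
    (hm : IsMesh T ht hx xlo xhi nt nx) {z : ℝ × ℝ} (hz : z ∈ grid ht hx xlo nt nx) (h1 : z.1 < T)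
    (h2 : xlo < z.2) (h3 : z.2 < xhi) :
    max (u z - whi z.2) (min (u z - wlo)
      (pricingOp f σ γ z.2 ((u (z.1 + ht, z.2) - u z) / ht)
        (discG ht hx z.1 z.2 (u z) u))) = 0 := by
  obtain ⟨i, j, hi, hj, hj', rfl⟩ := grid_interior hm hz h1 h2 h3
  have := hu.inner i j hi hj hj'
  rwa [schemeOp_eq] at this

theorem IsSchemeSolution.boundary_eq
    (hu : IsSchemeSolution f σ γ G wlo whi ht hx xlo nt nx u)
    (hm : IsMesh T ht hx xlo xhi nt nx) {z : ℝ × ℝ} (hz : z ∈ grid ht hx xlo nt nx)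
    (h : z.1 = T ∨ z.2 = xlo ∨ z.2 = xhi) : u z = G z.2 := by
  obtain ⟨i, j, hi, hj, rfl⟩ := hz
  refine hu.boundary i j hi hj ?_
  rcases h with h | h | h
  · left
    rw [← hm.time_steps] at h
    exact_mod_cast mul_right_cancel₀ hm.ht_pos.ne' h
  · right; left
    simp only [add_eq_left, mul_eq_zero, hm.hx_pos.ne', or_false] at h
    exact_mod_cast h
  · right; right
    have h4 : (j : ℝ) * hx = nx * hx := by rw [hm.space_steps]; simp only at h; linarith
    exact_mod_cast mul_right_cancel₀ hm.hx_pos.ne' h4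

theorem grid_cases (hm : IsMesh T ht hx xlo xhi nt nx) {z : ℝ × ℝ}
    (hz : z ∈ grid ht hx xlo nt nx) :
    (z.1 = T ∨ z.2 = xlo ∨ z.2 = xhi) ∨ (z.1 < T ∧ xlo < z.2 ∧ z.2 < xhi) := by
  obtain ⟨h1, h2⟩ := grid_mem_Icc hm hz
  rcases h1.2.eq_or_lt with h | h
  · exact Or.inl (Or.inl h)
  rcases h2.1.eq_or_lt with h' | h'
  · exact Or.inl (Or.inr (Or.inl h'.symm))
  rcases h2.2.eq_or_lt with h'' | h''
  · exact Or.inl (Or.inr (Or.inr h''))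
  exact Or.inr ⟨h, h', h''⟩

/-- Below the floor both entries of the maximum would be negative. -/
theorem scheme_solution_ge (hm : IsMesh T ht hx xlo xhi nt nx)
    (hu : IsSchemeSolution f σ γ G wlo whi ht hx xlo nt nx u)
    (hG : ∀ x, wlo ≤ G x) (hw : ∀ x, wlo < whi x) :
    ∀ z ∈ grid ht hx xlo nt nx, wlo ≤ u z := by
  intro z hz
  rcases grid_cases hm hz with h | ⟨h1, h2, h3⟩
  · rw [hu.boundary_eq hm hz h]; exact hG _
  · have a1 := hu.inner_eq hm hz h1 h2 h3
    by_contra h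
    push Not at h
    have h4 : u z - whi z.2 < 0 := by linarith [hw z.2]
    have h5 := min_le_left (u z - wlo) (pricingOp f σ γ z.2 ((u (z.1 + ht, z.2) - u z) / ht)
        (discG ht hx z.1 z.2 (u z) u))
    have : max (u z - whi z.2) (min (u z - wlo)
      (pricingOp f σ γ z.2 ((u (z.1 + ht, z.2) - u z) / ht)
        (discG ht hx z.1 z.2 (u z) u))) < 0 := max_lt h4 (by linarith)
    linarith

include C hm

/-- Apart from the unknown, a node equation involves only values one level later, so the levels are
filled backwards from `T`. -/
theorem exists_scheme_solution (G : ℝ → ℝ) (wlo : ℝ) (whi : ℝ → ℝ) :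
    ∃ u : ℝ × ℝ → ℝ, IsSchemeSolution f σ γ G wlo whi ht hx xlo nt nx u := by
  have hex : ∀ x b a : ℝ, ∃ y, max (y - whi x) (min (y - wlo)
      (pricingOp f σ γ x ((b - y) / ht) ((a - 2 * y) / hx ^ 2))) = 0 := fun x b a =>
    (C.existsUnique_node hm.ht_pos hm.hx_pos wlo (whi x)).exists
  choose Y hY using hex
  -- The index `k` counts the time steps remaining before `T`. The truncated subtraction `j - 1` is
  -- used only for `j ≥ 1`, the case `j = 0` being a boundary node.
  let U : ℕ → ℕ → ℝ := fun k => Nat.rec (fun j => G (xlo + j * hx))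
    (fun _ V j => if j = 0 ∨ j = nx then G (xlo + j * hx)
      else Y (xlo + j * hx) (V j) (V (j + 1) + V (j - 1))) k
  have hU0 : ∀ j, U 0 j = G (xlo + j * hx) := fun _ => rfl
  have hU1 : ∀ k j, U (k + 1) j = if j = 0 ∨ j = nx then G (xlo + j * hx)
      else Y (xlo + j * hx) (U k j) (U k (j + 1) + U k (j - 1)) := fun _ _ => rfl
  -- Off the grid the values are irrelevant; at the nodes the floors return the exact indices.
  let u : ℝ × ℝ → ℝ := fun p => U (nt - ⌊p.1 / ht⌋₊) ⌊(p.2 - xlo) / hx⌋₊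
  have hu : ∀ i j : ℕ, u (i * ht, xlo + j * hx) = U (nt - i) j := by
    intro i j
    simp only [u]
    rw [mul_div_cancel_right₀ _ hm.ht_pos.ne', add_sub_cancel_left,
      mul_div_cancel_right₀ _ hm.hx_pos.ne', Nat.floor_natCast, Nat.floor_natCast]
  refine ⟨u, ⟨?_, ?_⟩⟩
  · intro i j hi hj hj'
    have e1 : u (i * ht + ht, xlo + j * hx) = U (nt - (i + 1)) j := by
      rw [← hu]; congr 1; ext <;> push_cast <;> ring
    have e2 : u (i * ht + ht, xlo + j * hx + hx) = U (nt - (i + 1)) (j + 1) := by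
      rw [← hu]; congr 1; ext <;> push_cast <;> ring
    have e3 : u (i * ht + ht, xlo + j * hx - hx) = U (nt - (i + 1)) (j - 1) := by
      rw [← hu]; congr 1; ext <;> push_cast [Nat.cast_sub hj] <;> ring
    rw [schemeOp_eq, discG, e1, e2, e3, hu]
    have h1 : nt - i = (nt - (i + 1)) + 1 := by omega
    rw [h1, hU1, if_neg (by omega)]
    exact hY _ _ _
  · intro i j hi hj h
    rw [hu]
    rcases Nat.eq_zero_or_pos (nt - i) with h0 | h0
    · rw [h0, hU0]
    · obtain ⟨k, hk⟩ := Nat.exists_eq_add_of_lt h0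
      rw [zero_add] at hk
      rw [hk, hU1, if_pos (by omega)]

theorem scheme_solution_unique {u' : ℝ × ℝ → ℝ}
    (hu : IsSchemeSolution f σ γ G wlo whi ht hx xlo nt nx u)
    (hu' : IsSchemeSolution f σ γ G wlo whi ht hx xlo nt nx u') :
    EqOn u' u (grid ht hx xlo nt nx) := by
  refine grid_backward_induction hm ?_ ?_
  · intro z hz hzT
    rw [hu.boundary_eq hm hz (Or.inl hzT), hu'.boundary_eq hm hz (Or.inl hzT)]
  · intro z hz hzT ih
    rcases grid_cases hm hz with h | ⟨h1, h2, h3⟩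
    · rw [hu.boundary_eq hm hz h, hu'.boundary_eq hm hz h]
    · obtain ⟨n1, n2, n3⟩ := grid_neighbors hm hz h1 h2 h3
      have a1 := hu.inner_eq hm hz h1 h2 h3
      have a2 := hu'.inner_eq hm hz h1 h2 h3
      rw [discG] at a1 a2
      rw [ih _ n1 rfl, ih _ n2 rfl, ih _ n3 rfl] at a2
      exact (C.existsUnique_node hm.ht_pos hm.hx_pos wlo (whi z.2)).unique a2 a1

/-- Discrete maximum principle against a function of `x` with small second differences. -/
theorem grid_le_of_pricingOp_nonpos {E : ℝ → ℝ} {η A : ℝ} (hA : 0 ≤ A)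
    (hE : ∀ x h, E (x + h) + E (x - h) - 2 * E x ≤ η * h ^ 2) (hηγ : ∀ x, η ≤ γ x)
    (hηA : ∀ x, σ x ^ 2 * η / (2 * (1 - f x * η)) ≤ A)
    (hb : ∀ z ∈ grid ht hx xlo nt nx, (z.1 = T ∨ z.2 = xlo ∨ z.2 = xhi) → u z ≤ E z.2)
    (hi : ∀ z ∈ grid ht hx xlo nt nx, z.1 < T → xlo < z.2 → z.2 < xhi → E z.2 < u z →
      pricingOp f σ γ z.2 ((u (z.1 + ht, z.2) - u z) / ht) (discG ht hx z.1 z.2 (u z) u) ≤ 0) :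
    ∀ z ∈ grid ht hx xlo nt nx, u z ≤ E z.2 + A * (T - z.1) := by
  have hht := hm.ht_pos
  have hhx := hm.hx_pos
  have hbd : ∀ z ∈ grid ht hx xlo nt nx, (z.1 = T ∨ z.2 = xlo ∨ z.2 = xhi) →
      u z ≤ E z.2 + A * (T - z.1) := by
    intro z hz h
    have := (grid_mem_Icc hm hz).1.2
    nlinarith [hb z hz h]
  refine grid_backward_induction hm (fun z hz h => hbd z hz (Or.inl h)) ?_
  intro z hz hzT ih
  rcases grid_cases hm hz with h | ⟨h1, h2, h3⟩
  · exact hbd z hz h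
  obtain ⟨n1, n2, n3⟩ := grid_neighbors hm hz h1 h2 h3
  by_contra hcon
  push Not at hcon
  have i1 := ih _ n1 rfl
  have i2 := ih _ n2 rfl
  have i3 := ih _ n3 rfl
  simp only at i1 i2 i3
  -- The pair `(-A, η)` bounds the discrete jet of the barrier `E + A (T - t)`. Since `u` exceeds
  -- the barrier at `z` but not at the next level, its own differences are strictly smaller.
  have hbase : 0 ≤ pricingOp f σ γ z.2 (-A) η :=
    pricingOp_nonneg_iff.2 ⟨hηγ _, by linarith [hηA z.2]⟩
  have hpos : 0 < pricingOp f σ γ z.2 ((u (z.1 + ht, z.2) - u z) / ht)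
      (discG ht hx z.1 z.2 (u z) u) := by
    refine C.pos_mono hbase ?_ ?_
    · rw [div_lt_iff₀ hht]; linarith
    · rw [discG, div_lt_iff₀ (by positivity)]
      have := hE z.2 hx
      have : 0 ≤ A * ht := by positivity
      linarith
  refine absurd (hi z hz h1 h2 h3 ?_) (not_le.2 hpos)
  have : 0 ≤ A * (T - z.1) := mul_nonneg hA (by linarith)
  linarith

/-- Where `u > E ≥ wlo` the floor is inactive, so a vanishing maximum forces the operator to be
nonpositive; the cap can only help. -/
theorem scheme_solution_le (hu : IsSchemeSolution f σ γ G wlo whi ht hx xlo nt nx u)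
    {E : ℝ → ℝ} {η A : ℝ} (hA : 0 ≤ A)
    (hE : ∀ x h, E (x + h) + E (x - h) - 2 * E x ≤ η * h ^ 2) (hηγ : ∀ x, η ≤ γ x)
    (hηA : ∀ x, σ x ^ 2 * η / (2 * (1 - f x * η)) ≤ A) (hGE : ∀ x, G x ≤ E x)
    (hwE : ∀ x, wlo ≤ E x) :
    ∀ z ∈ grid ht hx xlo nt nx, u z ≤ E z.2 + A * (T - z.1) := by
  refine grid_le_of_pricingOp_nonpos C hm hA hE hηγ hηA
    (fun z hz h => (hu.boundary_eq hm hz h).trans_le (hGE _)) fun z hz h1 h2 h3 h4 => ?_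
  have a1 := hu.inner_eq hm hz h1 h2 h3
  by_contra hcon
  push Not at hcon
  have := le_max_right (u z - whi z.2) (min (u z - wlo)
      (pricingOp f σ γ z.2 ((u (z.1 + ht, z.2) - u z) / ht)
        (discG ht hx z.1 z.2 (u z) u)))
  have := lt_min (show 0 < u z - wlo by linarith [hwE z.2]) hcon
  linarith

end solution

/-- The truncations being inactive, the scheme reduces to the discretised pricing equation. -/
structure IsDiscreteSolution (f σ γ G : ℝ → ℝ) (T ht hx xlo xhi : ℝ) (nt nx : ℕ)
    (u : ℝ × ℝ → ℝ) : Prop where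
  inner : ∀ z ∈ grid ht hx xlo nt nx, z.1 < T → xlo < z.2 → z.2 < xhi →
    pricingOp f σ γ z.2 ((u (z.1 + ht, z.2) - u z) / ht) (discG ht hx z.1 z.2 (u z) u) = 0
  boundary : ∀ z ∈ grid ht hx xlo nt nx, (z.1 = T ∨ z.2 = xlo ∨ z.2 = xhi) → u z = G z.2

section discrete

variable {f σ γ G : ℝ → ℝ} {f₀ s₀ ι : ℝ} (C : CoeffBounds f σ γ f₀ s₀ ι)
variable {T ht hx xlo xhi : ℝ} {nt nx : ℕ} (hm : IsMesh T ht hx xlo xhi nt nx)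
variable {wlo : ℝ} {whi : ℝ → ℝ} {u : ℝ × ℝ → ℝ}
include C hm

/-- The cap is excluded by strictness. Where `u` equals the floor, its successors lie above the
floor, so the operator is nonpositive by `nonpos_of_jet_nonneg`, while the scheme makes it
nonnegative. -/
theorem IsSchemeSolution.isDiscreteSolution
    (hu : IsSchemeSolution f σ γ G wlo whi ht hx xlo nt nx u)
    (hlo : ∀ z ∈ grid ht hx xlo nt nx, wlo ≤ u z)
    (hhi : ∀ z ∈ grid ht hx xlo nt nx, u z < whi z.2) :
    IsDiscreteSolution f σ γ G T ht hx xlo xhi nt nx u := by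
  refine ⟨?_, fun z hz h => hu.boundary_eq hm hz h⟩
  intro z hz h1 h2 h3
  have a1 := hu.inner_eq hm hz h1 h2 h3
  obtain ⟨n1, n2, n3⟩ := grid_neighbors hm hz h1 h2 h3
  have hht := hm.ht_pos
  have hhx := hm.hx_pos
  set P := pricingOp f σ γ z.2 ((u (z.1 + ht, z.2) - u z) / ht) (discG ht hx z.1 z.2 (u z) u)
  have h4 : min (u z - wlo) P = 0 := by
    rcases max_choice (u z - whi z.2) (min (u z - wlo) P) with h | h
    · rw [h] at a1; linarith [hhi z hz]
    · rwa [h] at a1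
  rcases min_choice (u z - wlo) P with h | h
  · rw [h] at h4
    have hP : 0 ≤ P := by
      have := min_le_right (u z - wlo) P
      rw [h, h4] at this; exact this
    refine le_antisymm (C.nonpos_of_jet_nonneg ?_ ?_) hP
    · exact div_nonneg (by linarith [hlo _ n1]) hht.le
    · exact div_nonneg (by linarith [hlo _ n2, hlo _ n3]) (by positivity)
  · rwa [h] at h4

/-- The choice `s = 0` in the dual form bounds the time quotient with no reference to space, so the
bound propagates along each column of nodes. -/
theorem IsDiscreteSolution.ge_terminal
    (hu : IsDiscreteSolution f σ γ G T ht hx xlo xhi nt nx u) :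
    ∀ z ∈ grid ht hx xlo nt nx, G z.2 - s₀ ^ 2 / (2 * f₀) * (T - z.1) ≤ u z := by
  have hK : 0 ≤ s₀ ^ 2 / (2 * f₀) := by have := C.f₀_pos; positivity
  have hbd : ∀ z ∈ grid ht hx xlo nt nx, (z.1 = T ∨ z.2 = xlo ∨ z.2 = xhi) →
      G z.2 - s₀ ^ 2 / (2 * f₀) * (T - z.1) ≤ u z := by
    intro z hz h
    rw [hu.boundary z hz h]
    have := (grid_mem_Icc hm hz).1.2
    nlinarith
  refine grid_backward_induction hm (fun z hz h => hbd z hz (Or.inl h)) ?_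
  intro z hz hzT ih
  rcases grid_cases hm hz with h | ⟨h1, h2, h3⟩
  · exact hbd z hz h
  have i1 := ih _ (grid_neighbors hm hz h1 h2 h3).1 rfl
  have a1 := C.rate_le (hu.inner z hz h1 h2 h3).ge
  rw [div_le_iff₀ hm.ht_pos] at a1
  simp only at i1
  linarith

theorem IsDiscreteSolution.le_of_second_diff
    (hu : IsDiscreteSolution f σ γ G T ht hx xlo xhi nt nx u) {E : ℝ → ℝ} {η A : ℝ} (hA : 0 ≤ A)
    (hE : ∀ x h, E (x + h) + E (x - h) - 2 * E x ≤ η * h ^ 2) (hηγ : ∀ x, η ≤ γ x)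
    (hηA : ∀ x, σ x ^ 2 * η / (2 * (1 - f x * η)) ≤ A) (hGE : ∀ x, G x ≤ E x) :
    ∀ z ∈ grid ht hx xlo nt nx, u z ≤ E z.2 + A * (T - z.1) :=
  grid_le_of_pricingOp_nonpos C hm hA hE hηγ hηA
    (fun z hz h => (hu.boundary z hz h).trans_le (hGE _))
    fun z hz h1 h2 h3 _ => (hu.inner z hz h1 h2 h3).le

/-- Discrete comparison on `|x| ≤ R` with a strict discrete supersolution. -/
theorem IsDiscreteSolution.le_of_barrier
    (hu : IsDiscreteSolution f σ γ G T ht hx xlo xhi nt nx u) {W : ℝ × ℝ → ℝ} {R : ℝ}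
    (hlo : xlo ≤ -R) (hhi : R ≤ xhi)
    (hT : ∀ x, |x| ≤ R → G x ≤ W (T, x))
    (hlat : ∀ z ∈ grid ht hx xlo nt nx, R - 1 ≤ |z.2| → |z.2| ≤ R → u z ≤ W z)
    (hW : ∀ t x, 0 ≤ t → t + ht ≤ T → |x| ≤ R →
      0 ≤ pricingOp f σ γ x ((W (t + ht, x) - W (t, x)) / ht) (discG ht hx t x (W (t, x)) W)) :
    ∀ z ∈ grid ht hx xlo nt nx, |z.2| ≤ R → u z ≤ W z := by
  have hht := hm.ht_pos
  have hhx := hm.hx_pos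
  refine grid_backward_induction hm ?_ ?_
  · intro z hz h hR
    rw [hu.boundary z hz (Or.inl h)]
    have := hT z.2 hR
    rwa [← h] at this
  intro z hz hzT ih hR
  -- The strip `R - 1 ≤ |x| ≤ R` serves as lateral boundary: as `hx < 1`, the neighbours of a node
  -- inside `|x| < R - 1` remain in `|x| ≤ R`.
  rcases le_or_gt (R - 1) |z.2| with h | h
  · exact hlat z hz h hR
  have hR' := abs_lt.1 h
  have h2 : xlo < z.2 := by linarith
  have h3 : z.2 < xhi := by linarith
  obtain ⟨n1, n2, n3⟩ := grid_neighbors hm hz hzT h2 h3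
  have hx1 := hm.hx_lt_one
  have i1 := ih _ n1 rfl hR
  have i2 := ih _ n2 rfl (abs_le.2 ⟨by simp only; linarith, by simp only; linarith⟩)
  have i3 := ih _ n3 rfl (abs_le.2 ⟨by simp only; linarith, by simp only; linarith⟩)
  by_contra hcon
  push Not at hcon
  have hpos := C.pos_mono (q := (u (z.1 + ht, z.2) - u z) / ht)
    (M := discG ht hx z.1 z.2 (u z) u)
    (hW z.1 z.2 (grid_mem_Icc hm hz).1.1 (grid_time_le hm hz hzT) hR)
    (by change _ < (W (z.1 + ht, z.2) - W z) / ht; gcongr ?_ / _; linarith)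
    (by
      change (u (z.1 + ht, z.2 + hx) + u (z.1 + ht, z.2 - hx) - 2 * u z) / hx ^ 2 <
        (W (z.1 + ht, z.2 + hx) + W (z.1 + ht, z.2 - hx) - 2 * W z) / hx ^ 2
      gcongr ?_ / _
      linarith)
  exact absurd (hu.inner z hz hzT h2 h3) hpos.ne'

end discrete

end
end GammaHedging

/-! ### Derivatives of test functions and consistency of finite differences. -/

namespace GammaHedging
noncomputable section

open Filter Topology

section second_difference

variable {ψ ψ' ψ'' : ℝ → ℝ}

/-- Two integrations: the mean value inequality bounds `ψ'(x + s) - ψ'(x - s)` by `2ms`, so `ψ(x +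
s) + ψ(x - s) - m s²` decreases in `s`. -/
theorem second_diff_le (h1 : ∀ y, HasDerivAt ψ (ψ' y) y) (h2 : ∀ y, HasDerivAt ψ' (ψ'' y) y)
    {x h m : ℝ} (hh : 0 ≤ h) (hm : ∀ y ∈ Icc (x - h) (x + h), ψ'' y ≤ m) :
    ψ (x + h) + ψ (x - h) - 2 * ψ x ≤ m * h ^ 2 := by
  have hslope : ∀ s ∈ Icc 0 h, ψ' (x + s) - ψ' (x - s) ≤ m * (2 * s) := by
    intro s hs
    have := Convex.image_sub_le_mul_sub_of_deriv_le (D := Icc (x - h) (x + h))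
      (convex_Icc _ _) (f := ψ') (fun y _ => (h2 y).continuousAt.continuousWithinAt)
      (fun y _ => (h2 y).differentiableAt.differentiableWithinAt) (C := m)
      (fun y hy => by rw [(h2 y).deriv]; exact hm y (interior_subset hy))
      (x - s) ⟨by linarith [hs.2], by linarith [hs.1, hs.2]⟩
      (x + s) ⟨by linarith [hs.1, hs.2], by linarith [hs.2]⟩ (by linarith [hs.1])
    linarith
  have hF : ∀ s, HasDerivAt (fun s => ψ (x + s) + ψ (x - s) - m * s ^ 2)
      (ψ' (x + s) - ψ' (x - s) - m * (2 * s)) s := by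
    intro s
    have a1 : HasDerivAt (fun s => ψ (x + s)) (ψ' (x + s)) s := by
      simpa using (h1 (x + s)).comp_const_add x s
    have a2 : HasDerivAt (fun s => ψ (x - s)) (-ψ' (x - s)) s := by
      simpa using (h1 (x - s)).comp_const_sub x s
    have a3 : HasDerivAt (fun s : ℝ => m * s ^ 2) (m * (2 * s)) s := by
      simpa using (hasDerivAt_pow 2 s).const_mul m
    exact ((a1.add a2).sub a3).congr_deriv (by ring)
  have hanti : AntitoneOn (fun s => ψ (x + s) + ψ (x - s) - m * s ^ 2) (Icc 0 h) := by
    apply antitoneOn_of_deriv_nonpos (convex_Icc _ _)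
    · exact fun s _ => (hF s).continuousAt.continuousWithinAt
    · exact fun s _ => (hF s).differentiableAt.differentiableWithinAt
    · intro s hs
      rw [(hF s).deriv]
      linarith [hslope s (interior_subset hs)]
  have := hanti ⟨le_rfl, hh⟩ ⟨hh, le_rfl⟩ hh
  simp at this
  linarith

theorem le_second_diff (h1 : ∀ y, HasDerivAt ψ (ψ' y) y) (h2 : ∀ y, HasDerivAt ψ' (ψ'' y) y)
    {x h m : ℝ} (hh : 0 ≤ h) (hm : ∀ y ∈ Icc (x - h) (x + h), m ≤ ψ'' y) :
    m * h ^ 2 ≤ ψ (x + h) + ψ (x - h) - 2 * ψ x := by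
  have := second_diff_le (ψ := fun y => -ψ y) (ψ' := fun y => -ψ' y) (ψ'' := fun y => -ψ'' y)
    (fun y => (h1 y).neg) (fun y => (h2 y).neg) (x := x) (m := -m) hh
    (fun y hy => by linarith [hm y hy])
  linarith

end second_difference

/-- Time derivative of a function of `(t, x)`. -/
def dT (φ : ℝ × ℝ → ℝ) (p : ℝ × ℝ) : ℝ := deriv (fun s => φ (s, p.2)) p.1

/-- Space derivative of a function of `(t, x)`. -/
def dX (φ : ℝ × ℝ → ℝ) (p : ℝ × ℝ) : ℝ := deriv (fun z => φ (p.1, z)) p.2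

/-- Second space derivative of a function of `(t, x)`. -/
def dXX (φ : ℝ × ℝ → ℝ) (p : ℝ × ℝ) : ℝ := iteratedDeriv 2 (fun z => φ (p.1, z)) p.2

theorem pricingOpOn_eq (f σ γ : ℝ → ℝ) (φ : ℝ × ℝ → ℝ) (t x : ℝ) :
    pricingOpOn f σ γ φ t x = pricingOp f σ γ x (dT φ (t, x)) (dXX φ (t, x)) := rfl

section smooth

variable {φ : ℝ × ℝ → ℝ} (hφ : ContDiff ℝ 2 φ)
include hφ

theorem hasDerivAt_dT (p : ℝ × ℝ) : HasDerivAt (fun s => φ (s, p.2)) (dT φ p) p.1 := by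
  refine DifferentiableAt.hasDerivAt ?_
  have : Differentiable ℝ fun s => φ (s, p.2) :=
    (hφ.differentiable (by norm_num)).comp (by fun_prop)
  exact this _

theorem hasDerivAt_dX (p : ℝ × ℝ) : HasDerivAt (fun z => φ (p.1, z)) (dX φ p) p.2 := by
  refine DifferentiableAt.hasDerivAt ?_
  have : Differentiable ℝ fun z => φ (p.1, z) :=
    (hφ.differentiable (by norm_num)).comp (by fun_prop)
  exact this _

theorem dT_eq_fderiv : dT φ = fun p => fderiv ℝ φ p (1, 0) := by
  ext p
  have h := ((hφ.differentiable (by norm_num)) p).hasFDerivAt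
  have h2 : HasDerivAt (fun s : ℝ => (s, p.2)) ((1 : ℝ), (0 : ℝ)) p.1 :=
    (hasDerivAt_id _).prodMk (hasDerivAt_const _ _)
  exact (h.comp_hasDerivAt p.1 h2).deriv

theorem dX_eq_fderiv : dX φ = fun p => fderiv ℝ φ p (0, 1) := by
  ext p
  have h := ((hφ.differentiable (by norm_num)) p).hasFDerivAt
  have h2 : HasDerivAt (fun s : ℝ => (p.1, s)) ((0 : ℝ), (1 : ℝ)) p.2 :=
    (hasDerivAt_const _ _).prodMk (hasDerivAt_id _)
  exact (h.comp_hasDerivAt p.2 h2).deriv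

theorem contDiff_dX : ContDiff ℝ 1 (dX φ) := by
  rw [dX_eq_fderiv hφ]
  exact (hφ.fderiv_right (m := 1) (by norm_num)).clm_apply contDiff_const

theorem continuous_dT : Continuous (dT φ) := by
  rw [dT_eq_fderiv hφ]
  exact (hφ.continuous_fderiv (by norm_num)).clm_apply continuous_const

theorem hasDerivAt_dXX (p : ℝ × ℝ) : HasDerivAt (fun z => dX φ (p.1, z)) (dXX φ p) p.2 := by
  have h : dXX φ p = deriv (fun z => dX φ (p.1, z)) p.2 := by
    unfold dXX
    rw [iteratedDeriv_succ, iteratedDeriv_one]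
    rfl
  rw [h]
  refine DifferentiableAt.hasDerivAt ?_
  have : Differentiable ℝ fun z => dX φ (p.1, z) :=
    ((contDiff_dX hφ).differentiable (by norm_num)).comp (by fun_prop)
  exact this _

theorem continuous_dXX : Continuous (dXX φ) := by
  have h : dXX φ = fun p => fderiv ℝ (dX φ) p (0, 1) := by
    ext p
    have h : HasFDerivAt (dX φ) (fderiv ℝ (dX φ) p) (p.1, p.2) :=
      (((contDiff_dX hφ).differentiable (by norm_num)) p).hasFDerivAt
    have h2 : HasDerivAt (fun s : ℝ => (p.1, s)) ((0 : ℝ), (1 : ℝ)) p.2 :=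
      (hasDerivAt_const _ _).prodMk (hasDerivAt_id _)
    have h3 : HasDerivAt (fun z => dX φ (p.1, z)) (fderiv ℝ (dX φ) p (0, 1)) p.2 :=
      HasFDerivAt.comp_hasDerivAt (f := fun s : ℝ => (p.1, s)) p.2 h h2
    exact (hasDerivAt_dXX hφ p).unique h3
  rw [h]
  exact ((contDiff_dX hφ).continuous_fderiv (by norm_num)).clm_apply continuous_const

/-- Consistency of the finite differences with the derivatives, when `ht / hx² → 0`. -/
theorem consistency_at (p : ℝ × ℝ) {κ : ℝ} (hκ : 0 < κ) :
    ∃ δ > 0, ∀ t x ht hx : ℝ, dist (t, x) p < δ → 0 < ht → 0 < hx → hx < δ → ht / hx ^ 2 < δ →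
      |(φ (t + ht, x) - φ (t, x)) / ht - dT φ p| < κ ∧
        |discG ht hx t x (φ (t, x)) φ - dXX φ p| < κ := by
  set B := |dT φ p| + κ with hB
  have hBpos : 0 < B := by positivity
  obtain ⟨r1, hr1, H1⟩ := Metric.continuous_iff.1 (continuous_dT hφ) p (κ / 2) (by positivity)
  obtain ⟨r2, hr2, H2⟩ := Metric.continuous_iff.1 (continuous_dXX hφ) p (κ / 2) (by positivity)
  refine ⟨min 1 (min (r1 / 2) (min (r2 / 2) (κ / (4 * B)))), by positivity, ?_⟩
  intro t x ht hx hd hht hhx hxδ hr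
  simp only [lt_min_iff] at hd hxδ hr
  obtain ⟨-, hd1, hd2, -⟩ := hd
  obtain ⟨hx1, hx2, hx3, -⟩ := hxδ
  obtain ⟨hq1, hq2, hq3, hq4⟩ := hr
  have hxx : hx ^ 2 < 1 := by nlinarith
  have hle : ht ≤ ht / hx ^ 2 := by
    rw [le_div_iff₀ (by positivity)]; nlinarith
  rw [Prod.dist_eq, max_lt_iff] at hd1 hd2
  simp only [Real.dist_eq] at hd1 hd2
  have hT : ∀ s ∈ Icc t (t + ht), |dT φ (s, x) - dT φ p| < κ / 2 := by
    intro s hs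
    rw [← Real.dist_eq]
    refine H1 (s, x) ?_
    rw [Prod.dist_eq, max_lt_iff]
    simp only [Real.dist_eq]
    refine ⟨?_, by linarith⟩
    have h3 : |s - t| ≤ ht := by rw [abs_le]; constructor <;> linarith [hs.1, hs.2]
    have := abs_sub_le s t p.1
    linarith
  have hX : ∀ y ∈ Icc (x - hx) (x + hx), |dXX φ (t + ht, y) - dXX φ p| < κ / 2 := by
    intro y hy
    rw [← Real.dist_eq]
    refine H2 (t + ht, y) ?_
    rw [Prod.dist_eq, max_lt_iff]
    simp only [Real.dist_eq]
    constructor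
    · have := abs_sub_le (t + ht) t p.1
      have h3 : |t + ht - t| = ht := by rw [add_sub_cancel_left, abs_of_pos hht]
      linarith
    · have := abs_sub_le y x p.2
      have h3 : |y - x| ≤ hx := by rw [abs_le]; constructor <;> linarith [hy.1, hy.2]
      linarith
  obtain ⟨c, hc, hceq⟩ := exists_hasDerivAt_eq_slope (fun s => φ (s, x)) (fun s => dT φ (s, x))
    (show t < t + ht by linarith)
    (fun s _ => (hasDerivAt_dT hφ (s, x)).continuousAt.continuousWithinAt)
    (fun s _ => hasDerivAt_dT hφ (s, x))
  rw [add_sub_cancel_left] at hceq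
  have hc' := hT c ⟨hc.1.le, hc.2.le⟩
  rw [hceq] at hc'
  refine ⟨by linarith, ?_⟩
  have up := second_diff_le (ψ := fun y => φ (t + ht, y))
    (ψ' := fun y => dX φ (t + ht, y)) (ψ'' := fun y => dXX φ (t + ht, y))
    (fun y => hasDerivAt_dX hφ (t + ht, y))
    (fun y => hasDerivAt_dXX hφ (t + ht, y)) (x := x) hhx.le (m := dXX φ p + κ / 2)
    (fun y hy => by linarith [(abs_lt.1 (hX y hy)).2])
  have lo := le_second_diff (ψ := fun y => φ (t + ht, y))
    (ψ' := fun y => dX φ (t + ht, y)) (ψ'' := fun y => dXX φ (t + ht, y))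
    (fun y => hasDerivAt_dX hφ (t + ht, y))
    (fun y => hasDerivAt_dXX hφ (t + ht, y)) (x := x) hhx.le (m := dXX φ p - κ / 2)
    (fun y hy => by linarith [(abs_lt.1 (hX y hy)).1])
  have hx2 : 0 < hx ^ 2 := by positivity
  -- The centre value of `discG` is taken at time `t`, the lateral ones at `t + ht`. The mismatch is
  -- twice the bounded time quotient times `ht / hx²`, which is why this ratio must tend to zero.
  have hdec : discG ht hx t x (φ (t, x)) φ =
      (φ (t + ht, x + hx) + φ (t + ht, x - hx) - 2 * φ (t + ht, x)) / hx ^ 2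
        + 2 * ((φ (t + ht, x) - φ (t, x)) / ht) * (ht / hx ^ 2) := by
    unfold discG; field_simp; ring
  have hsl : |(φ (t + ht, x) - φ (t, x)) / ht| ≤ B := by
    have := abs_sub_abs_le_abs_sub ((φ (t + ht, x) - φ (t, x)) / ht) (dT φ p)
    linarith
  have hsm : |2 * ((φ (t + ht, x) - φ (t, x)) / ht) * (ht / hx ^ 2)| < κ / 2 := by
    rw [abs_mul, abs_mul, abs_of_pos (show (0 : ℝ) < 2 by norm_num),
      abs_of_pos (show 0 < ht / hx ^ 2 by positivity)]
    rw [lt_div_iff₀ (by positivity)] at hq4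
    have : 0 ≤ ht / hx ^ 2 := by positivity
    nlinarith
  have h1 : (φ (t + ht, x + hx) + φ (t + ht, x - hx) - 2 * φ (t + ht, x)) / hx ^ 2
      ≤ dXX φ p + κ / 2 := by rwa [div_le_iff₀ hx2]
  have h2 : dXX φ p - κ / 2 ≤
      (φ (t + ht, x + hx) + φ (t + ht, x - hx) - 2 * φ (t + ht, x)) / hx ^ 2 := by
    rwa [le_div_iff₀ hx2]
  rw [hdec, abs_lt]
  rw [abs_lt] at hsm
  constructor <;> linarith

end smooth

end
end GammaHedging

/-! ### Relaxed limits of grid functions and their contact with test functions. -/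

namespace GammaHedging
noncomputable section

open Filter Topology

/-- `w` is the lower relaxed limit on `K` of the grid functions `val S`, `S : α`, as `Fine δ S` with
`δ → 0`. -/
structure IsLowerLimit {α : Type*} (Fine : ℝ → α → Prop) (nodes : α → Set (ℝ × ℝ))
    (val : α → ℝ × ℝ → ℝ) (K : Set (ℝ × ℝ)) (w : ℝ × ℝ → ℝ) : Prop where
  lower : ∀ p ∈ K, ∀ ε > 0, ∃ δ > 0, ∀ S, Fine δ S → ∀ z ∈ nodes S, dist z p < δ →
    w p - ε < val S z
  attained : ∀ p ∈ K, ∀ ε > 0, ∀ δ > 0, ∃ S, Fine δ S ∧ ∃ z ∈ nodes S, dist z p < δ ∧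
    val S z < w p + ε

section relaxed

variable {α : Type*} {Fine : ℝ → α → Prop} {nodes : α → Set (ℝ × ℝ)}
  {val : α → ℝ × ℝ → ℝ} {K : Set (ℝ × ℝ)} {w : ℝ × ℝ → ℝ}

theorem exists_lowerLimit
    (hdense : ∀ p ∈ K, ∀ δ > 0, ∃ S, Fine δ S ∧ ∃ z ∈ nodes S, dist z p < δ)
    (hmono : ∀ δ δ' S, δ ≤ δ' → Fine δ S → Fine δ' S)
    {lo hi : ℝ × ℝ → ℝ} (hlo : Continuous lo) (hhi : Continuous hi)
    (hb : ∀ S, Fine 1 S → ∀ z ∈ nodes S, lo z ≤ val S z ∧ val S z ≤ hi z) :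
    ∃ w, IsLowerLimit Fine nodes val K w ∧ ∀ p ∈ K, lo p ≤ w p ∧ w p ≤ hi p := by
  -- Eventual lower bounds near `p`; their supremum is the lower limit. Density of the nodes makes
  -- this set bounded above.
  let A : ℝ × ℝ → Set ℝ := fun p => {m | ∃ δ > 0, ∀ S, Fine δ S → ∀ z ∈ nodes S, dist z p < δ →
    m ≤ val S z}
  have hlow : ∀ p, ∀ ε > 0, lo p - ε ∈ A p := by
    intro p ε hε
    obtain ⟨r, hr, H⟩ := Metric.continuous_iff.1 hlo p ε hε
    refine ⟨min 1 r, by positivity, fun S hS z hz hd => ?_⟩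
    have h1 := (hb S (hmono _ _ S (min_le_left _ _) hS) z hz).1
    have h2 := H z (hd.trans_le (min_le_right _ _))
    rw [Real.dist_eq, abs_lt] at h2
    linarith
  have hup : ∀ p ∈ K, ∀ m ∈ A p, m ≤ hi p := by
    rintro p hp m ⟨δ, hδ, hm⟩
    refine le_of_forall_pos_le_add fun ε hε => ?_
    obtain ⟨r, hr, H⟩ := Metric.continuous_iff.1 hhi p ε hε
    obtain ⟨S, hS, z, hz, hd⟩ := hdense p hp (min 1 (min δ r)) (by positivity)
    simp only [lt_min_iff] at hd
    have h1 := (hb S (hmono _ _ S (min_le_left _ _) hS) z hz).2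
    have h2 := hm S (hmono _ _ S ((min_le_right _ _).trans (min_le_left _ _)) hS) z hz hd.2.1
    have h3 := H z hd.2.2
    rw [Real.dist_eq, abs_lt] at h3
    linarith
  have hbdd : ∀ p ∈ K, BddAbove (A p) := fun p hp => ⟨hi p, fun m hm => hup p hp m hm⟩
  have hne : ∀ p, (A p).Nonempty := fun p => ⟨_, hlow p 1 one_pos⟩
  refine ⟨fun p => sSup (A p), ⟨?_, ?_⟩, ?_⟩
  · intro p hp ε hε
    obtain ⟨m, ⟨δ, hδ, hm⟩, hlt⟩ := exists_lt_of_lt_csSup (hne p)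
      (show sSup (A p) - ε < sSup (A p) by linarith)
    exact ⟨δ, hδ, fun S hS z hz hd => hlt.trans_le (hm S hS z hz hd)⟩
  · intro p hp ε hε δ hδ
    by_contra hcon
    push Not at hcon
    have : sSup (A p) + ε ∈ A p := ⟨δ, hδ, fun S hS z hz hd => hcon S hS z hz hd⟩
    linarith [le_csSup (hbdd p hp) this]
  · intro p hp
    refine ⟨le_of_forall_pos_le_add fun ε hε => ?_, csSup_le (hne p) (hup p hp)⟩
    linarith [le_csSup (hbdd p hp) (hlow p ε hε)]

namespace IsLowerLimit

/-- A value at `p'` is nearly attained at a node close to `p'`, hence close to `p`, where the lower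
bound for `p` applies. -/
theorem lowerSemicontinuousOn (h : IsLowerLimit Fine nodes val K w) (hmono : ∀ δ δ' S, δ ≤ δ' → Fine δ S → Fine δ' S) :
    LowerSemicontinuousOn w K := by
  intro p hp y hy
  obtain ⟨δ, hδ, H⟩ := h.lower p hp ((w p - y) / 2) (by linarith)
  have : Metric.ball p (δ / 2) ∩ K ∈ 𝓝[K] p :=
    inter_mem (mem_nhdsWithin_of_mem_nhds (Metric.ball_mem_nhds p (by positivity)))
      self_mem_nhdsWithin
  filter_upwards [this] with p' hp'
  obtain ⟨S, hS, z, hz, hd, hv⟩ := h.attained p' hp'.2 ((w p - y) / 2) (by linarith) (δ / 2)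
    (by positivity)
  have h1 := H S (hmono _ _ S (by linarith) hS) z hz (by
    have := dist_triangle z p' p
    have := Metric.mem_ball.1 hp'.1
    linarith)
  linarith

/-- Uniformity of the lower bound on compact sets. -/
theorem compact_lower (h : IsLowerLimit Fine nodes val K w)
    (hmono : ∀ δ δ' S, δ ≤ δ' → Fine δ S → Fine δ' S) {A : Set (ℝ × ℝ)} (hA : IsCompact A)
    (hAK : A ⊆ K) {ψ : ℝ × ℝ → ℝ} (hψ : ContinuousOn ψ A) (hlt : ∀ p ∈ A, ψ p < w p) :
    ∃ δ > 0, ∀ S, Fine δ S → ∀ z ∈ nodes S, z ∈ A → ψ z < val S z := by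
  have key : ∃ δ > 0, ∀ S, Fine δ S → ∀ z ∈ nodes S, z ∈ A → z ∈ A → ψ z < val S z := by
    refine hA.induction_on (p := fun s => ∃ δ > 0, ∀ S, Fine δ S → ∀ z ∈ nodes S, z ∈ A → z ∈ s →
      ψ z < val S z) ?_ ?_ ?_ ?_
    · exact ⟨1, one_pos, fun S _ z _ _ hz => absurd hz (notMem_empty z)⟩
    · rintro s t hst ⟨δ, hδ, H⟩
      exact ⟨δ, hδ, fun S hS z hz hzA hzs => H S hS z hz hzA (hst hzs)⟩
    · rintro s t ⟨δ, hδ, H⟩ ⟨δ', hδ', H'⟩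
      refine ⟨min δ δ', by positivity, fun S hS z hz hzA hzs => ?_⟩
      rcases hzs with hzs | hzs
      · exact H S (hmono _ _ S (min_le_left _ _) hS) z hz hzA hzs
      · exact H' S (hmono _ _ S (min_le_right _ _) hS) z hz hzA hzs
    · intro p hp
      have hε : 0 < (w p - ψ p) / 2 := by linarith [hlt p hp]
      obtain ⟨δ, hδ, H⟩ := h.lower p (hAK hp) _ hε
      have h1 : ∀ᶠ z in 𝓝[A] p, ψ z < ψ p + (w p - ψ p) / 2 :=
        (hψ p hp).eventually_lt_const (by linarith)
      refine ⟨{z | ψ z < ψ p + (w p - ψ p) / 2} ∩ Metric.ball p δ,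
        inter_mem h1 (mem_nhdsWithin_of_mem_nhds (Metric.ball_mem_nhds p hδ)), δ, hδ, ?_⟩
      intro S hS z hz _ hzs
      have := H S hS z hz hzs.2
      have h2 : ψ z < ψ p + (w p - ψ p) / 2 := hzs.1
      linarith
  obtain ⟨δ, hδ, H⟩ := key
  exact ⟨δ, hδ, fun S hS z hz hzA => H S hS z hz hzA hzA⟩

/-- A strict local minimum of `w - φ` is approximated by minima over the nodes of fine grids. -/
theorem exists_touching (h : IsLowerLimit Fine nodes val K w)
    (hmono : ∀ δ δ' S, δ ≤ δ' → Fine δ S → Fine δ' S)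
    (hfin : ∀ S, (nodes S).Finite) (hnodes : ∀ S, Fine 1 S → nodes S ⊆ K)
    {φ : ℝ × ℝ → ℝ} (hφ : Continuous φ) {p : ℝ × ℝ} (hp : p ∈ K) {r : ℝ} (hr : 0 < r)
    (hK : IsCompact (Metric.closedBall p r ∩ K))
    (hmin : ∀ z ∈ Metric.closedBall p r ∩ K, z ≠ p → w p - φ p < w z - φ z)
    {δ r' : ℝ} (hδ : 0 < δ) (hr' : 0 < r') :
    ∃ S, Fine δ S ∧ ∃ m ∈ nodes S, dist m p < r' ∧
      ∀ z ∈ nodes S, dist z p ≤ r → val S m - φ m ≤ val S z - φ z := by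
  set A := (Metric.closedBall p r ∩ K) \ Metric.ball p r' with hA
  have hAc : IsCompact A := hK.diff Metric.isOpen_ball
  have hAK : A ⊆ K := fun z hz => hz.1.2
  -- Away from `p`, compactness turns strictness into a margin `κ`, which fine grids inherit by
  -- `compact_lower`. A discrete minimiser therefore lies within `r'` of `p`.
  have hκ : ∃ κ > 0, ∀ z ∈ A, w p - φ p + κ < w z - φ z := by
    rcases A.eq_empty_or_nonempty with h0 | h0
    · exact ⟨1, one_pos, fun z hz => absurd hz (by rw [h0]; exact notMem_empty z)⟩
    have hl : LowerSemicontinuousOn (fun z => w z + -φ z) A :=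
      ((h.lowerSemicontinuousOn hmono).mono hAK).add
        (hφ.neg.lowerSemicontinuous.lowerSemicontinuousOn _)
    obtain ⟨z0, hz0, hz0'⟩ := hl.exists_isMinOn h0 hAc
    have hne : z0 ≠ p := fun he => hz0.2 (he ▸ Metric.mem_ball_self hr')
    have := hmin z0 hz0.1 hne
    refine ⟨(w z0 - φ z0 - (w p - φ p)) / 2, by linarith, fun z hz => ?_⟩
    have h2 : w z0 + -φ z0 ≤ w z + -φ z := hz0' hz
    linarith
  obtain ⟨κ, hκ, hκA⟩ := hκ
  obtain ⟨δ1, hδ1, H1⟩ := h.compact_lower hmono hAc hAK (ψ := fun z => φ z + (w p - φ p + κ))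
    (by fun_prop) (fun z hz => by linarith [hκA z hz])
  obtain ⟨δ2, hδ2, H2⟩ := Metric.continuous_iff.1 hφ p (κ / 2) (by positivity)
  obtain ⟨S, hS, z0, hz0, hd0, hv0⟩ := h.attained p hp (κ / 2) (by positivity)
    (min 1 (min δ (min δ1 (min δ2 r)))) (by positivity)
  simp only [lt_min_iff] at hd0
  have hS1 : Fine 1 S := hmono _ _ S (min_le_left _ _) hS
  have hSδ : Fine δ S := hmono _ _ S ((min_le_right _ _).trans (min_le_left _ _)) hS
  have hSδ1 : Fine δ1 S := hmono _ _ S ((min_le_right _ _).trans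
    ((min_le_right _ _).trans (min_le_left _ _))) hS
  have hfinB : (nodes S ∩ Metric.closedBall p r).Finite := (hfin S).subset inter_subset_left
  obtain ⟨m, hm, hmmin⟩ := Set.exists_min_image _ (fun z => val S z - φ z) hfinB
    ⟨z0, hz0, Metric.mem_closedBall.2 hd0.2.2.2.2.le⟩
  refine ⟨S, hSδ, m, hm.1, ?_, fun z hz hd => hmmin z ⟨hz, Metric.mem_closedBall.2 hd⟩⟩
  by_contra hcon
  have hmA : m ∈ A := ⟨⟨hm.2, hnodes S hS1 hm.1⟩, fun hb => hcon (Metric.mem_ball.1 hb)⟩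
  have h3 := H1 S hSδ1 m hm.1 hmA
  have h4 := hmmin z0 ⟨hz0, Metric.mem_closedBall.2 hd0.2.2.2.2.le⟩
  have h5 := H2 z0 hd0.2.2.2.1
  rw [Real.dist_eq, abs_lt] at h5
  linarith

end IsLowerLimit

end relaxed

/-- A mesh together with a grid function. -/
structure MeshFn where
  (ht hx xlo xhi : ℝ)
  (nt nx : ℕ)
  u : ℝ × ℝ → ℝ

/-- The nodes of the mesh. -/
def MeshFn.nodes (S : MeshFn) : Set (ℝ × ℝ) := grid S.ht S.hx S.xlo S.nt S.nx

/-- `S` is a solution of the discretised pricing equation on a mesh that is fine up to `δ`. -/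
structure MeshFn.Fine (f σ γ G : ℝ → ℝ) (T δ : ℝ) (S : MeshFn) : Prop where
  mesh : IsMesh T S.ht S.hx S.xlo S.xhi S.nt S.nx
  sol : IsDiscreteSolution f σ γ G T S.ht S.hx S.xlo S.xhi S.nt S.nx S.u
  ratio : S.ht / S.hx ^ 2 < δ
  space : S.hx < δ
  left : S.xlo * δ ≤ -1
  right : 1 ≤ S.xhi * δ

/-- One parameter governs the whole limit: the lateral conditions mean `xlo ≤ -1/δ` and `xhi ≥ 1/δ`,
so they too weaken as `δ` grows. -/
theorem MeshFn.Fine.mono {f σ γ G : ℝ → ℝ} {T δ δ' : ℝ} {S : MeshFn} (hd : δ ≤ δ')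
    (h : S.Fine f σ γ G T δ) : S.Fine f σ γ G T δ' := by
  have hδ : 0 < δ := h.mesh.hx_pos.trans h.space
  refine ⟨h.mesh, h.sol, h.ratio.trans_le hd, h.space.trans_le hd, ?_, ?_⟩
  · have := h.left
    have : S.xlo < 0 := by by_contra hc; push Not at hc; nlinarith
    nlinarith
  · have := h.right
    have : 0 < S.xhi := by by_contra hc; push Not at hc; nlinarith
    nlinarith

theorem MeshFn.Fine.ht_lt {f σ γ G : ℝ → ℝ} {T δ : ℝ} {S : MeshFn}
    (h : S.Fine f σ γ G T δ) : S.ht < δ := by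
  have h1 := h.mesh.hx_pos
  have h2 := h.mesh.hx_lt_one
  have h3 := h.mesh.ht_pos
  have : S.ht ≤ S.ht / S.hx ^ 2 := by
    rw [le_div_iff₀ (by positivity)]
    exact mul_le_of_le_one_right h3.le (pow_le_one₀ h1.le h2.le)
  linarith [h.ratio]

theorem MeshFn.Fine.wide {f σ γ G : ℝ → ℝ} {T δ R : ℝ} {S : MeshFn} (h : S.Fine f σ γ G T δ)
    (hR : R * δ < 1) : S.xlo < -R ∧ R < S.xhi := by
  have hδ : 0 < δ := h.mesh.hx_pos.trans h.space
  have h1 := h.left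
  have h2 := h.right
  constructor <;> nlinarith

theorem CoeffBounds.continuousAt_pricingOp {f σ γ : ℝ → ℝ} {f₀ s₀ ι : ℝ}
    (C : CoeffBounds f σ γ f₀ s₀ ι) {x q M : ℝ} (hM : M ≤ γ x) :
    ContinuousAt (fun v : ℝ × ℝ × ℝ => pricingOp f σ γ v.1 v.2.1 v.2.2) (x, q, M) := by
  have h1 := C.f_cont
  have h2 := C.σ_cont
  have h3 := C.γ_cont
  have h4 := C.gap_pos hM
  unfold pricingOp
  refine ContinuousAt.inf ?_ (by fun_prop)
  refine ContinuousAt.sub (by fun_prop) ?_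
  refine ContinuousAt.div (by fun_prop) (by fun_prop) ?_
  positivity

theorem CoeffBounds.eventually_pos {f σ γ : ℝ → ℝ} {f₀ s₀ ι : ℝ}
    (C : CoeffBounds f σ γ f₀ s₀ ι) {x q M : ℝ} (h : 0 < pricingOp f σ γ x q M) :
    ∀ᶠ v : ℝ × ℝ × ℝ in 𝓝 (x, q, M), 0 < pricingOp f σ γ v.1 v.2.1 v.2.2 :=
  (C.continuousAt_pricingOp (pricingOp_pos_iff.1 h).1.le).eventually_const_lt h

/-- Continuity may fail at the singularity, but there `M > γ x` and the constraint alone stays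
negative. -/
theorem CoeffBounds.eventually_neg {f σ γ : ℝ → ℝ} {f₀ s₀ ι : ℝ}
    (C : CoeffBounds f σ γ f₀ s₀ ι) {x q M : ℝ} (h : pricingOp f σ γ x q M < 0) :
    ∀ᶠ v : ℝ × ℝ × ℝ in 𝓝 (x, q, M), pricingOp f σ γ v.1 v.2.1 v.2.2 < 0 := by
  rcases le_or_gt M (γ x) with hM | hM
  · exact (C.continuousAt_pricingOp hM).eventually_lt_const h
  · have h3 := C.γ_cont
    have : ContinuousAt (fun v : ℝ × ℝ × ℝ => γ v.1 - v.2.2) (x, q, M) := by fun_prop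
    have h4 := this.eventually_lt_const (show γ x - M < 0 by linarith)
    filter_upwards [h4] with v hv
    exact (min_le_right _ _).trans_lt hv

theorem eventually_jet {φ : ℝ × ℝ → ℝ} (hφ : ContDiff ℝ 2 φ) (p : ℝ × ℝ)
    {N : ℝ × ℝ × ℝ → Prop} (hN : ∀ᶠ v in 𝓝 (p.2, dT φ p, dXX φ p), N v) :
    ∃ δ > 0, ∀ t x ht hx : ℝ, dist (t, x) p < δ → 0 < ht → 0 < hx → hx < δ → ht / hx ^ 2 < δ →
      N (x, (φ (t + ht, x) - φ (t, x)) / ht, discG ht hx t x (φ (t, x)) φ) := by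
  obtain ⟨κ, hκ, H⟩ := Metric.eventually_nhds_iff.1 hN
  obtain ⟨δ, hδ, H2⟩ := consistency_at hφ p hκ
  refine ⟨min δ κ, by positivity, fun t x ht hx hd h1 h2 h3 h4 => H ?_⟩
  rw [lt_min_iff] at hd h3 h4
  obtain ⟨h5, h6⟩ := H2 t x ht hx hd.1 h1 h2 h3.1 h4.1
  rw [Prod.dist_eq, Prod.dist_eq, max_lt_iff, max_lt_iff]
  refine ⟨?_, ?_, ?_⟩
  · have := hd.2
    rw [Prod.dist_eq, max_lt_iff] at this
    exact this.2
  · rw [Real.dist_eq]; exact h5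
  · rw [Real.dist_eq]; exact h6

/-- Perturbation making a local extremum at `p` strict without changing the jet at `p`. -/
def bowl (p z : ℝ × ℝ) : ℝ := (z.1 - p.1) ^ 2 + (z.2 - p.2) ^ 4

theorem contDiff_bowl (p : ℝ × ℝ) : ContDiff ℝ 2 (bowl p) := by
  unfold bowl; fun_prop

theorem bowl_self (p : ℝ × ℝ) : bowl p p = 0 := by simp [bowl]

theorem bowl_pos {p z : ℝ × ℝ} (h : z ≠ p) : 0 < bowl p z := by
  unfold bowl
  by_cases h1 : z.1 = p.1
  · have h2 : z.2 ≠ p.2 := fun h2 => h (Prod.ext h1 h2)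
    have : 0 < (z.2 - p.2) ^ 4 := by
      have := sub_ne_zero.2 h2
      positivity
    positivity
  · have : 0 < (z.1 - p.1) ^ 2 := by
      have := sub_ne_zero.2 h1
      positivity
    positivity

theorem dT_add {φ ψ : ℝ × ℝ → ℝ} (hφ : ContDiff ℝ 2 φ) (hψ : ContDiff ℝ 2 ψ) (p : ℝ × ℝ) :
    dT (fun z => φ z + ψ z) p = dT φ p + dT ψ p :=
  ((hasDerivAt_dT hφ p).add (hasDerivAt_dT hψ p)).deriv

theorem dX_add {φ ψ : ℝ × ℝ → ℝ} (hφ : ContDiff ℝ 2 φ) (hψ : ContDiff ℝ 2 ψ) (p : ℝ × ℝ) :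
    dX (fun z => φ z + ψ z) p = dX φ p + dX ψ p :=
  ((hasDerivAt_dX hφ p).add (hasDerivAt_dX hψ p)).deriv

theorem dXX_add {φ ψ : ℝ × ℝ → ℝ} (hφ : ContDiff ℝ 2 φ) (hψ : ContDiff ℝ 2 ψ) (p : ℝ × ℝ) :
    dXX (fun z => φ z + ψ z) p = dXX φ p + dXX ψ p := by
  have h1 := hasDerivAt_dXX (hφ.add hψ) p
  have h2 := (hasDerivAt_dXX hφ p).add (hasDerivAt_dXX hψ p)
  have h3 : (fun z => dX (fun z => φ z + ψ z) (p.1, z)) =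
      (fun z => dX φ (p.1, z)) + fun z => dX ψ (p.1, z) := by
    ext z; exact dX_add hφ hψ _
  change HasDerivAt (fun z => dX (fun z => φ z + ψ z) (p.1, z)) _ _ at h1
  rw [h3] at h1
  exact h1.unique h2

theorem dT_const_mul {φ : ℝ × ℝ → ℝ} (hφ : ContDiff ℝ 2 φ) (c : ℝ) (p : ℝ × ℝ) :
    dT (fun z => c * φ z) p = c * dT φ p :=
  ((hasDerivAt_dT hφ p).const_mul c).deriv

theorem dXX_const_mul {φ : ℝ × ℝ → ℝ} (hφ : ContDiff ℝ 2 φ) (c : ℝ) (p : ℝ × ℝ) :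
    dXX (fun z => c * φ z) p = c * dXX φ p := by
  have h1 := hasDerivAt_dXX (contDiff_const (c := c) |>.mul hφ) p
  have h2 := (hasDerivAt_dXX hφ p).const_mul c
  have h3 : (fun z => dX (fun z => c * φ z) (p.1, z)) = fun z => c * dX φ (p.1, z) := by
    ext z; exact ((hasDerivAt_dX hφ (p.1, z)).const_mul c).deriv
  rw [h3] at h1
  exact h1.unique h2

theorem dT_bowl (p : ℝ × ℝ) : dT (bowl p) p = 0 := by
  have : HasDerivAt (fun s : ℝ => (s - p.1) ^ 2 + (p.2 - p.2) ^ 4) 0 p.1 := by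
    have h := (((hasDerivAt_id p.1).sub_const p.1).pow 2).add_const ((p.2 - p.2) ^ 4)
    simpa using h
  exact this.deriv

theorem dXX_bowl (p : ℝ × ℝ) : dXX (bowl p) p = 0 := by
  have h1 : ∀ z, HasDerivAt (fun s : ℝ => (p.1 - p.1) ^ 2 + (s - p.2) ^ 4)
      (4 * (z - p.2) ^ 3) z := by
    intro z
    have h := (((hasDerivAt_id z).sub_const p.2).pow 4).const_add ((p.1 - p.1) ^ 2)
    simpa using h
  have h2 : HasDerivAt (fun z : ℝ => 4 * (z - p.2) ^ 3) 0 p.2 := by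
    have h := (((hasDerivAt_id p.2).sub_const p.2).pow 3).const_mul 4
    simpa using h
  have h3 : (fun z => dX (bowl p) (p.1, z)) = fun z => 4 * (z - p.2) ^ 3 := by
    ext z; exact (h1 z).deriv
  have h4 := hasDerivAt_dXX (contDiff_bowl p) p
  rw [h3] at h4
  exact h4.unique h2

end
end GammaHedging

/-! ### Relaxed limits are viscosity super- and subsolutions. -/

namespace GammaHedging
noncomputable section

open Filter Topology

/-- The interior supersolution property on `[0, T) × ℝ`. -/
def IsInteriorSuper (f σ γ : ℝ → ℝ) (T : ℝ) (w : ℝ × ℝ → ℝ) : Prop :=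
  ∀ φ : ℝ × ℝ → ℝ, ContDiff ℝ 2 φ → ∀ t x : ℝ, 0 ≤ t → t < T →
    IsLocalMinOn (fun p => w p - φ p) (Ico 0 T ×ˢ univ) (t, x) →
    0 ≤ pricingOpOn f σ γ φ t x

section

variable {f σ γ G : ℝ → ℝ} {f₀ s₀ ι T : ℝ} (C : CoeffBounds f σ γ f₀ s₀ ι)

theorem MeshFn.Fine.nodes_subset {δ : ℝ} {S : MeshFn} (h : S.Fine f σ γ G T δ) :
    S.nodes ⊆ Icc 0 T ×ˢ univ :=
  fun _ hz => ⟨(grid_mem_Icc h.mesh hz).1, mem_univ _⟩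

/-- Subtracting `bowl` makes the minimum strict without changing the jet. The grid function `val` is
left free so that `-u` yields the subsolution case. -/
theorem IsLowerLimit.exists_touching_node {val : MeshFn → ℝ × ℝ → ℝ} {w : ℝ × ℝ → ℝ}
    (h : IsLowerLimit (MeshFn.Fine f σ γ G T) MeshFn.nodes val (Icc 0 T ×ˢ univ) w)
    {φ : ℝ × ℝ → ℝ} (hφ : ContDiff ℝ 2 φ) {p : ℝ × ℝ} (hp0 : 0 ≤ p.1) (hpT : p.1 < T)
    (hmin : IsLocalMinOn (fun p => w p - φ p) (Ico 0 T ×ˢ univ) p) {ε : ℝ} (hε : 0 < ε) :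
    ∃ S : MeshFn, S.Fine f σ γ G T ε ∧ ∃ m ∈ S.nodes, dist m p < ε ∧ m.1 < T ∧ S.xlo < m.2 ∧
      m.2 < S.xhi ∧ ∀ z ∈ S.nodes, (z.1 = m.1 + S.ht ∧ |z.2 - m.2| ≤ S.hx) →
        val S m - (φ m + -1 * bowl p m) ≤ val S z - (φ z + -1 * bowl p z) := by
  obtain ⟨r0, hr0, H⟩ := Metric.eventually_nhds_iff.1 (eventually_nhdsWithin_iff.1 hmin)
  set r := min (r0 / 2) ((T - p.1) / 2) with hr
  have hT : 0 < T - p.1 := by linarith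
  have hrpos : 0 < r := by positivity
  have hr1 : r ≤ r0 / 2 := min_le_left _ _
  have hr2 : r ≤ (T - p.1) / 2 := min_le_right _ _
  have hφb : Continuous fun z => φ z + -1 * bowl p z :=
    hφ.continuous.add (continuous_const.mul (contDiff_bowl p).continuous)
  -- The bound `r / 2` keeps the successors of the minimising node inside the ball of radius `r`;
  -- the last bound makes the mesh wider than that ball.
  set δ := min ε (min (r / 2) (1 / (2 * (|p.2| + r)))) with hδ
  have hδpos : 0 < δ := by positivity
  have hδε : δ ≤ ε := min_le_left _ _
  have hδr : δ ≤ r / 2 := (min_le_right _ _).trans (min_le_left _ _)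
  have hδR : δ ≤ 1 / (2 * (|p.2| + r)) := (min_le_right _ _).trans (min_le_right _ _)
  obtain ⟨S, hS, m, hm, hd, hle⟩ := h.exists_touching (fun δ δ' S hd hS => hS.mono hd)
    (fun S => grid_finite _ _ _ _ _) (fun S hS => hS.nodes_subset) hφb
    (p := p) ⟨⟨hp0, hpT.le⟩, mem_univ _⟩ hrpos
    ((isCompact_closedBall p r).inter_right (isClosed_Icc.prod isClosed_univ))
    (by
      intro z hz hne
      have hzd := Metric.mem_closedBall.1 hz.1
      have hz1 : |z.1 - p.1| ≤ r := by
        rw [Prod.dist_eq, max_le_iff] at hzd; exact hzd.1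
      have := H (show dist z p < r0 by linarith)
        ⟨⟨hz.2.1.1, by linarith [(abs_le.1 hz1).2]⟩, mem_univ _⟩
      have h2 := bowl_pos hne
      rw [bowl_self]
      simp only at this
      linarith)
    hδpos (show 0 < δ by positivity)
  have hd' := hd
  rw [Prod.dist_eq, max_lt_iff] at hd'
  simp only [Real.dist_eq, abs_lt] at hd'
  have hw := hS.wide (R := |p.2| + r) (by
    have h0 : 0 < |p.2| + r := by positivity
    rw [le_div_iff₀ (by positivity)] at hδR
    linarith)
  have hpa := abs_le.1 (le_refl |p.2|)
  refine ⟨S, hS.mono hδε, m, hm, hd.trans_le hδε, by linarith, by linarith, by linarith, ?_⟩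
  rintro z hz ⟨hz1, hz2⟩
  refine hle z hz ?_
  have h1 := hS.ht_lt
  have h2 := hS.space
  have h3 := hS.mesh.ht_pos
  rw [Prod.dist_eq, max_le_iff]
  simp only [Real.dist_eq]
  rw [abs_le] at hz2
  constructor
  · rw [hz1, abs_le]; constructor <;> linarith
  · rw [abs_le]; constructor <;> linarith

theorem jet_add_bowl {φ : ℝ × ℝ → ℝ} (hφ : ContDiff ℝ 2 φ) (c : ℝ) (p : ℝ × ℝ) :
    dT (fun z => φ z + c * bowl p z) p = dT φ p ∧
      dXX (fun z => φ z + c * bowl p z) p = dXX φ p := by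
  have hb : ContDiff ℝ 2 fun z => c * bowl p z := contDiff_const.mul (contDiff_bowl p)
  constructor
  · rw [dT_add hφ hb, dT_const_mul (contDiff_bowl p), dT_bowl]; ring
  · rw [dXX_add hφ hb, dXX_const_mul (contDiff_bowl p), dXX_bowl]; ring

include C

/-- Lower relaxed limits of discrete solutions are viscosity supersolutions. -/
theorem IsLowerLimit.isInteriorSuper {w : ℝ × ℝ → ℝ}
    (h : IsLowerLimit (MeshFn.Fine f σ γ G T) MeshFn.nodes MeshFn.u (Icc 0 T ×ˢ univ) w) :
    IsInteriorSuper f σ γ T w := by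
  intro φ hφ t x ht0 htT hmin
  rw [pricingOpOn_eq]
  by_contra hcon
  push Not at hcon
  set ψ : ℝ × ℝ → ℝ := fun z => φ z + -1 * bowl (t, x) z with hψdef
  have hψ : ContDiff ℝ 2 ψ := hφ.add (contDiff_const.mul (contDiff_bowl _))
  obtain ⟨j1, j2⟩ := jet_add_bowl hφ (-1) (t, x)
  rw [← j1, ← j2] at hcon
  obtain ⟨δ, hδ, H⟩ := eventually_jet hψ (t, x) (C.eventually_neg hcon)
  obtain ⟨S, hS, m, hm, hd, hm1, hm2, hm3, hle⟩ :=
    h.exists_touching_node hφ (p := (t, x)) ht0 htT hmin hδ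
  obtain ⟨n1, n2, n3⟩ := grid_neighbors hS.mesh hm hm1 hm2 hm3
  have hht := hS.mesh.ht_pos
  have hhx := hS.mesh.hx_pos
  have i1 := hle _ n1 ⟨rfl, by simp [hhx.le]⟩
  have i2 := hle _ n2 ⟨rfl, by simp [abs_of_pos hhx]⟩
  have i3 := hle _ n3 ⟨rfl, by simp [abs_of_pos hhx]⟩
  have h0 := H m.1 m.2 S.ht S.hx hd hht hhx hS.space hS.ratio
  have heq := hS.sol.inner m hm hm1 hm2 hm3
  -- At the touching node the differences of `ψ` are at most those of `u`, for which the operator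
  -- vanishes.
  refine absurd (C.nonneg_mono heq.ge ?_ ?_) (not_le.2 h0)
  · change (ψ (m.1 + S.ht, m.2) - ψ m) / S.ht ≤ _
    gcongr ?_ / _
    simp only [hψdef]; linarith
  · change (ψ (m.1 + S.ht, m.2 + S.hx) + ψ (m.1 + S.ht, m.2 - S.hx) - 2 * ψ m) / S.hx ^ 2 ≤
      (S.u (m.1 + S.ht, m.2 + S.hx) + S.u (m.1 + S.ht, m.2 - S.hx) - 2 * S.u m) / S.hx ^ 2
    gcongr ?_ / _
    simp only [hψdef]; linarith

/-- Upper relaxed limits of discrete solutions are viscosity subsolutions. -/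
theorem IsLowerLimit.interior_sub {v : ℝ × ℝ → ℝ}
    (h : IsLowerLimit (MeshFn.Fine f σ γ G T) MeshFn.nodes (fun S z => -S.u z) (Icc 0 T ×ˢ univ)
      (fun z => -v z)) {φ : ℝ × ℝ → ℝ} (hφ : ContDiff ℝ 2 φ) {t x : ℝ} (ht0 : 0 ≤ t) (htT : t < T)
    (hmax : IsLocalMaxOn (fun p => v p - φ p) (Ico 0 T ×ˢ univ) (t, x)) :
    pricingOpOn f σ γ φ t x ≤ 0 := by
  rw [pricingOpOn_eq]
  by_contra hcon
  push Not at hcon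
  set ψ : ℝ × ℝ → ℝ := fun z => φ z + 1 * bowl (t, x) z with hψdef
  have hψ : ContDiff ℝ 2 ψ := hφ.add (contDiff_const.mul (contDiff_bowl _))
  obtain ⟨j1, j2⟩ := jet_add_bowl hφ 1 (t, x)
  rw [← j1, ← j2] at hcon
  obtain ⟨δ, hδ, H⟩ := eventually_jet hψ (t, x) (C.eventually_pos hcon)
  have hmin : IsLocalMinOn (fun p => -v p - (-φ p)) (Ico 0 T ×ˢ univ) (t, x) := by
    filter_upwards [hmax] with z hz
    linarith
  obtain ⟨S, hS, m, hm, hd, hm1, hm2, hm3, hle⟩ :=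
    h.exists_touching_node hφ.neg (p := (t, x)) ht0 htT hmin hδ
  obtain ⟨n1, n2, n3⟩ := grid_neighbors hS.mesh hm hm1 hm2 hm3
  have hht := hS.mesh.ht_pos
  have hhx := hS.mesh.hx_pos
  have i1 := hle _ n1 ⟨rfl, by simp [hhx.le]⟩
  have i2 := hle _ n2 ⟨rfl, by simp [abs_of_pos hhx]⟩
  have i3 := hle _ n3 ⟨rfl, by simp [abs_of_pos hhx]⟩
  have h0 := H m.1 m.2 S.ht S.hx hd hht hhx hS.space hS.ratio
  have heq := hS.sol.inner m hm hm1 hm2 hm3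
  refine absurd heq (C.pos_mono' h0 ?_ ?_).ne'
  · change _ ≤ (ψ (m.1 + S.ht, m.2) - ψ m) / S.ht
    gcongr ?_ / _
    simp only [hψdef]; linarith
  · change (S.u (m.1 + S.ht, m.2 + S.hx) + S.u (m.1 + S.ht, m.2 - S.hx) - 2 * S.u m) / S.hx ^ 2 ≤
      (ψ (m.1 + S.ht, m.2 + S.hx) + ψ (m.1 + S.ht, m.2 - S.hx) - 2 * ψ m) / S.hx ^ 2
    gcongr ?_ / _
    simp only [hψdef]; linarith

end

end
end GammaHedging

/-! ### Gaussian averages and explicit heat flows. -/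

namespace GammaHedging
noncomputable section

open Filter Topology MeasureTheory ProbabilityTheory

section gaussian

theorem integral_cexp_gaussianReal (v : NNReal) (c : ℝ) :
    ∫ y, Complex.exp (c * y * Complex.I) ∂(gaussianReal 0 v) = Real.exp (-(c ^ 2 * v / 2)) := by
  rw [← charFun_apply_real, charFun_gaussianReal]
  push_cast
  congr 1
  ring

theorem integrable_gaussianReal_of_bounded {g : ℝ → ℝ} (hg : Continuous g) {B : ℝ}
    (hB : ∀ x, |g x| ≤ B) (v : NNReal) : Integrable g (gaussianReal 0 v) :=
  Integrable.of_bound hg.aestronglyMeasurable B (Eventually.of_forall hB)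

theorem integral_cos_gaussianReal (v : NNReal) (c b : ℝ) :
    ∫ y, Real.cos (c * y + b) ∂(gaussianReal 0 v) = Real.exp (-(c ^ 2 * v / 2)) * Real.cos b := by
  have hint : Integrable (fun y : ℝ => Complex.exp (c * y * Complex.I) * Complex.exp (b * Complex.I))
      (gaussianReal 0 v) := by
    refine Integrable.of_bound (Continuous.aestronglyMeasurable (by fun_prop)) 1
      (Eventually.of_forall fun y => ?_)
    rw [← Complex.exp_add, show (c * y * Complex.I + b * Complex.I : ℂ) = ((c * y + b : ℝ) : ℂ) *
      Complex.I by push_cast; ring, Complex.norm_exp_ofReal_mul_I]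
  have h1 : ∀ y : ℝ, Real.cos (c * y + b) =
      RCLike.re (Complex.exp (c * y * Complex.I) * Complex.exp (b * Complex.I)) := by
    intro y
    rw [← Complex.exp_add, show (c * y * Complex.I + b * Complex.I : ℂ) = ((c * y + b : ℝ) : ℂ) *
      Complex.I by push_cast; ring]
    exact (Complex.exp_ofReal_mul_I_re _).symm
  simp_rw [h1]
  rw [integral_re hint, integral_mul_const, integral_cexp_gaussianReal]
  rw [RCLike.re_to_complex, Complex.re_ofReal_mul, Complex.exp_ofReal_mul_I_re]

theorem integral_sq_gaussianReal (v : NNReal) : ∫ y, y ^ 2 ∂(gaussianReal 0 v) = v := by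
  have h := variance_id_gaussianReal (μ := 0) (v := v)
  rw [variance_eq_integral (by fun_prop)] at h
  simpa using h

theorem integrable_pow_gaussianReal (v : NNReal) (n : ℕ) :
    Integrable (fun y : ℝ => y ^ n) (gaussianReal 0 v) := by
  have h : MemLp id n (gaussianReal 0 v) := memLp_id_gaussianReal n
  rcases Nat.eq_zero_or_pos n with h0 | h0
  · subst h0; simp
  have h2 := h.integrable_norm_pow h0.ne'
  refine h2.mono (by fun_prop) (Eventually.of_forall fun y => ?_)
  simp

theorem integrable_gaussianReal_of_growth {g : ℝ → ℝ} (hg : AEStronglyMeasurable g (gaussianReal 0 v))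
    {B : ℝ} (hB : ∀ x, |g x| ≤ B * (1 + |x|)) : Integrable g (gaussianReal 0 v) := by
  have h1 := integrable_pow_gaussianReal v 1
  have h2 : Integrable (fun y : ℝ => B * (1 + |y|)) (gaussianReal 0 v) := by
    refine ((integrable_const 1).add ?_).const_mul B
    simpa using h1.abs
  exact h2.mono' hg (Eventually.of_forall hB)

end gaussian

/-- `ψ` is the terminal value at `t₁` of a smooth solution of `∂ₜz + s²/2 ∂ₓₓz = 0` given by Gaussian
averages. -/
def HasHeatFlow (s t₁ : ℝ) (ψ : ℝ → ℝ) : Prop :=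
  Continuous ψ ∧ (∃ B, ∀ x, |ψ x| ≤ B) ∧ ∃ z : ℝ × ℝ → ℝ, ContDiff ℝ 2 z ∧
    (∀ p, dT z p + s ^ 2 / 2 * dXX z p = 0) ∧ (∀ x, z (t₁, x) = ψ x) ∧
    ∀ t ≤ t₁, ∀ x, z (t, x) = ∫ y, ψ (x + y) ∂(gaussianReal 0 (s ^ 2 * (t₁ - t)).toNNReal)

theorem HasHeatFlow.add {s t₁ : ℝ} {ψ₁ ψ₂ : ℝ → ℝ} (h₁ : HasHeatFlow s t₁ ψ₁)
    (h₂ : HasHeatFlow s t₁ ψ₂) : HasHeatFlow s t₁ (ψ₁ + ψ₂) := by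
  obtain ⟨c1, ⟨B1, b1⟩, z1, d1, e1, t1, r1⟩ := h₁
  obtain ⟨c2, ⟨B2, b2⟩, z2, d2, e2, t2, r2⟩ := h₂
  refine ⟨c1.add c2, ⟨B1 + B2, fun x => (abs_add_le _ _).trans (add_le_add (b1 x) (b2 x))⟩,
    fun p => z1 p + z2 p, d1.add d2, ?_, ?_, ?_⟩
  · intro p
    rw [dT_add d1 d2, dXX_add d1 d2]
    linarith [e1 p, e2 p]
  · intro x; simp [t1, t2]
  · intro t ht x
    simp only [Pi.add_apply]
    rw [integral_add, r1 t ht x, r2 t ht x]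
    · exact integrable_gaussianReal_of_bounded (c1.comp (continuous_const.add continuous_id))
        (fun y => b1 _) _
    · exact integrable_gaussianReal_of_bounded (c2.comp (continuous_const.add continuous_id))
        (fun y => b2 _) _

theorem HasHeatFlow.smul {s t₁ : ℝ} {ψ : ℝ → ℝ} (h : HasHeatFlow s t₁ ψ) (c : ℝ) :
    HasHeatFlow s t₁ (c • ψ) := by
  obtain ⟨c1, ⟨B1, b1⟩, z1, d1, e1, t1, r1⟩ := h
  refine ⟨c1.const_smul c, ⟨|c| * B1, fun x => ?_⟩, fun p => c * z1 p, contDiff_const.mul d1,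
    ?_, ?_, ?_⟩
  · rw [Pi.smul_apply, smul_eq_mul, abs_mul]
    exact mul_le_mul_of_nonneg_left (b1 x) (abs_nonneg c)
  · intro p
    rw [dT_const_mul d1, dXX_const_mul d1]
    linear_combination c * e1 p
  · intro x; simp [t1]
  · intro t ht x
    simp only [Pi.smul_apply, smul_eq_mul]
    rw [integral_const_mul, r1 t ht x]

/-- Cosines are eigenfunctions: the decay factor of the flow is the characteristic function of the
Gaussian of variance `s² (t₁ - t)`. -/
theorem hasHeatFlow_cos (s t₁ c b : ℝ) : HasHeatFlow s t₁ fun x => Real.cos (c * x + b) := by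
  set z : ℝ × ℝ → ℝ := fun p => Real.exp (c ^ 2 * s ^ 2 / 2 * (p.1 - t₁)) * Real.cos (c * p.2 + b)
    with hz
  have hd : ContDiff ℝ 2 z := by
    rw [hz]; fun_prop
  refine ⟨by fun_prop, ⟨1, fun x => Real.abs_cos_le_one _⟩, z, hd, ?_, ?_, ?_⟩
  · intro p
    have h1 : dT z p = c ^ 2 * s ^ 2 / 2 * z p := by
      have a1 : HasDerivAt (fun s' : ℝ => c ^ 2 * s ^ 2 / 2 * (s' - t₁)) (c ^ 2 * s ^ 2 / 2) p.1 := by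
        simpa using ((hasDerivAt_id p.1).sub_const t₁).const_mul (c ^ 2 * s ^ 2 / 2)
      refine (a1.exp.mul_const (Real.cos (c * p.2 + b))).deriv.trans ?_
      simp only [hz]; ring
    have ac : ∀ y, HasDerivAt (fun y : ℝ => c * y + b) c y := by
      intro y
      simpa using ((hasDerivAt_id y).const_mul c).add_const b
    have h2 : ∀ y, dX z (p.1, y) = Real.exp (c ^ 2 * s ^ 2 / 2 * (p.1 - t₁)) *
        (-Real.sin (c * y + b) * c) := fun y =>
      ((ac y).cos.const_mul (Real.exp (c ^ 2 * s ^ 2 / 2 * (p.1 - t₁)))).deriv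
    have h3 := hasDerivAt_dXX hd p
    simp_rw [h2] at h3
    have h4 := h3.unique (((ac p.2).sin.neg.mul_const c).const_mul _)
    rw [h4, h1]
    simp only [hz]; ring
  · intro x; simp [hz]
  · intro t ht x
    have h1 : ∀ y : ℝ, c * (x + y) + b = c * y + (c * x + b) := fun y => by ring
    simp_rw [h1]
    rw [integral_cos_gaussianReal, Real.coe_toNNReal _ (by nlinarith [sq_nonneg s])]
    simp only [hz]
    congr 2
    ring

/-- By the product formula, the span of the `cos (n θ)` is stable under multiplication by `cos θ`,
so it contains all powers of `cos θ`. -/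
theorem hasHeatFlow_polynomial_cos (s t₁ c b : ℝ) (p : Polynomial ℝ) :
    HasHeatFlow s t₁ fun x => p.eval (Real.cos (c * x + b)) := by
  set V := Submodule.span ℝ (range fun n : ℕ => fun x : ℝ => Real.cos (n * (c * x + b))) with hV
  have hflow : ∀ g ∈ V, HasHeatFlow s t₁ g := by
    intro g hg
    induction hg using Submodule.span_induction with
    | mem g hg =>
      obtain ⟨n, rfl⟩ := hg
      have := hasHeatFlow_cos s t₁ (n * c) (n * b)
      convert this using 3
      ring
    | zero =>
      have := (hasHeatFlow_cos s t₁ 0 0).smul 0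
      simpa using this
    | add g₁ g₂ _ _ h₁ h₂ => exact h₁.add h₂
    | smul a g _ h => exact h.smul a
  have hmul : ∀ g ∈ V, (fun x => Real.cos (c * x + b) * g x) ∈ V := by
    intro g hg
    induction hg using Submodule.span_induction with
    | mem g hg =>
      obtain ⟨n, rfl⟩ := hg
      rcases n with _ | n
      · have : (fun x : ℝ => Real.cos (c * x + b) * Real.cos ((0 : ℕ) * (c * x + b))) =
            fun x => Real.cos ((1 : ℕ) * (c * x + b)) := by
          ext x; simp
        rw [this]
        exact Submodule.subset_span ⟨1, rfl⟩
      · have : (fun x : ℝ => Real.cos (c * x + b) * Real.cos ((n + 1 : ℕ) * (c * x + b))) =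
            (1 / 2 : ℝ) • (fun x => Real.cos ((n + 2 : ℕ) * (c * x + b))) +
            (1 / 2 : ℝ) • (fun x => Real.cos (n * (c * x + b))) := by
          ext x
          simp only [Pi.add_apply, Pi.smul_apply, smul_eq_mul]
          have e1 : ((n + 2 : ℕ) : ℝ) * (c * x + b) =
              (n + 1 : ℕ) * (c * x + b) + (c * x + b) := by push_cast; ring
          have e2 : (n : ℝ) * (c * x + b) =
              (n + 1 : ℕ) * (c * x + b) - (c * x + b) := by push_cast; ring
          rw [e1, e2]
          generalize ((n + 1 : ℕ) : ℝ) * (c * x + b) = α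
          generalize c * x + b = θ
          rw [Real.cos_add, Real.cos_sub]
          ring
        rw [this]
        exact V.add_mem (V.smul_mem _ (Submodule.subset_span ⟨n + 2, rfl⟩))
          (V.smul_mem _ (Submodule.subset_span ⟨n, rfl⟩))
    | zero =>
      convert V.zero_mem using 1
      ext x; simp
    | add g₁ g₂ _ _ h₁ h₂ =>
      convert V.add_mem h₁ h₂ using 1
      ext x; simp [mul_add]
    | smul a g _ h =>
      convert V.smul_mem a h using 1
      ext x; simp; ring
  have hpow : ∀ n : ℕ, (fun x => Real.cos (c * x + b) ^ n) ∈ V := by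
    intro n
    induction n with
    | zero => exact Submodule.subset_span ⟨0, by ext x; simp⟩
    | succ n ih =>
      convert hmul _ ih using 1
      ext x; ring
  refine hflow _ ?_
  induction p using Polynomial.induction_on' with
  | add p q hp hq =>
    convert V.add_mem hp hq using 1
    ext x; simp
  | monomial n a =>
    convert V.smul_mem a (hpow n) using 1
    ext x; simp

/-- Uniform approximation on an interval by data with an explicit heat flow. -/
theorem exists_hasHeatFlow_near (s t₁ x₀ : ℝ) {L κ B : ℝ} (hL : 0 < L) (hκ : 0 < κ) {h : ℝ → ℝ}
    (hh : ContinuousOn h (Icc (x₀ - L) (x₀ + L))) (hB : ∀ x ∈ Icc (x₀ - L) (x₀ + L), |h x| ≤ B) :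
    ∃ ψ, HasHeatFlow s t₁ ψ ∧ (∀ x ∈ Icc (x₀ - L) (x₀ + L), |ψ x - h x| ≤ κ) ∧
      ∀ x, |ψ x| ≤ B + κ := by
  have hπ := Real.pi_pos
  -- With this frequency the phase runs over `[0, π]` on the interval, where `arccos` inverts `cos`.
  -- Weierstrass is applied to `h` in the variable `u = cos`; elsewhere the approximant repeats the
  -- same values, whence the global bound.
  set ω := Real.pi / (2 * L) with hω
  have hωpos : 0 < ω := by positivity
  have hωL : ω * (2 * L) = Real.pi := by rw [hω]; field_simp
  have hmem : ∀ u, x₀ - L + Real.arccos u / ω ∈ Icc (x₀ - L) (x₀ + L) := by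
    intro u
    have h1 : 0 ≤ Real.arccos u / ω := div_nonneg (Real.arccos_nonneg u) hωpos.le
    have h2 : Real.arccos u / ω ≤ 2 * L := by
      rw [div_le_iff₀ hωpos]; linarith [Real.arccos_le_pi u]
    constructor <;> linarith
  obtain ⟨p, hp⟩ := exists_polynomial_near_of_continuousOn (-1) 1
    (fun u => h (x₀ - L + Real.arccos u / ω))
    (hh.comp (by have := Real.continuous_arccos; fun_prop) (fun u _ => hmem u)) κ hκ
  refine ⟨fun x => p.eval (Real.cos (ω * x + -(ω * (x₀ - L)))),
    hasHeatFlow_polynomial_cos s t₁ _ _ p, ?_, ?_⟩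
  · intro x hx
    have h1 := hp _ (Real.cos_mem_Icc (ω * x + -(ω * (x₀ - L))))
    have h2 : Real.arccos (Real.cos (ω * x + -(ω * (x₀ - L)))) = ω * x + -(ω * (x₀ - L)) := by
      apply Real.arccos_cos
      · nlinarith [hx.1]
      · nlinarith [hx.2]
    simp only [h2] at h1
    have h3 : x₀ - L + (ω * x + -(ω * (x₀ - L))) / ω = x := by field_simp; ring
    rw [h3] at h1
    exact h1.le
  · intro x
    have h1 := hp _ (Real.cos_mem_Icc (ω * x + -(ω * (x₀ - L))))
    have h2 := hB _ (hmem (Real.cos (ω * x + -(ω * (x₀ - L)))))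
    have h3 := abs_sub_abs_le_abs_sub (p.eval (Real.cos (ω * x + -(ω * (x₀ - L)))))
      (h (x₀ - L + Real.arccos (Real.cos (ω * x + -(ω * (x₀ - L)))) / ω))
    linarith

end
end GammaHedging

/-! ### Semiconcavity in space of supersolutions. -/

namespace GammaHedging
noncomputable section

open Filter Topology MeasureTheory ProbabilityTheory

section

variable {f σ γ : ℝ → ℝ} {f₀ s₀ ι T : ℝ} {w : ℝ × ℝ → ℝ}

/-- A minimum over a box is local in `[0, T) × ℝ` if it avoids the top and the lateral sides. The
bottom is forbidden only when `a > 0`: for `a ≤ 0` the box starts at time zero, which belongs to the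
domain of the equation. -/
theorem isInteriorSuper_jet (hw : IsInteriorSuper f σ γ T w) {φ : ℝ × ℝ → ℝ}
    (hφ : ContDiff ℝ 2 φ) {a b c d : ℝ} {p : ℝ × ℝ} (hcT : c < T)
    (hp : p ∈ Icc (max 0 a) c ×ˢ Icc b d) (h1 : 0 < a → a < p.1) (h2 : p.1 < c) (h3 : b < p.2)
    (h4 : p.2 < d)
    (hmin : IsMinOn (fun p => w p - φ p) (Icc (max 0 a) c ×ˢ Icc b d) p) :
    0 ≤ pricingOp f σ γ p.2 (dT φ p) (dXX φ p) := by
  have hp0 := (max_le_iff.1 hp.1.1)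
  refine hw φ hφ p.1 p.2 hp0.1 (h2.trans hcT) ?_
  have hnhds : Ico 0 T ×ˢ univ ∩ {z : ℝ × ℝ | (0 < a → a < z.1) ∧ z.1 < c ∧ b < z.2 ∧ z.2 < d} ∈
      𝓝[Ico 0 T ×ˢ univ] p := by
    refine inter_mem self_mem_nhdsWithin (mem_nhdsWithin_of_mem_nhds (IsOpen.mem_nhds ?_
      ⟨h1, h2, h3, h4⟩))
    have e3 : IsOpen {z : ℝ × ℝ | z.1 < c ∧ b < z.2 ∧ z.2 < d} :=
      (isOpen_lt continuous_fst continuous_const).inter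
        ((isOpen_lt continuous_const continuous_snd).inter
          (isOpen_lt continuous_snd continuous_const))
    by_cases ha : 0 < a
    · simp only [ha, true_imp_iff]
      exact (isOpen_lt continuous_const continuous_fst).inter e3
    · simp only [ha, false_imp_iff, true_and]
      exact e3
  filter_upwards [hnhds] with z hz
  obtain ⟨⟨hz1, -⟩, hz2, hz3, hz4, hz5⟩ := hz
  refine hmin ⟨⟨max_le hz1.1 ?_, hz3.le⟩, hz4.le, hz5.le⟩
  by_cases ha : 0 < a
  · exact (hz2 ha).le
  · push Not at ha; linarith [hz1.1]

/-- Supersolutions lie above parabolas of curvature larger than `γ` with the same end points. -/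
theorem parabola_le (hlsc : LowerSemicontinuousOn w (Icc 0 T ×ˢ univ))
    (hw : IsInteriorSuper f σ γ T w) {t : ℝ} (ht0 : 0 ≤ t) (htT : t < T) {y₁ y₂ m α β : ℝ}
    (hm : ∀ y ∈ Icc y₁ y₂, γ y < m)
    (h1 : α + β * y₁ + m / 2 * y₁ ^ 2 ≤ w (t, y₁)) (h2 : α + β * y₂ + m / 2 * y₂ ^ 2 ≤ w (t, y₂))
    {y : ℝ} (hy : y ∈ Icc y₁ y₂) : α + β * y + m / 2 * y ^ 2 ≤ w (t, y) := by
  by_contra hcon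
  push Not at hcon
  set P : ℝ → ℝ := fun y => α + β * y + m / 2 * y ^ 2 with hP
  set κ := P y - w (t, y) with hκdef
  have hκ : 0 < κ := by simp only [hκdef, hP]; linarith
  -- Lower semicontinuity preserves the end point inequalities, up to `κ / 2`, at times near `t`.
  have hend : ∀ yi, P yi ≤ w (t, yi) → ∃ δ > 0, ∀ r ∈ Icc 0 T, |r - t| ≤ δ →
      P yi - κ / 2 < w (r, yi) := by
    intro yi hyi
    have h := hlsc (t, yi) ⟨⟨ht0, htT.le⟩, mem_univ _⟩ (P yi - κ / 2) (by linarith)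
    obtain ⟨δ, hδ, H⟩ := Metric.eventually_nhds_iff.1 (eventually_nhdsWithin_iff.1 h)
    refine ⟨δ / 2, by positivity, fun r hr hrt => H ?_ ⟨hr, mem_univ _⟩⟩
    rw [Prod.dist_eq, max_lt_iff]
    simp only [Real.dist_eq, sub_self, abs_zero]
    exact ⟨by linarith, hδ⟩
  obtain ⟨δ₁, hδ₁, H₁⟩ := hend y₁ h1
  obtain ⟨δ₂, hδ₂, H₂⟩ := hend y₂ h2
  have hTt : 0 < T - t := by linarith
  set δ := min (min δ₁ δ₂) ((T - t) / 2) with hδdef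
  have hδ : 0 < δ := by positivity
  have hδ1 : δ ≤ δ₁ := (min_le_left _ _).trans (min_le_left _ _)
  have hδ2 : δ ≤ δ₂ := (min_le_left _ _).trans (min_le_right _ _)
  have hδT : δ ≤ (T - t) / 2 := min_le_right _ _
  set B := Icc (max 0 (t - δ)) (t + δ) ×ˢ Icc y₁ y₂ with hB
  have hBK : B ⊆ Icc 0 T ×ˢ univ := by
    rintro z ⟨⟨ha, hb⟩, -⟩
    exact ⟨⟨(le_max_left _ _).trans ha, by linarith⟩, mem_univ _⟩
  have hBc : IsCompact B := isCompact_Icc.prod isCompact_Icc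
  have htB : (t, y) ∈ B := ⟨⟨max_le ht0 (by linarith), by linarith⟩, hy⟩
  have hPc : Continuous P := by fun_prop
  have hlscB : ∀ φ : ℝ × ℝ → ℝ, Continuous φ → LowerSemicontinuousOn (fun z => w z - φ z) B := by
    intro φ hφ
    simp only [sub_eq_add_neg]
    exact (hlsc.mono hBK).add (hφ.neg.lowerSemicontinuous.lowerSemicontinuousOn _)
  obtain ⟨z0, hz0, hz0min⟩ := (hlscB (fun z => P z.2) (by fun_prop)).exists_isMinOn ⟨_, htB⟩ hBc
  -- On the box `w - P ≥ -b`. With `N δ² = b` the penalised difference is nonnegative at times `t ±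
  -- δ`, while it equals `-κ` at `(t, y)`; so the minimum avoids these times.
  set b := |w z0 - P z0.2| with hb
  set N := b / δ ^ 2 with hN
  have hNδ : N * δ ^ 2 = b := by rw [hN]; field_simp
  set φ : ℝ × ℝ → ℝ := fun z => P z.2 - N * (z.1 - t) ^ 2 with hφdef
  have hφ : ContDiff ℝ 2 φ := by simp only [hφdef, hP]; fun_prop
  obtain ⟨p, hp, hpmin⟩ := (hlscB φ hφ.continuous).exists_isMinOn ⟨_, htB⟩ hBc
  have hpv : w p - φ p ≤ -κ := by
    have : w p - φ p ≤ w (t, y) - φ (t, y) := hpmin htB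
    simp only [hφdef] at this ⊢
    simp only [hκdef]
    linarith [show N * (t - t) ^ 2 = 0 by simp]
  have hN0 : 0 ≤ N := by positivity
  have hsq : 0 ≤ N * (p.1 - t) ^ 2 := by positivity
  have hptime : |p.1 - t| ≤ δ := by
    rw [abs_le]
    constructor
    · linarith [(le_max_right _ _).trans hp.1.1]
    · linarith [hp.1.2]
  have hp0T : p.1 ∈ Icc 0 T := (hBK hp).1
  have hne1 : p.2 ≠ y₁ := by
    intro he
    have := H₁ p.1 hp0T (hptime.trans hδ1)
    have h3 : w p = w (p.1, y₁) := by rw [← he]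
    simp only [hφdef, he] at hpv
    linarith
  have hne2 : p.2 ≠ y₂ := by
    intro he
    have := H₂ p.1 hp0T (hptime.trans hδ2)
    have h3 : w p = w (p.1, y₂) := by rw [← he]
    simp only [hφdef, he] at hpv
    linarith
  have hlt : |p.1 - t| < δ := by
    refine lt_of_le_of_ne hptime fun he => ?_
    have h3 : (p.1 - t) ^ 2 = δ ^ 2 := by rw [← he, sq_abs]
    have h4 : w z0 - P z0.2 ≤ w p - P p.2 := hz0min hp
    have h5 := neg_abs_le (w z0 - P z0.2)
    simp only [hφdef, h3, hNδ] at hpv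
    linarith
  rw [abs_lt] at hlt
  have hjet := isInteriorSuper_jet hw hφ (a := t - δ) (c := t + δ) (by linarith) hp
    (fun _ => by linarith) (by linarith) (lt_of_le_of_ne hp.2.1 hne1.symm)
    (lt_of_le_of_ne hp.2.2 hne2) hpmin
  have hM : dXX φ p = m := by
    have a1 : ∀ y, HasDerivAt P (β + m * y) y := by
      intro y
      have := (((hasDerivAt_id y).const_mul β).const_add α).add
        (((hasDerivAt_id y).pow 2).const_mul (m / 2))
      refine this.congr_deriv ?_
      simp; ring
    have a2 : (fun y => dX φ (p.1, y)) = fun y => β + m * y := by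
      ext y
      exact ((a1 y).sub_const (N * (p.1 - t) ^ 2)).deriv
    have a3 := hasDerivAt_dXX hφ p
    rw [a2] at a3
    refine a3.unique ?_
    simpa using ((hasDerivAt_id p.2).const_mul m).const_add β
  have := (pricingOp_nonneg_iff.1 hjet).1
  rw [hM] at this
  linarith [hm p.2 hp.2]

/-- The parabola of curvature `m` through the values at `x ± h` lies below the slice; its value at
`x` is their mean minus `m h² / 2`. -/
theorem second_diff_le_of_super (hlsc : LowerSemicontinuousOn w (Icc 0 T ×ˢ univ))
    (hw : IsInteriorSuper f σ γ T w) {t : ℝ} (ht0 : 0 ≤ t) (htT : t < T) {x h m : ℝ} (hh : 0 < h)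
    (hm : ∀ y ∈ Icc (x - h) (x + h), γ y < m) :
    w (t, x + h) + w (t, x - h) - 2 * w (t, x) ≤ m * h ^ 2 := by
  set A := (w (t, x + h) + w (t, x - h)) / 2 - m / 2 * h ^ 2 with hA
  set b := (w (t, x + h) - w (t, x - h)) / (2 * h) with hb
  have hbh : b * h = (w (t, x + h) - w (t, x - h)) / 2 := by rw [hb]; field_simp
  have := parabola_le hlsc hw ht0 htT (y₁ := x - h) (y₂ := x + h) (m := m)
    (α := A - b * x + m / 2 * x ^ 2) (β := b - m * x) hm
    (by nlinarith) (by nlinarith) (y := x) ⟨by linarith, by linarith⟩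
  nlinarith

/-- A chord of `w - m y²/2` is a parabola of curvature `m` for `w`. -/
theorem concaveOn_of_super (hlsc : LowerSemicontinuousOn w (Icc 0 T ×ˢ univ))
    (hw : IsInteriorSuper f σ γ T w) {t : ℝ} (ht0 : 0 ≤ t) (htT : t < T) {m : ℝ}
    (hm : ∀ y, γ y < m) : ConcaveOn ℝ univ fun y => w (t, y) - m / 2 * y ^ 2 := by
  refine LinearOrder.concaveOn_of_lt convex_univ ?_
  intro x _ y _ hxy a b ha hb hab
  simp only [smul_eq_mul]
  have hd : 0 < y - x := by linarith
  set g : ℝ → ℝ := fun y => w (t, y) - m / 2 * y ^ 2 with hg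
  set k := (g y - g x) / (y - x) with hk
  have hkd : k * (y - x) = g y - g x := by rw [hk]; field_simp
  have hb' : b = 1 - a := by linarith
  have := parabola_le hlsc hw ht0 htT (y₁ := x) (y₂ := y) (m := m) (α := g x - k * x) (β := k)
    (fun y _ => hm y) (by simp only [hg]; linarith)
    (by have : g y = w (t, y) - m / 2 * y ^ 2 := rfl
        linarith) (y := a * x + b * y) ⟨by subst hb'; nlinarith, by subst hb'; nlinarith⟩
  have h2 : k * (a * x + b * y) - k * x = b * (g y - g x) := by
    rw [← hkd, hb']; ring
  have h3 : a * g x + b * g y = g x + b * (g y - g x) := by rw [hb']; ring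
  change a * g x + b * g y ≤ w (t, a * x + b * y) - m / 2 * (a * x + b * y) ^ 2
  linarith

/-- The constant `1 / f₀ + 1` exceeds `γ` everywhere, and a finite concave function on the line is
locally Lipschitz. -/
theorem continuous_slice_of_super (C : CoeffBounds f σ γ f₀ s₀ ι)
    (hlsc : LowerSemicontinuousOn w (Icc 0 T ×ˢ univ))
    (hw : IsInteriorSuper f σ γ T w) {t : ℝ} (ht0 : 0 ≤ t) (htT : t < T) :
    Continuous fun y => w (t, y) := by
  have h := (concaveOn_of_super hlsc hw ht0 htT (m := 1 / f₀ + 1)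
    (fun y => by linarith [C.γ_bound y])).locallyLipschitz.continuous
  have : Continuous fun y => (w (t, y) - (1 / f₀ + 1) / 2 * y ^ 2) + (1 / f₀ + 1) / 2 * y ^ 2 :=
    h.add (by fun_prop)
  simpa using this

end

end
end GammaHedging

/-! ### Supersolutions dominate Gaussian averages of their later values. -/

namespace GammaHedging
noncomputable section

open Filter Topology MeasureTheory ProbabilityTheory

/-- Explicit part of the comparison function in `heat_inequality`. -/
def heatCorrection (t₁ x₀ a c k κ : ℝ) (p : ℝ × ℝ) : ℝ :=
  -(c + κ) * (t₁ - p.1) - k * ((p.2 - x₀) ^ 2 * (t₁ - p.1) + a * (t₁ - p.1) ^ 2)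
    - κ * ((p.2 - x₀) ^ 2 + 2 * a * (t₁ - p.1))

theorem contDiff_heatCorrection (t₁ x₀ a c k κ : ℝ) :
    ContDiff ℝ 2 (heatCorrection t₁ x₀ a c k κ) := by
  unfold heatCorrection; fun_prop

/-- The first term produces `c + κ` and the second the source `k (x - x₀)²`. The third solves the
homogeneous heat equation and serves only to be very negative at the lateral sides. -/
theorem heatCorrection_jet (t₁ x₀ a c k κ : ℝ) (p : ℝ × ℝ) :
    dT (heatCorrection t₁ x₀ a c k κ) p + a * dXX (heatCorrection t₁ x₀ a c k κ) p =
      c + κ + k * (p.2 - x₀) ^ 2 := by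
  have h1 : dT (heatCorrection t₁ x₀ a c k κ) p =
      (c + κ) + k * ((p.2 - x₀) ^ 2 + 2 * a * (t₁ - p.1)) + 2 * a * κ := by
    have e : HasDerivAt (fun s : ℝ => t₁ - s) (-1) p.1 := by
      simpa using (hasDerivAt_id p.1).const_sub t₁
    have := ((e.const_mul (-(c + κ))).sub (((e.const_mul ((p.2 - x₀) ^ 2)).add
      ((e.pow 2).const_mul a)).const_mul k)).sub
      (((e.const_mul (2 * a)).const_add ((p.2 - x₀) ^ 2)).const_mul κ)
    refine (HasDerivAt.deriv (this.congr_deriv ?_))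
    simp; ring
  have e : ∀ y, HasDerivAt (fun y : ℝ => y - x₀) 1 y := fun y => (hasDerivAt_id y).sub_const x₀
  have h2 : ∀ y, dX (heatCorrection t₁ x₀ a c k κ) (p.1, y) =
      -(2 * k * (t₁ - p.1) + 2 * κ) * (y - x₀) := by
    intro y
    have := ((((((e y).pow 2).mul_const (t₁ - p.1)).add_const (a * (t₁ - p.1) ^ 2)).const_mul
      k).const_sub (-(c + κ) * (t₁ - p.1))).sub
      ((((e y).pow 2).add_const (2 * a * (t₁ - p.1))).const_mul κ)
    refine (HasDerivAt.deriv (this.congr_deriv ?_))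
    simp; ring
  have h3 := hasDerivAt_dXX (contDiff_heatCorrection t₁ x₀ a c k κ) p
  simp_rw [h2] at h3
  have h4 := h3.unique ((e p.2).const_mul (-(2 * k * (t₁ - p.1) + 2 * κ)))
  rw [h1, h4]
  ring

section

variable {f σ γ : ℝ → ℝ} {f₀ s₀ ι T : ℝ} {w : ℝ × ℝ → ℝ} (C : CoeffBounds f σ γ f₀ s₀ ι)
include C

/-- Comparison of a supersolution with a heat flow starting below it. -/
theorem heat_comparison (hlsc : LowerSemicontinuousOn w (Icc 0 T ×ˢ univ))
    (hw : IsInteriorSuper f σ γ T w) {K : ℝ}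
    (hK : ∀ t ∈ Icc 0 T, ∀ x, |w (t, x)| ≤ K * (1 + |x|))
    {s c k x₀ t₀ t₁ κ L B : ℝ} (hk : 0 ≤ k)
    (hc : ∀ x, ctrlCost f σ s x ≤ c + k * (x - x₀) ^ 2)
    (ht₀ : 0 ≤ t₀) (ht₁ : t₀ ≤ t₁) (hT : t₁ < T) (hκ : 0 < κ) (hL : 0 < L)
    {ψ : ℝ → ℝ} (hflow : HasHeatFlow s t₁ ψ)
    (hψ : ∀ x ∈ Icc (x₀ - L) (x₀ + L), ψ x ≤ w (t₁, x)) (hB : ∀ x, |ψ x| ≤ B)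
    (hBL : B + (|c| + κ) * T + K * (1 + |x₀| + L) ≤ κ * L ^ 2) :
    ∫ y, ψ (x₀ + y) ∂(gaussianReal 0 (s ^ 2 * (t₁ - t₀)).toNNReal)
      + heatCorrection t₁ x₀ (s ^ 2 / 2) c k κ (t₀, x₀) ≤ w (t₀, x₀) := by
  obtain ⟨hψc, -, z, hz, hpde, hz1, hrep⟩ := hflow
  set a := s ^ 2 / 2 with ha
  have ha0 : 0 ≤ a := by positivity
  set φ : ℝ × ℝ → ℝ := fun p => z p + heatCorrection t₁ x₀ a c k κ p with hφdef
  have hφ : ContDiff ℝ 2 φ := hz.add (contDiff_heatCorrection _ _ _ _ _ _)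
  rw [← hrep t₀ ht₁ x₀]
  -- The bottom `max 0 (-1) = 0` is the form required by `isInteriorSuper_jet` with `a = -1`, so a
  -- minimum at time zero is admitted.
  set D := Icc (max 0 (-1)) t₁ ×ˢ Icc (x₀ - L) (x₀ + L) with hD
  have hDK : D ⊆ Icc 0 T ×ˢ univ := by
    rintro p ⟨⟨h1, h2⟩, -⟩
    exact ⟨⟨(le_max_left _ _).trans h1, h2.trans hT.le⟩, mem_univ _⟩
  have hp0 : (t₀, x₀) ∈ D :=
    ⟨⟨max_le ht₀ (by linarith), ht₁⟩, ⟨by simp only; linarith, by simp only; linarith⟩⟩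
  have hl : LowerSemicontinuousOn (fun p => w p - φ p) D := by
    simp only [sub_eq_add_neg]
    exact (hlsc.mono hDK).add (hφ.continuous.neg.lowerSemicontinuous.lowerSemicontinuousOn _)
  obtain ⟨p, hp, hpmin⟩ := hl.exists_isMinOn ⟨_, hp0⟩ (isCompact_Icc.prod isCompact_Icc)
  have hmain : w p - φ p ≤ w (t₀, x₀) - φ (t₀, x₀) := hpmin hp0
  suffices h : 0 ≤ w p - φ p by
    simp only [hφdef] at hmain h
    linarith
  by_contra hcon
  push Not at hcon
  have hp1 : 0 ≤ p.1 := (hDK hp).1.1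
  have hzB : |z p| ≤ B := by
    rw [show z p = z (p.1, p.2) from rfl, hrep p.1 hp.1.2 p.2]
    have := norm_integral_le_of_norm_le_const (μ := gaussianReal 0 (s ^ 2 * (t₁ - p.1)).toNNReal)
      (f := fun y => ψ (p.2 + y)) (Eventually.of_forall fun y => hB (p.2 + y))
    simpa using this
  have htime : p.1 ≠ t₁ := by
    intro he
    have h1 := hψ p.2 hp.2
    have h2 : w p = w (t₁, p.2) := by rw [← he]
    have h3 : z p = ψ p.2 := by rw [← hz1, ← he]
    have h4 : heatCorrection t₁ x₀ a c k κ p ≤ 0 := by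
      unfold heatCorrection
      rw [he]
      nlinarith [mul_nonneg hκ.le (sq_nonneg (p.2 - x₀))]
    simp only [hφdef] at hcon
    linarith
  -- On the lateral sides `-κ L²` outweighs all other terms, by `hBL`.
  have hlat : (p.2 - x₀) ^ 2 ≠ L ^ 2 := by
    intro he
    have h1 : |p.2| ≤ |x₀| + L := by
      have h2 : |p.2 - x₀| ≤ L := by rw [abs_le]; constructor <;> linarith [hp.2.1, hp.2.2]
      have := abs_sub_abs_le_abs_sub p.2 x₀
      linarith
    have hK0 : 0 ≤ K := by
      have := (abs_nonneg _).trans (hK p.1 (hDK hp).1 0)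
      simpa using this
    have h2 := (abs_le.1 ((hK p.1 (hDK hp).1 p.2))).1
    have h3 : K * (1 + |p.2|) ≤ K * (1 + |x₀| + L) := mul_le_mul_of_nonneg_left (by linarith) hK0
    have h4 : heatCorrection t₁ x₀ a c k κ p ≤ (|c| + κ) * T - κ * L ^ 2 := by
      unfold heatCorrection
      rw [he]
      have hd : 0 ≤ t₁ - p.1 := by linarith [hp.1.2]
      have hd2 : t₁ - p.1 ≤ T := by linarith
      have e1 : -(c + κ) * (t₁ - p.1) ≤ (|c| + κ) * T := by
        have : -(c + κ) ≤ |c| + κ := by linarith [neg_abs_le c]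
        calc -(c + κ) * (t₁ - p.1) ≤ (|c| + κ) * (t₁ - p.1) :=
              mul_le_mul_of_nonneg_right this hd
          _ ≤ _ := mul_le_mul_of_nonneg_left hd2 (by positivity)
      have e2 : 0 ≤ k * (L ^ 2 * (t₁ - p.1) + a * (t₁ - p.1) ^ 2) := by positivity
      have e3 : 0 ≤ κ * (2 * a * (t₁ - p.1)) := by positivity
      linarith
    have h5 : w p = w (p.1, p.2) := rfl
    simp only [hφdef] at hcon
    linarith [le_abs_self (z p)]
  have hl1 : x₀ - L < p.2 := by
    refine lt_of_le_of_ne hp.2.1 fun he => hlat ?_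
    rw [← he]; ring
  have hl2 : p.2 < x₀ + L := by
    refine lt_of_le_of_ne hp.2.2 fun he => hlat ?_
    rw [he]; ring
  have hjet := isInteriorSuper_jet hw hφ (a := -1) hT hp (fun h => by linarith)
    (lt_of_le_of_ne hp.1.2 htime) hl1 hl2 hpmin
  -- The test function has `∂ₜφ + s²/2 ∂ₓₓφ = c + κ + k (x - x₀)²`, larger than the cost by at least
  -- `κ`.
  have h1 := C.le_of_nonneg hjet s
  have h2 := hc p.2
  rw [dT_add hz (contDiff_heatCorrection _ _ _ _ _ _),
    dXX_add hz (contDiff_heatCorrection _ _ _ _ _ _)] at h1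
  have h3 := hpde p
  have h4 := heatCorrection_jet t₁ x₀ a c k κ p
  rw [← ha] at h1
  linarith

/-- Supersolutions dominate the Gaussian averages of their later values. -/
theorem heat_inequality (hlsc : LowerSemicontinuousOn w (Icc 0 T ×ˢ univ))
    (hw : IsInteriorSuper f σ γ T w) {K : ℝ}
    (hK : ∀ t ∈ Icc 0 T, ∀ x, |w (t, x)| ≤ K * (1 + |x|))
    {s c k x₀ t₀ t₁ : ℝ} (hk : 0 ≤ k) (hc : ∀ x, ctrlCost f σ s x ≤ c + k * (x - x₀) ^ 2)
    (ht₀ : 0 ≤ t₀) (ht₁ : t₀ ≤ t₁) (hT : t₁ < T) :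
    ∫ y, w (t₁, x₀ + y) ∂(gaussianReal 0 (s ^ 2 * (t₁ - t₀)).toNNReal) ≤
      w (t₀, x₀) + c * (t₁ - t₀) + k * (s ^ 2 / 2) * (t₁ - t₀) ^ 2 := by
  have hcont := continuous_slice_of_super C hlsc hw (ht₀.trans ht₁) hT
  have hT0 : 0 ≤ T := by linarith
  have ht₁mem : t₁ ∈ Icc 0 T := ⟨by linarith, hT.le⟩
  have hK0 : 0 ≤ K := by simpa using (abs_nonneg _).trans (hK t₁ ht₁mem 0)
  set v := (s ^ 2 * (t₁ - t₀)).toNNReal with hv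
  have hvv : (v : ℝ) = s ^ 2 * (t₁ - t₀) :=
    Real.coe_toNNReal _ (mul_nonneg (sq_nonneg _) (by linarith))
  have hint : Integrable (fun y => w (t₁, x₀ + y)) (gaussianReal 0 v) := by
    refine integrable_gaussianReal_of_growth (B := K * (1 + |x₀|))
      (hcont.comp (continuous_const.add continuous_id)).aestronglyMeasurable fun y => ?_
    refine (hK t₁ ht₁mem (x₀ + y)).trans ?_
    rw [mul_assoc]
    refine mul_le_mul_of_nonneg_left ?_ hK0
    nlinarith [abs_add_le x₀ y, abs_nonneg x₀, abs_nonneg y]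
  have key : ∀ κ : ℝ, 0 < κ → κ ≤ 1 →
      ∫ y, w (t₁, x₀ + y) ∂(gaussianReal 0 v) ≤
      w (t₀, x₀) + c * (t₁ - t₀) + k * (s ^ 2 / 2) * (t₁ - t₀) ^ 2
        + κ * (3 + (t₁ - t₀) + s ^ 2 * (t₁ - t₀)) := by
    intro κ hκ hκ1
    -- For `|y| ≥ L`, `D |y| ≤ (D / L) y²` controls both `w` and `ψ`; this tail costs `D v / L ≤ κ`
    -- on average. The constant `E` is such that `E ≤ κ L` yields the lateral condition of
    -- `heat_comparison`.
    set D := 2 * K * (2 + |x₀|) + 2 with hD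
    have hDpos : 0 < D := by positivity
    set E := 2 * K * (2 + |x₀|) + 3 + (|c| + κ) * T with hE
    have hEpos : 0 < E := by positivity
    set L := max 1 (max (E / κ) (D * v / κ)) with hLdef
    have hL1 : 1 ≤ L := le_max_left _ _
    have hL2 : E ≤ κ * L := by
      have : E / κ ≤ L := (le_max_left _ _).trans (le_max_right _ _)
      rw [div_le_iff₀ hκ] at this; linarith
    have hL3 : D * v / L ≤ κ := by
      have : D * v / κ ≤ L := (le_max_right _ _).trans (le_max_right _ _)
      rw [div_le_iff₀ hκ] at this
      rw [div_le_iff₀ (by linarith)]; linarith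
    have hL0 : 0 < L := by linarith
    set B := K * (1 + |x₀| + L) + κ with hB
    have hx : ∀ x ∈ Icc (x₀ - L) (x₀ + L), |x| ≤ |x₀| + L := by
      intro x hx
      have h2 : |x - x₀| ≤ L := by rw [abs_le]; constructor <;> linarith [hx.1, hx.2]
      have := abs_sub_abs_le_abs_sub x x₀
      linarith
    -- Approximating `w - κ` within `κ` gives `w - 2κ ≤ ψ ≤ w` on the interval. With the tail, this
    -- accounts for the `3κ` in `key`.
    obtain ⟨ψ, hflow, hnear, hψB⟩ := exists_hasHeatFlow_near s t₁ x₀ (B := B) hL0 hκ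
      (h := fun x => w (t₁, x) - κ) (hcont.sub continuous_const).continuousOn (by
        intro x hxm
        have h1 := hK t₁ ht₁mem x
        have h2 : K * (1 + |x|) ≤ K * (1 + |x₀| + L) :=
          mul_le_mul_of_nonneg_left (by linarith [hx x hxm]) hK0
        have h3 := abs_sub (w (t₁, x)) κ
        rw [abs_of_pos hκ] at h3
        linarith)
    have hcomp := heat_comparison C hlsc hw hK (x₀ := x₀) (t₀ := t₀) (κ := κ) (L := L)
      (B := B + κ) hk hc ht₀ ht₁ hT hκ hL0 hflow
      (fun x hxm => by linarith [(abs_le.1 (hnear x hxm)).2]) hψB (by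
        have : K * (1 + |x₀| + L) ≤ K * (2 + |x₀|) * L := by
          rw [mul_assoc]
          exact mul_le_mul_of_nonneg_left (by nlinarith [abs_nonneg x₀]) hK0
        have h4 : K * (2 + |x₀|) * L * 2 + 3 * L + (|c| + κ) * T * L ≤ κ * L ^ 2 := by
          calc _ = E * L := by rw [hE]; ring
            _ ≤ κ * L * L := mul_le_mul_of_nonneg_right hL2 hL0.le
            _ = _ := by ring
        have h5 : (|c| + κ) * T ≤ (|c| + κ) * T * L :=
          le_mul_of_one_le_right (by positivity) hL1
        linarith)
    have hlow : ∀ y, w (t₁, x₀ + y) - 2 * κ - D / L * y ^ 2 ≤ ψ (x₀ + y) := by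
      intro y
      have hDy : 0 ≤ D / L * y ^ 2 := by positivity
      rcases le_or_gt |y| L with h | h
      · have := (abs_le.1 (hnear (x₀ + y) ⟨by linarith [(abs_le.1 h).1],
          by linarith [(abs_le.1 h).2]⟩)).1
        linarith
      · have h1 := (abs_le.1 (hψB (x₀ + y))).1
        have h2 := (abs_le.1 (hK t₁ ht₁mem (x₀ + y))).2
        have h3 := abs_add_le x₀ y
        have h4 : D * |y| ≤ D / L * y ^ 2 := by
          rw [← sq_abs y, div_mul_eq_mul_div, le_div_iff₀ hL0]
          have := mul_le_mul_of_nonneg_left h.le (show 0 ≤ D * |y| by positivity)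
          linarith
        have hy1 : 1 ≤ |y| := by linarith
        have h5 : K * (1 + |x₀ + y|) + (B + κ) ≤ D * |y| := by
          have e1 : K * (1 + |x₀ + y|) ≤ K * (1 + |x₀| + |y|) :=
            mul_le_mul_of_nonneg_left (by linarith) hK0
          have e2 : K * (1 + |x₀| + L) ≤ K * (1 + |x₀| + |y|) :=
            mul_le_mul_of_nonneg_left (by linarith) hK0
          have e3 : K * (1 + |x₀| + |y|) ≤ K * ((2 + |x₀|) * |y|) :=
            mul_le_mul_of_nonneg_left (by nlinarith [abs_nonneg x₀]) hK0
          rw [hD]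
          nlinarith
        linarith
    have hsq := integrable_pow_gaussianReal v 2
    have hint' : Integrable (fun y => w (t₁, x₀ + y) - 2 * κ) (gaussianReal 0 v) :=
      hint.sub (integrable_const _)
    have hmono : ∫ y, (w (t₁, x₀ + y) - 2 * κ - D / L * y ^ 2) ∂(gaussianReal 0 v) ≤
        ∫ y, ψ (x₀ + y) ∂(gaussianReal 0 v) := by
      refine integral_mono (hint'.sub (hsq.const_mul _)) ?_ hlow
      exact integrable_gaussianReal_of_bounded
        (hflow.1.comp (continuous_const.add continuous_id)) (fun y => hψB _) v
    rw [integral_sub hint' (hsq.const_mul _),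
      integral_sub hint (integrable_const _), integral_const_mul, integral_const_mul,
      integral_sq_gaussianReal] at hmono
    simp only [integral_const, probReal_univ, smul_eq_mul, one_mul] at hmono
    have h6 : D / L * v = D * v / L := by ring
    rw [← hv] at hcomp
    have hcorr : heatCorrection t₁ x₀ (s ^ 2 / 2) c k κ (t₀, x₀) =
      -(c * (t₁ - t₀) + k * (s ^ 2 / 2) * (t₁ - t₀) ^ 2
        + κ * ((t₁ - t₀) + s ^ 2 * (t₁ - t₀))) := by
      unfold heatCorrection; ring
    rw [hcorr] at hcomp
    linarith
  set m := 3 + (t₁ - t₀) + s ^ 2 * (t₁ - t₀) with hm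
  have hm0 : 0 < m := by
    have : 0 ≤ s ^ 2 * (t₁ - t₀) := mul_nonneg (sq_nonneg _) (by linarith)
    linarith
  refine le_of_forall_pos_le_add fun ε hε => ?_
  have := key (min 1 (ε / m)) (by positivity) (min_le_left _ _)
  have h2 : min 1 (ε / m) * m ≤ ε := by
    have := min_le_right 1 (ε / m)
    rwa [le_div_iff₀ hm0] at this
  linarith

/-- Supersolutions cannot grow faster than linearly in time. -/
theorem time_monotone_of_super (hlsc : LowerSemicontinuousOn w (Icc 0 T ×ˢ univ))
    (hw : IsInteriorSuper f σ γ T w) {K : ℝ}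
    (hK : ∀ t ∈ Icc 0 T, ∀ x, |w (t, x)| ≤ K * (1 + |x|))
    {x t₀ t₁ : ℝ} (ht₀ : 0 ≤ t₀) (ht₁ : t₀ ≤ t₁) (hT : t₁ < T) :
    w (t₁, x) ≤ w (t₀, x) + s₀ ^ 2 / (2 * f₀) * (t₁ - t₀) := by
  -- For `s = 0` the Gaussian is a Dirac mass and no space average remains.
  have hc : ∀ y, ctrlCost f σ 0 y ≤ s₀ ^ 2 / (2 * f₀) + 0 * (y - x) ^ 2 := by
    intro y
    have h1 := C.f₀_pos
    have h2 := C.σ_pos y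
    have h3 := C.σ_le y
    unfold ctrlCost
    rw [zero_mul, add_zero]
    apply div_le_div₀ (by positivity) _ (by positivity) (by linarith [C.f_ge y])
    nlinarith
  have := heat_inequality C hlsc hw hK le_rfl hc ht₀ ht₁ hT
  simpa [gaussianReal_zero_var] using this

end

end
end GammaHedging

/-! ### One-sided mollifiers and extension beyond the terminal time. -/

namespace GammaHedging
noncomputable section

open Filter Topology MeasureTheory ProbabilityTheory

theorem dXX_le_of_second_diff {φ : ℝ × ℝ → ℝ} (hφ : ContDiff ℝ 2 φ) {p : ℝ × ℝ} {m : ℝ}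
    (h : ∀ᶠ h in 𝓝[>] (0 : ℝ), φ (p.1, p.2 + h) + φ (p.1, p.2 - h) - 2 * φ p ≤ m * h ^ 2) :
    dXX φ p ≤ m := by
  by_contra hcon
  push Not at hcon
  set κ := (dXX φ p - m) / 2 with hκ
  have hκ0 : 0 < κ := by simp only [hκ]; linarith
  obtain ⟨r, hr, H⟩ := Metric.continuous_iff.1 (continuous_dXX hφ) p κ hκ0
  have h2 : ∀ᶠ h in 𝓝[>] (0 : ℝ), h < r := nhdsWithin_le_nhds (Iio_mem_nhds hr)
  obtain ⟨h, h1, h3, h4⟩ := (h.and (h2.and self_mem_nhdsWithin)).exists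
  have h4' : 0 < h := h4
  have := le_second_diff (ψ := fun y => φ (p.1, y)) (ψ' := fun y => dX φ (p.1, y))
    (ψ'' := fun y => dXX φ (p.1, y)) (fun y => hasDerivAt_dX hφ (p.1, y))
    (fun y => hasDerivAt_dXX hφ (p.1, y)) (x := p.2) h4'.le (m := m + κ) (by
      intro y hy
      have h5 := H (p.1, y) (by
        rw [Prod.dist_eq, max_lt_iff]
        simp only [dist_self, Real.dist_eq]
        refine ⟨hr, ?_⟩
        rw [abs_lt]; constructor <;> linarith [hy.1, hy.2])
      rw [Real.dist_eq, abs_lt] at h5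
      simp only [hκ] at h5 ⊢
      linarith)
  have h6 : 0 < κ * h ^ 2 := by positivity
  have h7 : φ p = φ (p.1, p.2) := rfl
  linarith

theorem deriv_nonpos_of_right {ψ : ℝ → ℝ} {d t : ℝ} (hd : HasDerivAt ψ d t)
    (h : ∀ᶠ r in 𝓝[>] t, ψ r ≤ ψ t) : d ≤ 0 := by
  have h1 : Tendsto (slope ψ t) (𝓝[>] t) (𝓝 d) :=
    (hasDerivAt_iff_tendsto_slope.1 hd).mono_left
      (nhdsWithin_mono _ fun r (hr : t < r) => (ne_of_gt hr : r ≠ t))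
  refine le_of_tendsto h1 ?_
  filter_upwards [h, self_mem_nhdsWithin] with r hr hr'
  have hr'' : t < r := hr'
  rw [slope_def_field]
  exact div_nonpos_of_nonpos_of_nonneg (by linarith) (by linarith)

section mollifier

/-- Only later times are averaged, so the regularisation is available down to `t = 0`, at the price
of an extension past `T`. A probability measure is convenient for integrating inequalities;
smoothness comes from convolution with a bump around `(-ε, 0)`, of which the measure is the
reflection. -/
theorem exists_mollifier {ε : ℝ} (hε : 0 < ε) : ∃ μ : Measure (ℝ × ℝ), IsProbabilityMeasure μ ∧
    (∀ᵐ q ∂μ, 0 < q.1 ∧ q.1 < 2 * ε ∧ |q.2| < ε) ∧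
    ∀ e : ℝ × ℝ → ℝ, LocallyIntegrable e volume → Measurable e →
      ContDiff ℝ 2 fun p => ∫ q, e (p + q) ∂μ := by
  let b : ContDiffBump ((-ε, 0) : ℝ × ℝ) := ⟨ε / 2, ε, by positivity, by linarith⟩
  set ρ : ℝ × ℝ → ℝ := b.normed volume with hρ
  have hρc : Continuous ρ := b.continuous_normed
  set ν : Measure (ℝ × ℝ) := volume.withDensity fun q => ((ρ q).toNNReal : ENNReal) with hν
  have hρm : Measurable fun q => (ρ q).toNNReal := hρc.measurable.real_toNNReal
  have hν1 : IsProbabilityMeasure ν := by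
    refine ⟨?_⟩
    rw [hν, withDensity_apply _ MeasurableSet.univ, Measure.restrict_univ]
    have h1 := ofReal_integral_eq_lintegral_ofReal (b.integrable_normed (μ := volume))
      (Eventually.of_forall fun q => b.nonneg_normed q)
    rw [b.integral_normed, ENNReal.ofReal_one] at h1
    exact h1.symm
  have hνs : ∀ᵐ q ∂ν, q ∈ Metric.ball ((-ε, 0) : ℝ × ℝ) ε := by
    rw [hν, ae_withDensity_iff hρm.coe_nnreal_ennreal]
    refine Eventually.of_forall fun q hq => ?_
    have : q ∈ Function.support ρ := by
      intro h0
      apply hq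
      rw [h0]; simp
    rwa [hρ, b.support_normed_eq] at this
  refine ⟨ν.map (fun q => -q), ?_, ?_, ?_⟩
  · exact Measure.isProbabilityMeasure_map measurable_neg.aemeasurable
  · rw [ae_map_iff measurable_neg.aemeasurable]
    · filter_upwards [hνs] with q hq
      rw [Metric.mem_ball, Prod.dist_eq, max_lt_iff] at hq
      simp only [Real.dist_eq, abs_lt] at hq
      simp only [Prod.fst_neg, Prod.snd_neg, abs_neg, abs_lt]
      refine ⟨by linarith, by linarith, by linarith, by linarith⟩
    · exact ((measurableSet_lt measurable_const measurable_fst).inter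
        ((measurableSet_lt measurable_fst measurable_const).inter
          (measurableSet_lt (measurable_snd.abs) measurable_const)))
  · intro e he hem
    have h1 : (fun p => ∫ q, e (p + q) ∂(ν.map fun q => -q)) =
        convolution ρ e (ContinuousLinearMap.mul ℝ ℝ) volume := by
      ext p
      have hm1 : Measurable fun q => e (p + q) := hem.comp (by fun_prop)
      rw [integral_map measurable_neg.aemeasurable hm1.aestronglyMeasurable]
      rw [hν, integral_withDensity_eq_integral_smul hρm]
      unfold convolution
      refine integral_congr_ae (Eventually.of_forall fun q => ?_)
      simp only [NNReal.smul_def, smul_eq_mul, ContinuousLinearMap.mul_apply', sub_eq_add_neg]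
      rw [Real.coe_toNNReal _ (b.nonneg_normed q)]
    rw [h1]
    exact b.hasCompactSupport_normed.contDiff_convolution_left _ b.contDiff_normed he

end mollifier

/-- Extension of a supersolution beyond the terminal time, decreasing at rate `Q`. -/
def timeExt (T Q : ℝ) (w : ℝ × ℝ → ℝ) (p : ℝ × ℝ) : ℝ :=
  w (max 0 (min T p.1), p.2) - Q * max 0 (p.1 - T)

section extension

variable {T Q : ℝ} {w : ℝ × ℝ → ℝ}

theorem timeExt_of_le {p : ℝ × ℝ} (h0 : 0 ≤ p.1) (hT : p.1 ≤ T) : timeExt T Q w p = w p := by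
  unfold timeExt
  rw [min_eq_right hT, max_eq_right h0, max_eq_left (by linarith)]
  simp

theorem timeExt_of_ge (hT0 : 0 ≤ T) {p : ℝ × ℝ} (hT : T ≤ p.1) :
    timeExt T Q w p = w (T, p.2) - Q * (p.1 - T) := by
  unfold timeExt
  rw [min_eq_left hT, max_eq_right hT0, max_eq_right (by linarith)]

theorem lowerSemicontinuous_timeExt (hT : 0 ≤ T)
    (hw : LowerSemicontinuousOn w (Icc 0 T ×ˢ univ)) : LowerSemicontinuous (timeExt T Q w) := by
  unfold timeExt
  simp only [sub_eq_add_neg]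
  refine LowerSemicontinuous.add ?_ (Continuous.lowerSemicontinuous (by fun_prop))
  rw [← lowerSemicontinuousOn_univ_iff]
  intro p _ y hy
  have hc : ContinuousWithinAt (fun p : ℝ × ℝ => (max 0 (min T p.1), p.2)) univ p :=
    Continuous.continuousWithinAt (by fun_prop)
  have hmaps : MapsTo (fun p : ℝ × ℝ => (max 0 (min T p.1), p.2)) univ (Icc 0 T ×ˢ univ) :=
    fun p _ => ⟨⟨le_max_left _ _, max_le hT (min_le_left _ _)⟩, mem_univ _⟩
  exact (hc.tendsto_nhdsWithin hmaps).eventually (hw _ (hmaps (mem_univ p)) y hy)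

theorem abs_timeExt_le (hT : 0 ≤ T) (hQ : 0 ≤ Q) {K : ℝ}
    (hK : ∀ t ∈ Icc 0 T, ∀ x, |w (t, x)| ≤ K * (1 + |x|)) {t : ℝ} (ht : t ≤ T + 1) (x : ℝ) :
    |timeExt T Q w (t, x)| ≤ (K + Q) * (1 + |x|) := by
  have h1 := hK (max 0 (min T t)) ⟨le_max_left _ _, max_le hT (min_le_left _ _)⟩ x
  have h2 : |Q * max 0 (t - T)| ≤ Q * (1 + |x|) := by
    rw [abs_of_nonneg (by positivity)]
    refine mul_le_mul_of_nonneg_left (max_le (by positivity) ?_) hQ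
    linarith [abs_nonneg x]
  calc |timeExt T Q w (t, x)| ≤ |w (max 0 (min T t), x)| + |Q * max 0 (t - T)| := abs_sub _ _
    _ ≤ _ := by linarith

/-- From `T` on, the curvature constraint is inherited from the terminal data through `hG`, and the
decay rate `Q` dominates the nonlinearity by `nonlin_le`. -/
theorem isInteriorSuper_timeExt {f σ γ Γ : ℝ → ℝ} {f₀ s₀ ι : ℝ} (C : CoeffBounds f σ γ f₀ s₀ ι)
    (hT : 0 ≤ T) (hw : IsInteriorSuper f σ γ T w)
    (hQ : (s₀ / (ι * f₀)) ^ 2 / (2 * f₀) ≤ Q) (hΓ : ContDiff ℝ 2 Γ)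
    (hΓγ : ∀ x, iteratedDeriv 2 Γ x = γ x)
    (hG : ∀ x h, w (T, x + h) + w (T, x - h) - 2 * w (T, x) ≤ Γ (x + h) + Γ (x - h) - 2 * Γ x) :
    IsInteriorSuper f σ γ (T + 1) (timeExt T Q w) := by
  intro φ hφ t x ht0 htT hmin
  rcases lt_or_ge t T with h | h
  · refine hw φ hφ t x ht0 h ?_
    have h1 := hmin.on_subset (s := Ico 0 T ×ˢ univ)
      (prod_mono (Ico_subset_Ico_right (by linarith)) subset_rfl)
    filter_upwards [h1, self_mem_nhdsWithin] with z hz hz'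
    rwa [timeExt_of_le hz'.1.1 hz'.1.2.le, timeExt_of_le (p := (t, x)) ht0 h.le] at hz
  · rw [pricingOpOn_eq]
    have hev := eventually_nhdsWithin_iff.1 hmin
    -- Only times after `t` are used, which makes the argument valid at `t = T` too.
    have hq : dT φ (t, x) ≤ -Q := by
      have hd : HasDerivAt (fun r => φ (r, x) + Q * r) (dT φ (t, x) + Q) t := by
        exact ((hasDerivAt_dT hφ (t, x)).add ((hasDerivAt_id t).const_mul Q)).congr_deriv (by ring)
      have : ∀ᶠ r in 𝓝[>] t, φ (r, x) + Q * r ≤ φ (t, x) + Q * t := by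
        have hc : Tendsto (fun r : ℝ => (r, x)) (𝓝[>] t) (𝓝 (t, x)) :=
          ((Continuous.prodMk_left x).tendsto t).mono_left nhdsWithin_le_nhds
        have h5 : ∀ᶠ r in 𝓝[>] t, r < T + 1 := nhdsWithin_le_nhds (Iio_mem_nhds htT)
        filter_upwards [hc.eventually hev, self_mem_nhdsWithin, h5] with r hr hr' hr''
        have hr1 : t < r := hr'
        have := hr ⟨⟨by simp only; linarith, hr''⟩, mem_univ _⟩
        rw [timeExt_of_ge hT (p := (r, x)) (by simp only; linarith),
          timeExt_of_ge hT (p := (t, x)) h] at this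
        simp only at this
        linarith
      linarith [deriv_nonpos_of_right hd this]
    have hM : dXX φ (t, x) ≤ γ x := by
      refine le_of_forall_pos_le_add fun κ hκ => dXX_le_of_second_diff hφ ?_
      have hc1 : Tendsto (fun h : ℝ => (t, x + h)) (𝓝[>] 0) (𝓝 (t, x)) := by
        have : Continuous fun h : ℝ => (t, x + h) := by fun_prop
        have := this.tendsto 0
        simp only [add_zero] at this
        exact this.mono_left nhdsWithin_le_nhds
      have hc2 : Tendsto (fun h : ℝ => (t, x - h)) (𝓝[>] 0) (𝓝 (t, x)) := by
        have : Continuous fun h : ℝ => (t, x - h) := by fun_prop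
        have := this.tendsto 0
        simp only [sub_zero] at this
        exact this.mono_left nhdsWithin_le_nhds
      obtain ⟨r, hr, H⟩ := Metric.continuous_iff.1 C.γ_cont x κ hκ
      have hr' : ∀ᶠ h in 𝓝[>] (0 : ℝ), h < r := nhdsWithin_le_nhds (Iio_mem_nhds hr)
      filter_upwards [hc1.eventually hev, hc2.eventually hev, hr', self_mem_nhdsWithin] with
        h h1 h2 h3 h4
      have h4' : 0 < h := h4
      have e1 := h1 ⟨⟨ht0, htT⟩, mem_univ _⟩
      have e2 := h2 ⟨⟨ht0, htT⟩, mem_univ _⟩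
      rw [timeExt_of_ge hT (by assumption), timeExt_of_ge hT (by assumption)] at e1 e2
      simp only at e1 e2 ⊢
      have e3 := hG x h
      have hΓ1 : ∀ y, HasDerivAt Γ (deriv Γ y) y :=
        fun y => ((hΓ.differentiable (by norm_num)) y).hasDerivAt
      have hΓ2 : ∀ y, HasDerivAt (deriv Γ) (γ y) y := by
        intro y
        rw [← hΓγ y, iteratedDeriv_succ, iteratedDeriv_one]
        have : ContDiff ℝ 1 (deriv Γ) := by
          have := hΓ.iterate_deriv' 1 1
          simpa using this
        exact ((this.differentiable (by norm_num)) y).hasDerivAt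
      have e4 := second_diff_le hΓ1 hΓ2 (x := x) h4'.le (m := γ x + κ) (by
        intro y hy
        have h5 := H y (by
          rw [Real.dist_eq, abs_lt]; constructor <;> linarith [hy.1, hy.2])
        rw [Real.dist_eq, abs_lt] at h5
        linarith)
      linarith
    exact pricingOp_nonneg_iff.2 ⟨hM, by linarith [C.nonlin_le hM]⟩

end extension

end
end GammaHedging

/-! ### Pointwise inequalities for mollified supersolutions. -/

namespace GammaHedging
noncomputable section

open Filter Topology MeasureTheory ProbabilityTheory

/-- Scaling by `√v`. Only the order `v²` is needed, not the value of the constant. -/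
theorem integral_pow_four_gaussianReal (v : NNReal) :
    ∫ y, y ^ 4 ∂(gaussianReal 0 v) = (v : ℝ) ^ 2 * ∫ y, y ^ 4 ∂(gaussianReal 0 1) := by
  have h := gaussianReal_map_const_mul (μ := 0) (v := 1) (Real.sqrt v)
  have hv : NNReal.mk (Real.sqrt v ^ 2) (sq_nonneg _) * 1 = v := by
    ext; simp
  rw [mul_zero, hv] at h
  rw [← h, integral_map (by fun_prop) (by fun_prop), ← integral_const_mul]
  refine integral_congr_ae (Eventually.of_forall fun y => ?_)
  have : Real.sqrt v ^ 4 = (v : ℝ) ^ 2 := by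
    rw [show (4 : ℕ) = 2 * 2 by norm_num, pow_mul, Real.sq_sqrt v.coe_nonneg]
  simp only [mul_pow, this]

section

variable {T K ε : ℝ} {e : ℝ × ℝ → ℝ} {μ : Measure (ℝ × ℝ)} [IsProbabilityMeasure μ]

theorem integrable_shift (hem : Measurable e) (hK : ∀ t ≤ T, ∀ x, |e (t, x)| ≤ K * (1 + |x|))
    (hK0 : 0 ≤ K) (hμ : ∀ᵐ q ∂μ, 0 < q.1 ∧ q.1 < 2 * ε ∧ |q.2| < ε) {p : ℝ × ℝ}
    (hp : p.1 + 2 * ε ≤ T) : Integrable (fun q => e (p + q)) μ := by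
  refine Integrable.of_bound (hem.comp (by fun_prop)).aestronglyMeasurable
    (K * (1 + (|p.2| + ε))) ?_
  filter_upwards [hμ] with q hq
  refine (hK (p.1 + q.1) (by linarith [hq.2.1]) (p.2 + q.2)).trans ?_
  refine mul_le_mul_of_nonneg_left ?_ hK0
  linarith [abs_add_le p.2 q.2, hq.2.2]

theorem abs_mollify_le (hK : ∀ t ≤ T, ∀ x, |e (t, x)| ≤ K * (1 + |x|))
    (hK0 : 0 ≤ K) (hμ : ∀ᵐ q ∂μ, 0 < q.1 ∧ q.1 < 2 * ε ∧ |q.2| < ε) {p : ℝ × ℝ}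
    (hp : p.1 + 2 * ε ≤ T) : |∫ q, e (p + q) ∂μ| ≤ K * (1 + (|p.2| + ε)) := by
  have := norm_integral_le_of_norm_le_const (μ := μ) (f := fun q => e (p + q))
    (C := K * (1 + (|p.2| + ε))) (by
      filter_upwards [hμ] with q hq
      refine (hK (p.1 + q.1) (by linarith [hq.2.1]) (p.2 + q.2)).trans ?_
      refine mul_le_mul_of_nonneg_left ?_ hK0
      linarith [abs_add_le p.2 q.2, hq.2.2])
  simpa using this

variable {f σ γ : ℝ → ℝ} {f₀ s₀ ι : ℝ}

/-- The second difference bound is averaged over shifts; steps and spatial shifts below `ε` involve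
only points within `2ε` of `p.2`. -/
theorem dXX_mollify_le (hlsc : LowerSemicontinuousOn e (Icc 0 T ×ˢ univ))
    (he : IsInteriorSuper f σ γ T e) (hem : Measurable e)
    (hK : ∀ t ≤ T, ∀ x, |e (t, x)| ≤ K * (1 + |x|))
    (hK0 : 0 ≤ K) (hε : 0 < ε) (hμ : ∀ᵐ q ∂μ, 0 < q.1 ∧ q.1 < 2 * ε ∧ |q.2| < ε)
    (hE : ContDiff ℝ 2 fun p => ∫ q, e (p + q) ∂μ) {p : ℝ × ℝ} (hp0 : 0 ≤ p.1)
    (hp : p.1 + 2 * ε ≤ T) {m : ℝ} (hm : ∀ y, |y - p.2| ≤ 2 * ε → γ y < m) :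
    dXX (fun p => ∫ q, e (p + q) ∂μ) p ≤ m := by
  refine dXX_le_of_second_diff hE ?_
  have h1 : ∀ᶠ h in 𝓝[>] (0 : ℝ), h < ε := nhdsWithin_le_nhds (Iio_mem_nhds hε)
  filter_upwards [h1, self_mem_nhdsWithin] with h hh hh0
  have hh0' : 0 < h := hh0
  have i1 := integrable_shift hem hK hK0 hμ (p := (p.1, p.2 + h)) hp
  have i2 := integrable_shift hem hK hK0 hμ (p := (p.1, p.2 - h)) hp
  have i3 := integrable_shift hem hK hK0 hμ (p := p) hp
  have i12 : Integrable (fun q => e ((p.1, p.2 + h) + q) + e ((p.1, p.2 - h) + q)) μ := i1.add i2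
  rw [← integral_add i1 i2, ← integral_const_mul, ← integral_sub i12 (i3.const_mul 2)]
  have : ∫ q, (e ((p.1, p.2 + h) + q) + e ((p.1, p.2 - h) + q) - 2 * e (p + q)) ∂μ ≤
      ∫ _, m * h ^ 2 ∂μ := by
    refine integral_mono_ae (i12.sub (i3.const_mul 2)) (integrable_const _) ?_
    filter_upwards [hμ] with q hq
    have := second_diff_le_of_super hlsc he (t := p.1 + q.1) (by linarith) (by linarith)
      (x := p.2 + q.2) hh0' (m := m) (by
        intro y hy
        apply hm
        have := abs_lt.1 hq.2.2
        rw [abs_le]; constructor <;> linarith [hy.1, hy.2])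
    have e1 : (p.1, p.2 + h) + q = (p.1 + q.1, p.2 + q.2 + h) := by
      ext <;> simp; ring
    have e2 : (p.1, p.2 - h) + q = (p.1 + q.1, p.2 + q.2 - h) := by
      ext <;> simp; ring
    rw [e1, e2]
    exact this
  simpa using this

/-- Fubini, then `heat_inequality` for each shift. The centre `x + q.2` moves with the shift, hence
a cost bound uniform over nearby centres. -/
theorem integral_mollify_le (C : CoeffBounds f σ γ f₀ s₀ ι)
    (hlsc : LowerSemicontinuousOn e (Icc 0 T ×ˢ univ))
    (he : IsInteriorSuper f σ γ T e) (hem : Measurable e)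
    (hK : ∀ t ≤ T, ∀ x, |e (t, x)| ≤ K * (1 + |x|))
    (hK0 : 0 ≤ K) (hμ : ∀ᵐ q ∂μ, 0 < q.1 ∧ q.1 < 2 * ε ∧ |q.2| < ε)
    {t x s c k δ : ℝ} (ht0 : 0 ≤ t) (hδ : 0 < δ) (ht : t + δ + 2 * ε ≤ T) (hk : 0 ≤ k)
    (hc : ∀ x₀, |x₀ - x| < ε → ∀ y, ctrlCost f σ s y ≤ c + k * (y - x₀) ^ 2) :
    ∫ y, (∫ q, e ((t + δ, x + y) + q) ∂μ) ∂(gaussianReal 0 (s ^ 2 * δ).toNNReal) ≤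
      (∫ q, e ((t, x) + q) ∂μ) + c * δ + k * (s ^ 2 / 2) * δ ^ 2 := by
  set ν := gaussianReal 0 (s ^ 2 * δ).toNNReal with hν
  have hprod : Integrable (Function.uncurry fun y q => e ((t + δ, x + y) + q)) (ν.prod μ) := by
    have h1 : Integrable (fun y : ℝ => K * (1 + (|x| + |y| + ε))) ν := by
      have := (integrable_pow_gaussianReal (s ^ 2 * δ).toNNReal 1).abs
      simp only [pow_one] at this
      exact ((integrable_const _).add (((integrable_const _).add this).add
        (integrable_const _))).const_mul K
    refine (h1.comp_fst μ).mono' (hem.comp (by fun_prop)).aestronglyMeasurable ?_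
    filter_upwards [Measure.quasiMeasurePreserving_snd.ae hμ] with z hz
    refine (hK (t + δ + z.2.1) (by linarith [hz.2.1]) (x + z.1 + z.2.2)).trans ?_
    refine mul_le_mul_of_nonneg_left ?_ hK0
    linarith [abs_add_le (x + z.1) z.2.2, abs_add_le x z.1, hz.2.2]
  rw [integral_integral_swap hprod]
  have i3 := integrable_shift hem hK hK0 hμ (p := (t, x)) (by simp only; linarith)
  have h2 : ∫ q, (∫ y, e ((t + δ, x + y) + q) ∂ν) ∂μ ≤
      ∫ q, (e ((t, x) + q) + (c * δ + k * (s ^ 2 / 2) * δ ^ 2)) ∂μ := by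
    refine integral_mono_ae hprod.integral_prod_right (i3.add (integrable_const _)) ?_
    filter_upwards [hμ] with q hq
    have := heat_inequality C hlsc he (K := K) (fun t ht x => hK t ht.2 x) (s := s) (c := c)
      (x₀ := x + q.2) (t₀ := t + q.1) (t₁ := t + q.1 + δ) hk
      (hc (x + q.2) (by simpa using hq.2.2)) (by linarith) (by linarith) (by linarith)
    rw [add_sub_cancel_left] at this
    have e1 : ∀ y, (t + δ, x + y) + q = (t + q.1 + δ, x + q.2 + y) := by
      intro y; ext <;> simp <;> ring
    simp_rw [e1]
    change _ ≤ e (t + q.1, x + q.2) + _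
    linarith
  refine h2.trans (le_of_eq ?_)
  rw [integral_add i3 (integrable_const _)]
  simp; ring

/-- First-order expansion of the averaged heat inequality: the Gaussian mean of `E (t + δ, x + ·)`
is at least `E (t + δ, x) + m s² δ / 2 - O(δ²)` for `m` just below `∂ₓₓE`; dividing by `δ` and
letting it vanish gives the claim. -/
theorem jet_mollify_le (C : CoeffBounds f σ γ f₀ s₀ ι)
    (hlsc : LowerSemicontinuousOn e (Icc 0 T ×ˢ univ))
    (he : IsInteriorSuper f σ γ T e) (hem : Measurable e)
    (hK : ∀ t ≤ T, ∀ x, |e (t, x)| ≤ K * (1 + |x|))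
    (hK0 : 0 ≤ K) (hε : 0 < ε) (hμ : ∀ᵐ q ∂μ, 0 < q.1 ∧ q.1 < 2 * ε ∧ |q.2| < ε)
    {E : ℝ × ℝ → ℝ} (hEdef : ∀ p, E p = ∫ q, e (p + q) ∂μ) (hE : ContDiff ℝ 2 E)
    {t x s c : ℝ} (ht0 : 0 ≤ t) (ht : t + 2 * ε < T)
    (hc : ∀ y, |y - x| ≤ 2 * ε → ctrlCost f σ s y ≤ c) :
    dT E (t, x) + s ^ 2 / 2 * dXX E (t, x) ≤ c := by
  have hcost0 : ∀ y, 0 ≤ ctrlCost f σ s y := by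
    intro y
    have := C.f_pos y
    unfold ctrlCost; positivity
  have hc0 : 0 ≤ c := (hcost0 x).trans (hc x (by simp; positivity))
  -- quadratic majorant of the cost around the points near `x`
  set A := (|s| + s₀) ^ 2 / (2 * f₀) with hA
  have hf₀ := C.f₀_pos
  have hs₀ := C.s₀_pos
  have hcostA : ∀ y, ctrlCost f σ s y ≤ A := by
    intro y
    have h2 := C.σ_pos y
    have h3 := C.σ_le y
    unfold ctrlCost
    apply div_le_div₀ (by positivity) _ (by positivity) (by linarith [C.f_ge y])
    apply sq_le_sq'
    · linarith [neg_abs_le s]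
    · linarith [le_abs_self s]
  -- Beyond distance `ε` the quadratic term exceeds the global cost bound `A`.
  set k := A / ε ^ 2 with hk
  have hk0 : 0 ≤ k := by positivity
  have hquad : ∀ x₀, |x₀ - x| < ε → ∀ y, ctrlCost f σ s y ≤ c + k * (y - x₀) ^ 2 := by
    intro x₀ hx₀ y
    rcases le_or_gt |y - x₀| ε with h | h
    · have h1 : |y - x| ≤ 2 * ε := by linarith [abs_sub_le y x₀ x]
      have : 0 ≤ k * (y - x₀) ^ 2 := by positivity
      linarith [hc y h1]
    · have h1 : ε ^ 2 ≤ (y - x₀) ^ 2 := by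
        rw [← sq_abs (y - x₀)]; gcongr
      have h2 : A = k * ε ^ 2 := by rw [hk]; field_simp
      have h3 := mul_le_mul_of_nonneg_left h1 hk0
      linarith [hcostA y]
  refine le_of_forall_pos_le_add fun η hη => ?_
  set κ := η / (s ^ 2 / 2 + 1) with hκ
  have hκ0 : 0 < κ := by positivity
  have hκη : κ * (s ^ 2 / 2) ≤ η := by
    have : κ * (s ^ 2 / 2 + 1) = η := by rw [hκ]; field_simp
    linarith
  obtain ⟨r, hr, H⟩ := Metric.continuous_iff.1 (continuous_dXX hE) (t, x) κ hκ0
  set m := dXX E (t, x) - κ with hm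
  set B := 4 * K * (1 + (|x| + ε)) with hB
  have hB0 : 0 ≤ B := by positivity
  -- For `|y| ≥ r` all terms are absorbed by `D y⁴`, whose Gaussian mean is of order `δ²`.
  set D := |m| / r ^ 2 + B * (1 / r ^ 4 + 1 / r ^ 3) with hD
  have hEgr : ∀ t' y, t' + 2 * ε ≤ T → |E (t', y)| ≤ K * (1 + (|y| + ε)) := by
    intro t' y h
    rw [hEdef]
    exact abs_mollify_le hK hK0 hμ (p := (t', y)) h
  have hlow : ∀ δ, 0 < δ → δ < r → t + δ + 2 * ε ≤ T → ∀ y,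
      m * y ^ 2 - D * y ^ 4 ≤ E (t + δ, x + y) + E (t + δ, x - y) - 2 * E (t + δ, x) := by
    intro δ hδ hδr htδ
    have hpos : ∀ y, 0 ≤ y → m * y ^ 2 - D * y ^ 4 ≤
        E (t + δ, x + y) + E (t + δ, x - y) - 2 * E (t + δ, x) := by
      intro y hy
      rcases lt_or_ge y r with h | h
      · have h1 := le_second_diff (ψ := fun y => E (t + δ, y)) (ψ' := fun y => dX E (t + δ, y))
          (ψ'' := fun y => dXX E (t + δ, y)) (fun y => hasDerivAt_dX hE (t + δ, y))
          (fun y => hasDerivAt_dXX hE (t + δ, y)) (x := x) hy (m := m) (by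
            intro z hz
            have h5 := H (t + δ, z) (by
              rw [Prod.dist_eq, max_lt_iff]
              simp only [Real.dist_eq, add_sub_cancel_left, abs_of_pos hδ]
              refine ⟨hδr, ?_⟩
              rw [abs_lt]; constructor <;> linarith [hz.1, hz.2])
            rw [Real.dist_eq, abs_lt] at h5
            linarith)
        have : 0 ≤ D * y ^ 4 := by positivity
        linarith
      · have b1 := (abs_le.1 (hEgr (t + δ) (x + y) htδ)).1
        have b2 := (abs_le.1 (hEgr (t + δ) (x - y) htδ)).1
        have b3 := (abs_le.1 (hEgr (t + δ) x htδ)).2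
        have b4 : K * (1 + (|x + y| + ε)) + K * (1 + (|x - y| + ε)) + 2 * (K * (1 + (|x| + ε))) ≤
            B * (1 + y) := by
          have c1 : |x + y| ≤ |x| + y := by have := abs_add_le x y; rwa [abs_of_nonneg hy] at this
          have c2 : |x - y| ≤ |x| + y := by have := abs_sub x y; rwa [abs_of_nonneg hy] at this
          have c3 := mul_le_mul_of_nonneg_left c1 hK0
          have c4 := mul_le_mul_of_nonneg_left c2 hK0
          have c5 : 0 ≤ K * y * (|x| + ε) := by positivity
          have c6 : 0 ≤ K * y := by positivity
          rw [hB]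
          nlinarith
        have d1 : m * y ^ 2 ≤ |m| / r ^ 2 * y ^ 4 := by
          have : y ^ 2 ≤ y ^ 4 / r ^ 2 := by
            rw [le_div_iff₀ (by positivity)]
            have : r ^ 2 ≤ y ^ 2 := by gcongr
            nlinarith [sq_nonneg y]
          calc m * y ^ 2 ≤ |m| * y ^ 2 := mul_le_mul_of_nonneg_right (le_abs_self m) (sq_nonneg _)
            _ ≤ |m| * (y ^ 4 / r ^ 2) := mul_le_mul_of_nonneg_left this (abs_nonneg m)
            _ = _ := by ring
        have d2 : 1 ≤ 1 / r ^ 4 * y ^ 4 := by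
          rw [one_div_mul_eq_div, le_div_iff₀ (by positivity), one_mul]; gcongr
        have d3 : y ≤ 1 / r ^ 3 * y ^ 4 := by
          rw [one_div_mul_eq_div, le_div_iff₀ (by positivity)]
          have : r ^ 3 ≤ y ^ 3 := by gcongr
          calc y * r ^ 3 ≤ y * y ^ 3 := mul_le_mul_of_nonneg_left this hy
            _ = y ^ 4 := by ring
        have d4 : B * (1 + y) ≤ B * (1 / r ^ 4 + 1 / r ^ 3) * y ^ 4 := by
          calc B * (1 + y) ≤ B * (1 / r ^ 4 * y ^ 4 + 1 / r ^ 3 * y ^ 4) :=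
                mul_le_mul_of_nonneg_left (by linarith) hB0
            _ = _ := by ring
        rw [hD]
        linarith
    intro y
    rcases le_or_gt 0 y with h | h
    · exact hpos y h
    · have := hpos (-y) (by linarith)
      rw [← sub_eq_add_neg, sub_neg_eq_add] at this
      have e1 : (-y) ^ 2 = y ^ 2 := by ring
      have e2 : (-y) ^ 4 = y ^ 4 := by ring
      rw [e1, e2] at this
      linarith
  set C4 := ∫ y, y ^ 4 ∂(gaussianReal 0 1) with hC4
  have hmain : ∀ δ, 0 < δ → δ < r → t + δ + 2 * ε ≤ T →
      δ⁻¹ • (E (t + δ, x) - E (t, x)) ≤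
        c - m * (s ^ 2 / 2) + δ * (k * (s ^ 2 / 2) + D * C4 * s ^ 4 / 2) := by
    intro δ hδ hδr htδ
    set v := (s ^ 2 * δ).toNNReal with hv
    have hvv : (v : ℝ) = s ^ 2 * δ := Real.coe_toNNReal _ (by positivity)
    have h1 := integral_mollify_le (x := x) C hlsc he hem hK hK0 hμ ht0 hδ htδ hk0 hquad
    simp_rw [← hEdef] at h1
    have hEc : Continuous fun y => E (t + δ, x + y) := hE.continuous.comp (by fun_prop)
    have hEc' : Continuous fun y => E (t + δ, x - y) := hE.continuous.comp (by fun_prop)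
    have gr : ∀ z y, |z| ≤ |x| + |y| → |E (t + δ, z)| ≤ K * (1 + (|x| + ε)) * (1 + |y|) := by
      intro z y hz
      refine (hEgr _ _ htδ).trans ?_
      rw [mul_assoc]
      refine mul_le_mul_of_nonneg_left ?_ hK0
      nlinarith [abs_nonneg x, abs_nonneg y]
    have i1 : Integrable (fun y => E (t + δ, x + y)) (gaussianReal 0 v) :=
      integrable_gaussianReal_of_growth hEc.aestronglyMeasurable
        (fun y => gr _ y (abs_add_le x y))
    have i2 : Integrable (fun y => E (t + δ, x - y)) (gaussianReal 0 v) :=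
      integrable_gaussianReal_of_growth hEc'.aestronglyMeasurable
        (fun y => gr _ y (abs_sub x y))
    -- Symmetry of the Gaussian allows symmetric second differences, so no first derivative appears.
    have hsym : ∫ y, E (t + δ, x - y) ∂(gaussianReal 0 v) =
        ∫ y, E (t + δ, x + y) ∂(gaussianReal 0 v) := by
      have h := gaussianReal_map_neg (μ := 0) (v := v)
      rw [neg_zero] at h
      conv_rhs => rw [← h]
      rw [integral_map (by fun_prop) hEc.aestronglyMeasurable]
      simp only [sub_eq_add_neg]
    have i12 : Integrable (fun y => E (t + δ, x + y) + E (t + δ, x - y)) (gaussianReal 0 v) :=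
      i1.add i2
    have q2 := integrable_pow_gaussianReal v 2
    have q4 := integrable_pow_gaussianReal v 4
    have h2 : ∫ y, (m * y ^ 2 - D * y ^ 4) ∂(gaussianReal 0 v) ≤
        ∫ y, (E (t + δ, x + y) + E (t + δ, x - y) - 2 * E (t + δ, x)) ∂(gaussianReal 0 v) :=
      integral_mono ((q2.const_mul m).sub (q4.const_mul D)) (i12.sub (integrable_const _))
        (hlow δ hδ hδr htδ)
    rw [integral_sub (q2.const_mul m) (q4.const_mul D), integral_sub i12 (integrable_const _),
      integral_add i1 i2, hsym, integral_const_mul, integral_const_mul, integral_sq_gaussianReal,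
      integral_pow_four_gaussianReal, hvv, ← hC4] at h2
    simp only [integral_const, probReal_univ, smul_eq_mul, one_mul] at h2
    rw [smul_eq_mul, inv_mul_le_iff₀ hδ]
    linarith
  have hlim1 := (hasDerivAt_iff_tendsto_slope_zero.1 (hasDerivAt_dT hE (t, x))).mono_left
    (nhdsWithin_mono (0 : ℝ) (show Ioi (0 : ℝ) ⊆ {0}ᶜ from fun r hr => (mem_Ioi.1 hr).ne'))
  have hlim2 : Tendsto (fun δ : ℝ => c - m * (s ^ 2 / 2) +
      δ * (k * (s ^ 2 / 2) + D * C4 * s ^ 4 / 2)) (𝓝[>] 0) (𝓝 (c - m * (s ^ 2 / 2))) := by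
    have : Continuous fun δ : ℝ => c - m * (s ^ 2 / 2) +
      δ * (k * (s ^ 2 / 2) + D * C4 * s ^ 4 / 2) := by fun_prop
    have := this.tendsto 0
    simp only [zero_mul, add_zero] at this
    exact this.mono_left nhdsWithin_le_nhds
  have hle := le_of_tendsto_of_tendsto hlim1 hlim2 (by
    have e1 : ∀ᶠ δ in 𝓝[>] (0 : ℝ), δ < r := nhdsWithin_le_nhds (Iio_mem_nhds hr)
    have e2 : ∀ᶠ δ in 𝓝[>] (0 : ℝ), δ < T - t - 2 * ε :=
      nhdsWithin_le_nhds (Iio_mem_nhds (by linarith))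
    filter_upwards [e1, e2, self_mem_nhdsWithin] with δ h1 h2 h3
    exact hmain δ h3 h1 (by linarith))
  rw [hm] at hle
  linarith

/-- Lower semicontinuity gives no upper bound. It comes from `time_monotone_of_super`, which
controls later values by present ones, and from continuity of the slice at time `p.1`. -/
theorem mollify_le (C : CoeffBounds f σ γ f₀ s₀ ι)
    (hlsc : LowerSemicontinuousOn e (Icc 0 T ×ˢ univ))
    (he : IsInteriorSuper f σ γ T e) (hem : Measurable e)
    (hK : ∀ t ≤ T, ∀ x, |e (t, x)| ≤ K * (1 + |x|)) (hK0 : 0 ≤ K) {p : ℝ × ℝ} (hp0 : 0 ≤ p.1)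
    (hp : p.1 < T) {η : ℝ} (hη : 0 < η) :
    ∃ ε₀ > 0, ∀ ε, 0 < ε → ε < ε₀ → ∀ μ : Measure (ℝ × ℝ), IsProbabilityMeasure μ →
      (∀ᵐ q ∂μ, 0 < q.1 ∧ q.1 < 2 * ε ∧ |q.2| < ε) → ∫ q, e (p + q) ∂μ ≤ e p + η := by
  have hcont := continuous_slice_of_super C hlsc he hp0 hp
  obtain ⟨r, hr, H⟩ := Metric.continuous_iff.1 hcont p.2 (η / 2) (by positivity)
  set A := s₀ ^ 2 / (2 * f₀) with hA
  have hA0 : 0 ≤ A := by have := C.f₀_pos; positivity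
  have hTp : 0 < T - p.1 := by linarith
  refine ⟨min r (min ((T - p.1) / 4) (η / (4 * (A + 1)))), by positivity, ?_⟩
  intro ε hε hε₀ μ hμ1 hμ
  simp only [lt_min_iff] at hε₀
  obtain ⟨h1, h2, h3⟩ := hε₀
  rw [lt_div_iff₀ (by positivity)] at h3
  have hint := integrable_shift hem hK hK0 hμ (p := p) (by linarith)
  have : ∫ q, e (p + q) ∂μ ≤ ∫ _, (e p + η) ∂μ := by
    refine integral_mono_ae hint (integrable_const _) ?_
    filter_upwards [hμ] with q hq
    have e1 := time_monotone_of_super C hlsc he (K := K) (fun t ht x => hK t ht.2 x)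
      (x := p.2 + q.2) (t₀ := p.1) (t₁ := p.1 + q.1) hp0 (by linarith) (by linarith)
    have e2 := H (p.2 + q.2) (by rw [Real.dist_eq, add_sub_cancel_left]; linarith)
    rw [Real.dist_eq, abs_lt] at e2
    rw [add_sub_cancel_left, ← hA] at e1
    have e3 : A * q.1 ≤ A * (2 * ε) := mul_le_mul_of_nonneg_left hq.2.1.le hA0
    change e (p.1 + q.1, p.2 + q.2) ≤ e p + η
    have e4 : e p = e (p.1, p.2) := rfl
    linarith
  simpa using this

end

end
end GammaHedging

/-! ### Smooth strict supersolutions close to a given supersolution. -/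

namespace GammaHedging
noncomputable section

open Filter Topology MeasureTheory ProbabilityTheory

theorem exists_uniform_modulus {g : ℝ × ℝ → ℝ} (hg : Continuous g) (S R : ℝ) {κ : ℝ}
    (hκ : 0 < κ) : ∃ ε > 0, ∀ s ∈ Icc 0 S, ∀ x y, |x| ≤ R → |y - x| ≤ ε →
      |g (s, y) - g (s, x)| < κ := by
  have hc : IsCompact (Icc 0 S ×ˢ Icc (-(R + 1)) (R + 1)) := isCompact_Icc.prod isCompact_Icc
  obtain ⟨δ, hδ, H⟩ := Metric.uniformContinuousOn_iff.1
    (hc.uniformContinuousOn_of_continuous hg.continuousOn) κ hκ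
  refine ⟨min 1 (δ / 2), by positivity, fun s hs x y hx hy => ?_⟩
  have h1 : |y - x| ≤ 1 := hy.trans (min_le_left _ _)
  have h2 : |y - x| ≤ δ / 2 := hy.trans (min_le_right _ _)
  have h3 := abs_le.1 h1
  have h4 := abs_le.1 hx
  have := H (s, y) ⟨hs, by simp only; linarith, by simp only; linarith⟩ (s, x)
    ⟨hs, by simp only; linarith, by simp only; linarith⟩ (by
      rw [Prod.dist_eq, max_lt_iff]
      simp only [dist_self, Real.dist_eq]
      exact ⟨hδ, by linarith⟩)
  rwa [Real.dist_eq] at this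

/-- Strict supersolution with quadratic growth. -/
def quadBarrier (T β K₀ Q : ℝ) (p : ℝ × ℝ) : ℝ := β / 2 * p.2 ^ 2 + K₀ + (Q + 1) * (T - p.1)

theorem contDiff_quadBarrier (T β K₀ Q : ℝ) : ContDiff ℝ 2 (quadBarrier T β K₀ Q) := by
  unfold quadBarrier; fun_prop

theorem dT_quadBarrier (T β K₀ Q : ℝ) (p : ℝ × ℝ) : dT (quadBarrier T β K₀ Q) p = -(Q + 1) := by
  have := (((hasDerivAt_id p.1).const_sub T).const_mul (Q + 1)).const_add (β / 2 * p.2 ^ 2 + K₀)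
  exact (this.congr_deriv (by ring)).deriv

theorem dXX_quadBarrier (T β K₀ Q : ℝ) (p : ℝ × ℝ) : dXX (quadBarrier T β K₀ Q) p = β := by
  have h1 : ∀ y, dX (quadBarrier T β K₀ Q) (p.1, y) = β * y := by
    intro y
    have := ((((hasDerivAt_id y).pow 2).const_mul (β / 2)).add_const K₀).add_const
      ((Q + 1) * (T - p.1))
    refine (HasDerivAt.deriv (this.congr_deriv ?_))
    simp; ring
  have h2 := hasDerivAt_dXX (contDiff_quadBarrier T β K₀ Q) p
  simp_rw [h1] at h2
  refine h2.unique ?_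
  simpa using (hasDerivAt_id p.2).const_mul β

section

variable {f σ γ Γ : ℝ → ℝ} {f₀ s₀ ι T : ℝ} {w : ℝ × ℝ → ℝ}

/-- A viscosity supersolution is approximated, at a given point, by smooth strict supersolutions
that lie above the terminal data and grow faster than a given linear function. -/
theorem exists_barrier (C : CoeffBounds f σ γ f₀ s₀ ι) (hT : 0 < T)
    (hlsc : LowerSemicontinuousOn w (Icc 0 T ×ˢ univ)) (hsup : IsInteriorSuper f σ γ T w)
    {K : ℝ} (hK : ∀ t ∈ Icc 0 T, ∀ x, |w (t, x)| ≤ K * (1 + |x|))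
    (hΓ : ContDiff ℝ 2 Γ) (hΓγ : ∀ x, iteratedDeriv 2 Γ x = γ x)
    (hG : ∀ x h, w (T, x + h) + w (T, x - h) - 2 * w (T, x) ≤ Γ (x + h) + Γ (x - h) - 2 * Γ x)
    (hunif : UniformContinuous fun x => w (T, x)) {p : ℝ × ℝ} (hp : p.1 ∈ Icc 0 T) {η : ℝ}
    (hη : 0 < η) (K' : ℝ) :
    ∃ (W : ℝ × ℝ → ℝ) (R : ℝ), ContDiff ℝ 2 W ∧ |p.2| < R - 1 ∧ W p < w p + η ∧
      (∀ t ∈ Icc 0 T, ∀ x, |x| ≤ R → 0 < pricingOp f σ γ x (dT W (t, x)) (dXX W (t, x))) ∧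
      (∀ x, |x| ≤ R → w (T, x) ≤ W (T, x)) ∧
      ∀ t ∈ Icc 0 T, ∀ x, R - 1 ≤ |x| → |x| ≤ R → K' * (1 + |x|) ≤ W (t, x) := by
  have hι := C.ι_pos
  have hf₀ := C.f₀_pos
  have hK0 : 0 ≤ K := by simpa using (abs_nonneg _).trans (hK 0 ⟨le_rfl, hT.le⟩ 0)
  set S := s₀ / (ι * f₀) with hS
  set Q := S ^ 2 / (2 * f₀) with hQ
  have hQ0 : 0 ≤ Q := by positivity
  set e := timeExt T Q w with he
  have helsc : LowerSemicontinuous e := lowerSemicontinuous_timeExt hT.le hlsc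
  have hem : Measurable e := helsc.measurable
  have hesup : IsInteriorSuper f σ γ (T + 1) e :=
    isInteriorSuper_timeExt C hT.le hsup le_rfl hΓ hΓγ hG
  set Ke := K + Q with hKe
  have hKe0 : 0 ≤ Ke := by positivity
  have hegr : ∀ t ≤ T + 1, ∀ x, |e (t, x)| ≤ Ke * (1 + |x|) :=
    fun t ht x => abs_timeExt_le hT.le hQ0 hK ht x
  have heloc : LocallyIntegrable e volume := by
    intro z
    have hb : ∀ q ∈ Metric.ball z 1, ‖e q‖ ≤ K * (1 + (|z.2| + 1)) + Q * (|z.1| + 1) := by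
      intro q hq
      rw [Metric.mem_ball, Prod.dist_eq, max_lt_iff] at hq
      simp only [Real.dist_eq] at hq
      have h1 := hK (max 0 (min T q.1)) ⟨le_max_left _ _, max_le hT.le (min_le_left _ _)⟩ q.2
      have h2 : |q.2| ≤ |z.2| + 1 := by linarith [abs_sub_abs_le_abs_sub q.2 z.2]
      have h3 : |q.1| ≤ |z.1| + 1 := by linarith [abs_sub_abs_le_abs_sub q.1 z.1]
      have h4 : |Q * max 0 (q.1 - T)| ≤ Q * (|z.1| + 1) := by
        rw [abs_of_nonneg (by positivity)]
        refine mul_le_mul_of_nonneg_left (max_le (by positivity) ?_) hQ0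
        linarith [le_abs_self q.1]
      have h5 : K * (1 + |q.2|) ≤ K * (1 + (|z.2| + 1)) :=
        mul_le_mul_of_nonneg_left (by linarith) hK0
      calc ‖e q‖ ≤ |w (max 0 (min T q.1), q.2)| + |Q * max 0 (q.1 - T)| := abs_sub _ _
        _ ≤ _ := by linarith
    refine ⟨Metric.ball z 1, Metric.ball_mem_nhds z one_pos, ?_⟩
    refine Measure.integrableOn_of_bounded (M := K * (1 + (|z.2| + 1)) + Q * (|z.1| + 1))
      measure_ball_lt_top.ne hem.aestronglyMeasurable ?_
    filter_upwards [ae_restrict_mem measurableSet_ball] with q hq using hb q hq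
  -- the quadratic barrier and the weights
  set β := ι / 2 with hβ
  have hβ0 : 0 < β := by positivity
  -- Chosen, by completing the square, so that `B` exceeds the growth bound of `w` by at least one.
  set K₀ := K + 1 + K ^ 2 / (2 * β) with hK₀
  set B := quadBarrier T β K₀ Q with hB
  have hBlow : ∀ t ≤ T, ∀ x, K * (1 + |x|) + 1 ≤ B (t, x) := by
    intro t ht x
    have h1 : β / 2 * x ^ 2 - K * |x| + K ^ 2 / (2 * β) = β / 2 * (|x| - K / β) ^ 2 := by
      rw [← sq_abs x]; field_simp; ring
    have h2 : 0 ≤ β / 2 * (|x| - K / β) ^ 2 := by positivity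
    have h3 : 0 ≤ (Q + 1) * (T - t) := mul_nonneg (by positivity) (by linarith)
    simp only [hB, quadBarrier, hK₀]
    linarith
  have hBquad : ∀ t ≤ T, ∀ x, β / 2 * x ^ 2 ≤ B (t, x) := by
    intro t ht x
    have h3 : 0 ≤ (Q + 1) * (T - t) := mul_nonneg (by positivity) (by linarith)
    have h4 : 0 ≤ K₀ := by positivity
    simp only [hB, quadBarrier]
    linarith
  -- The weight of the barrier, small enough to move the value at `p` by no more than a fraction of
  -- `η`.
  set l := min (1 / 2) (η / (4 * (|w p| + |B p| + 1))) with hl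
  have hl0 : 0 < l := by positivity
  have hl1 : l ≤ 1 / 2 := min_le_left _ _
  have hlη : l * (|w p| + |B p| + 1) ≤ η / 4 := by
    have : l ≤ η / (4 * (|w p| + |B p| + 1)) := min_le_right _ _
    rw [le_div_iff₀ (by positivity)] at this
    linarith
  -- Near `|x| = R` the term `l β x² / 2` beats the linear growth of the mollification together with
  -- the prescribed slope `K'`.
  set R := 2 + |p.2| + (3 * Ke + 2 * |K'|) * 2 / (l * β) with hR
  have hRp : 0 ≤ (3 * Ke + 2 * |K'|) * 2 / (l * β) := by positivity
  -- the mollification scale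
  obtain ⟨ε₁, hε₁, H₁⟩ := mollify_le C (helsc.lowerSemicontinuousOn _) hesup hem hegr hKe0 hp.1
    (show p.1 < T + 1 by linarith [hp.2]) (show 0 < η / 2 by positivity)
  obtain ⟨ε₂, hε₂, H₂⟩ := exists_uniform_modulus (g := fun z => γ z.2)
    (C.γ_cont.comp continuous_snd) 0 R (show 0 < l * ι / 8 by positivity)
  obtain ⟨ε₃, hε₃, H₃⟩ := exists_uniform_modulus C.continuous_ctrlCost S R
    (show 0 < l / 2 by positivity)
  obtain ⟨ε₄, hε₄, H₄⟩ := Metric.uniformContinuous_iff.1 hunif (l / 2) (by positivity)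
  set ε := min (1 / 4) (min (ε₁ / 2) (min (ε₂ / 2) (min (ε₃ / 2) (min (ε₄ / 2)
    (l / (4 * (Q + 1))))))) with hε
  have hε0 : 0 < ε := by positivity
  obtain ⟨b1, b2, b3, b4, b5, b6⟩ : ε ≤ 1 / 4 ∧ ε ≤ ε₁ / 2 ∧ ε ≤ ε₂ / 2 ∧ ε ≤ ε₃ / 2 ∧
      ε ≤ ε₄ / 2 ∧ ε ≤ l / (4 * (Q + 1)) := by
    have := le_refl ε
    simpa only [hε, le_min_iff] using this
  obtain ⟨μ, hμ1, hμ, hμE⟩ := exists_mollifier hε0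
  set E : ℝ × ℝ → ℝ := fun p => ∫ q, e (p + q) ∂μ with hE
  have hEs : ContDiff ℝ 2 E := hμE e heloc hem
  have hBs : ContDiff ℝ 2 B := contDiff_quadBarrier _ _ _ _
  -- Admissible jets form a convex set. The mollification satisfies the inequalities up to `l ι / 8`
  -- and `l / 2`; the margins of `B`, at least `ι / 2` in curvature and `1` in the other inequality,
  -- weighted by `l`, more than compensate.
  set W : ℝ × ℝ → ℝ := fun z => (1 - l) * E z + l * B z with hW
  have hWs : ContDiff ℝ 2 W := (contDiff_const.mul hEs).add (contDiff_const.mul hBs)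
  have hWT : ∀ z, dT W z = (1 - l) * dT E z + l * -(Q + 1) := by
    intro z
    rw [hW, dT_add (contDiff_const.mul hEs) (contDiff_const.mul hBs), dT_const_mul hEs,
      dT_const_mul hBs, dT_quadBarrier]
  have hWX : ∀ z, dXX W z = (1 - l) * dXX E z + l * β := by
    intro z
    rw [hW, dXX_add (contDiff_const.mul hEs) (contDiff_const.mul hBs), dXX_const_mul hEs,
      dXX_const_mul hBs, dXX_quadBarrier]
  refine ⟨W, R, hWs, by linarith, ?_, ?_, ?_, ?_⟩
  · have h1 := H₁ ε hε0 (by linarith) μ hμ1 hμ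
    have h2 : e p = w p := timeExt_of_le hp.1 hp.2
    rw [h2] at h1
    change E p ≤ _ at h1
    have h3 : (1 - l) * E p ≤ (1 - l) * (w p + η / 2) :=
      mul_le_mul_of_nonneg_left h1 (by linarith)
    have h4 : l * B p ≤ l * |B p| := mul_le_mul_of_nonneg_left (le_abs_self _) hl0.le
    have h5 : l * (-w p) ≤ l * |w p| := mul_le_mul_of_nonneg_left (neg_le_abs _) hl0.le
    have h6 : 0 < l * (η / 2) := by positivity
    simp only [hW]
    linarith
  · intro t ht x hx
    have htT : t + 2 * ε < T + 1 := by linarith [ht.2]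
    have hM := dXX_mollify_le (helsc.lowerSemicontinuousOn _) hesup hem hegr hKe0 hε0 hμ hEs
      (p := (t, x)) ht.1 htT.le (m := γ x + l * ι / 8) (by
        intro y hy
        have := H₂ 0 ⟨le_rfl, le_rfl⟩ x y hx (by simp only at hy; linarith)
        rw [abs_lt] at this
        linarith)
    change dXX E (t, x) ≤ _ at hM
    have hq : ∀ s ∈ Icc 0 S, dT E (t, x) + s ^ 2 / 2 * dXX E (t, x) ≤ ctrlCost f σ s x + l / 2 := by
      intro s hs
      refine jet_mollify_le C (helsc.lowerSemicontinuousOn _) hesup hem hegr hKe0 hε0 hμ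
        (fun p => rfl) hEs ht.1 htT fun y hy => ?_
      have := H₃ s hs x y hx (by linarith)
      rw [abs_lt] at this
      linarith
    have hγι := C.γ_ge x
    have hβγ : β ≤ γ x := by linarith
    refine C.pos_of_lt (κ := min (l * ι / 8) (l / 2)) (by positivity) ?_ fun s hs => ?_
    · rw [hWX]
      have h1 : (1 - l) * dXX E (t, x) ≤ (1 - l) * (γ x + l * ι / 8) :=
        mul_le_mul_of_nonneg_left hM (by linarith)
      have h2 := min_le_left (l * ι / 8) (l / 2)
      have h3 : l * ι ≤ l * γ x := mul_le_mul_of_nonneg_left hγι hl0.le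
      have h4 : 0 ≤ l * (l * ι / 8) := by positivity
      have h5 : 0 < l * ι := by positivity
      rw [hβ]
      linarith
    · rw [hWT, hWX]
      have h1 := hq s hs
      have h2 := C.dual_le hβγ s
      have h3 := C.nonlin_le hβγ
      have h4 := min_le_right (l * ι / 8) (l / 2)
      have h5 : (1 - l) * (dT E (t, x) + s ^ 2 / 2 * dXX E (t, x)) ≤
          (1 - l) * (ctrlCost f σ s x + l / 2) := mul_le_mul_of_nonneg_left h1 (by linarith)
      have h6 : l * (-(Q + 1) + s ^ 2 / 2 * β) ≤ l * (ctrlCost f σ s x - 1) :=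
        mul_le_mul_of_nonneg_left (by linarith) hl0.le
      have h7 : 0 ≤ l * l := by positivity
      linarith
  · intro x hx
    -- Half of the loss is the modulus of continuity in space, half the decay of the extension past
    -- `T`; the excess of `B` over `w` restores `l`.
    have h1 : w (T, x) - l ≤ E (T, x) := by
      have hint := integrable_shift hem hegr hKe0 hμ (p := (T, x)) (by simp only; linarith)
      have : ∫ _, (w (T, x) - l) ∂μ ≤ ∫ q, e ((T, x) + q) ∂μ := by
        refine integral_mono_ae (integrable_const _) hint ?_
        filter_upwards [hμ] with q hq
        have e1 : e ((T, x) + q) = w (T, x + q.2) - Q * q.1 := by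
          rw [he, timeExt_of_ge hT.le (by simp; linarith)]
          simp
        have e2 := H₄ (a := x + q.2) (b := x) (by
          rw [Real.dist_eq, add_sub_cancel_left]; linarith)
        rw [Real.dist_eq, abs_lt] at e2
        have e3 : Q * q.1 ≤ l / 2 := by
          rw [le_div_iff₀ (by positivity)] at b6
          have : Q * q.1 ≤ (Q + 1) * (2 * ε) :=
            mul_le_mul (by linarith) hq.2.1.le hq.1.le (by positivity)
          linarith
        simp only [e1]
        linarith
      simpa using this
    have h2 : (1 - l) * (w (T, x) - l) ≤ (1 - l) * E (T, x) :=
      mul_le_mul_of_nonneg_left h1 (by linarith)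
    have h3 := hBlow T le_rfl x
    have h4 := (abs_le.1 (hK T ⟨hT.le, le_rfl⟩ x)).2
    have h5 : l * (w (T, x) + 1) ≤ l * B (T, x) :=
      mul_le_mul_of_nonneg_left (by linarith) hl0.le
    have h7 : 0 ≤ l * l := by positivity
    simp only [hW]
    linarith
  · intro t ht x hx1 hx2
    have h1 := (abs_le.1 (abs_mollify_le hegr hKe0 hμ (p := (t, x))
      (by simp only; linarith [ht.2]))).1
    change _ ≤ E (t, x) at h1
    simp only at h1
    have hx0 : 1 + (3 * Ke + 2 * |K'|) * 2 / (l * β) ≤ |x| := by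
      linarith [abs_nonneg p.2]
    have h2 : (3 * Ke + 2 * |K'|) * 2 ≤ |x| * (l * β) := by
      rw [← div_le_iff₀ (by positivity)]; linarith
    have hx3 : 1 ≤ |x| := by linarith
    have h3 : (3 * Ke + 2 * |K'|) * |x| ≤ l * (β / 2 * x ^ 2) := by
      rw [← sq_abs x]
      have := mul_le_mul_of_nonneg_right h2 (abs_nonneg x)
      linarith
    have h4 : l * (β / 2 * x ^ 2) ≤ l * B (t, x) :=
      mul_le_mul_of_nonneg_left (hBquad t ht.2 x) hl0.le
    have h5 : Ke * (1 + (|x| + ε)) ≤ Ke * (3 * |x|) :=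
      mul_le_mul_of_nonneg_left (by linarith) hKe0
    have h6 : -(Ke * (3 * |x|)) ≤ (1 - l) * E (t, x) := by
      have e1 : (1 - l) * -(Ke * (3 * |x|)) ≤ (1 - l) * E (t, x) :=
        mul_le_mul_of_nonneg_left (by linarith) (by linarith)
      have e2 : 0 ≤ l * (Ke * (3 * |x|)) := by positivity
      linarith
    have h7 : K' * (1 + |x|) ≤ 2 * |K'| * |x| := by
      calc K' * (1 + |x|) ≤ |K'| * (1 + |x|) :=
            mul_le_mul_of_nonneg_right (le_abs_self _) (by positivity)
        _ ≤ |K'| * (2 * |x|) := mul_le_mul_of_nonneg_left (by linarith) (abs_nonneg _)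
        _ = _ := by ring
    simp only [hW]
    linarith

end

end
end GammaHedging

/-! ### Concave envelopes, the face-lift and a priori bounds. -/

namespace GammaHedging
noncomputable section

section envelope

variable {u w : ℝ → ℝ}

/-- The majorant `w` ensures that the infimum is not over the empty set, where `sInf` would be `0`.
-/
theorem le_concEnv (hw : ConcaveOn ℝ univ w) (h : ∀ z, u z ≤ w z) (x : ℝ) : u x ≤ concEnv u x := by
  refine le_csInf ⟨_, w, hw, h, rfl⟩ ?_
  rintro _ ⟨w', _, h', rfl⟩
  exact h' x

theorem concEnv_le (hw : ConcaveOn ℝ univ w) (h : ∀ z, u z ≤ w z) (x : ℝ) : concEnv u x ≤ w x := by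
  refine csInf_le ⟨u x, ?_⟩ ⟨w, hw, h, rfl⟩
  rintro _ ⟨w', _, h', rfl⟩
  exact h' x

theorem concaveOn_concEnv (hw : ConcaveOn ℝ univ w) (h : ∀ z, u z ≤ w z) :
    ConcaveOn ℝ univ (concEnv u) := by
  refine ⟨convex_univ, fun x _ y _ a b ha hb hab => le_csInf ⟨_, w, hw, h, rfl⟩ ?_⟩
  rintro _ ⟨w', hw', h', rfl⟩
  refine le_trans ?_ (hw'.2 (mem_univ x) (mem_univ y) ha hb hab)
  simp only [smul_eq_mul]
  exact add_le_add (mul_le_mul_of_nonneg_left (concEnv_le hw' h' x) ha)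
    (mul_le_mul_of_nonneg_left (concEnv_le hw' h' y) hb)

theorem second_diff_nonpos_of_concaveOn (hw : ConcaveOn ℝ univ w) (x h : ℝ) :
    w (x + h) + w (x - h) - 2 * w x ≤ 0 := by
  have := hw.2 (mem_univ (x + h)) (mem_univ (x - h)) (show (0 : ℝ) ≤ 1 / 2 by norm_num)
    (show (0 : ℝ) ≤ 1 / 2 by norm_num) (by norm_num)
  simp only [smul_eq_mul] at this
  rw [show 1 / 2 * (x + h) + 1 / 2 * (x - h) = x by ring] at this
  linarith

theorem concaveOn_affine (a b : ℝ) : ConcaveOn ℝ univ fun z : ℝ => a + b * z := by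
  refine ⟨convex_univ, fun x _ y _ s t _ _ hst => le_of_eq ?_⟩
  simp only [smul_eq_mul]
  linear_combination a * hst

end envelope

section facelift

variable {f σ γ Γ g : ℝ → ℝ} {ι : ℝ}

/-- `Γ` minus the non-constant part of the quadratic is convex with zero slope at the origin, hence
minimal there. -/
theorem quadratic_le_of_second_deriv (hΓ : ContDiff ℝ 2 Γ) (h : ∀ x, ι ≤ iteratedDeriv 2 Γ x)
    (x : ℝ) : Γ 0 + deriv Γ 0 * x + ι / 2 * x ^ 2 ≤ Γ x := by
  have h1 : ∀ y, HasDerivAt Γ (deriv Γ y) y := fun y =>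
    (hΓ.differentiable (by norm_num) y).hasDerivAt
  have h2 : ∀ y, HasDerivAt (deriv Γ) (iteratedDeriv 2 Γ y) y := by
    intro y
    rw [iteratedDeriv_succ, iteratedDeriv_one]
    exact ((hΓ.differentiable_deriv_two) y).hasDerivAt
  have d1 : ∀ y, HasDerivAt (fun z => Γ z - (deriv Γ 0 * z + ι / 2 * z ^ 2))
      (deriv Γ y - (deriv Γ 0 + ι * y)) y := by
    intro y
    refine ((h1 y).sub (((hasDerivAt_id y).const_mul _).add
      (((hasDerivAt_id y).pow 2).const_mul (ι / 2)))).congr_deriv ?_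
    simp; ring
  have d2 : ∀ y, HasDerivAt (fun z => deriv Γ z - (deriv Γ 0 + ι * z))
      (iteratedDeriv 2 Γ y - ι) y := by
    intro y
    refine ((h2 y).sub (((hasDerivAt_id y).const_mul ι).const_add _)).congr_deriv ?_
    simp
  have e1 : deriv (fun z => Γ z - (deriv Γ 0 * z + ι / 2 * z ^ 2)) =
      fun y => deriv Γ y - (deriv Γ 0 + ι * y) := funext fun y => (d1 y).deriv
  have hconv : ConvexOn ℝ univ fun z => Γ z - (deriv Γ 0 * z + ι / 2 * z ^ 2) := by
    refine convexOn_univ_of_deriv2_nonneg (fun y => (d1 y).differentiableAt) ?_ ?_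
    · rw [e1]; exact fun y => (d2 y).differentiableAt
    · intro y
      simp only [Function.iterate_succ, Function.iterate_zero, Function.comp, id]
      rw [e1, (d2 y).deriv]
      linarith [h y]
  have d0 := d1 0
  rw [show deriv Γ 0 - (deriv Γ 0 + ι * 0) = 0 by ring] at d0
  rcases lt_trichotomy x 0 with hx | rfl | hx
  · have := hconv.slope_le_of_hasDerivAt (mem_univ x) (mem_univ 0) hx d0
    rw [slope_def_field, div_nonpos_iff] at this
    rcases this with h | h
    · linarith [h.2]
    · have := h.1; simp at this; linarith
  · simp
  · have := hconv.le_slope_of_hasDerivAt (mem_univ 0) (mem_univ x) hx d0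
    rw [slope_def_field, div_nonneg_iff] at this
    rcases this with h | h
    · have := h.1; simp at this; linarith
    · linarith [h.2]

/-- `g - Γ` has a concave majorant. -/
theorem exists_concave_majorant (hι : 0 < ι) (hΓ : ContDiff ℝ 2 Γ)
    (h : ∀ x, ι ≤ iteratedDeriv 2 Γ x) {K : ℝ} (hg : ∀ x, g x ≤ K * (1 + |x|)) :
    ∃ w : ℝ → ℝ, ConcaveOn ℝ univ w ∧ ∀ z, g z - Γ z ≤ w z := by
  set a := K + |deriv Γ 0|
  -- A constant suffices: `a |z| - ι z² / 2` is at most `a² / (2ι)`.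
  refine ⟨fun _ => K - Γ 0 + a ^ 2 / (2 * ι), concaveOn_const _ convex_univ, fun z => ?_⟩
  have h1 := quadratic_le_of_second_deriv hΓ h z
  have h2 : ι / 2 * z ^ 2 - a * |z| + a ^ 2 / (2 * ι) = ι / 2 * (|z| - a / ι) ^ 2 := by
    rw [← sq_abs z]; field_simp; ring
  have h3 : 0 ≤ ι / 2 * (|z| - a / ι) ^ 2 := by positivity
  have h4 : -(|deriv Γ 0| * |z|) ≤ deriv Γ 0 * z := by
    rw [← abs_mul]; exact neg_abs_le _
  have h5 : a * |z| = K * |z| + |deriv Γ 0| * |z| := by ring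
  linarith [hg z]

theorem le_faceLift (hι : 0 < ι) (hΓ : ContDiff ℝ 2 Γ)
    (h : ∀ x, ι ≤ iteratedDeriv 2 Γ x) {K : ℝ} (hg : ∀ x, g x ≤ K * (1 + |x|)) (x : ℝ) :
    g x ≤ faceLift Γ g x := by
  obtain ⟨w, hw, hw'⟩ := exists_concave_majorant hι hΓ h hg
  have := le_concEnv hw hw' x
  unfold faceLift
  linarith

/-- The effect of the face-lift used in the limit: the terminal data satisfy the gamma constraint in
difference form, because a concave envelope has nonpositive second differences. -/
theorem second_diff_faceLift_le (hι : 0 < ι) (hΓ : ContDiff ℝ 2 Γ)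
    (h : ∀ x, ι ≤ iteratedDeriv 2 Γ x) {K : ℝ} (hg : ∀ x, g x ≤ K * (1 + |x|)) (x k : ℝ) :
    faceLift Γ g (x + k) + faceLift Γ g (x - k) - 2 * faceLift Γ g x ≤
      Γ (x + k) + Γ (x - k) - 2 * Γ x := by
  obtain ⟨w, hw, hw'⟩ := exists_concave_majorant hι hΓ h hg
  have := second_diff_nonpos_of_concaveOn (concaveOn_concEnv hw hw') x k
  unfold faceLift
  linarith

/-- The part of the upper bound `upperBd` that depends on `x`. -/
def growthBd (c₀ c₁ η x : ℝ) : ℝ :=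
  concEnv (fun z => 1 + 2 * c₀ + c₁ * |z| - η * z ^ 2 / 2) x + η * x ^ 2 / 2

theorem growthBd_const_majorant {c₀ c₁ η : ℝ} (hη : 0 < η) (z : ℝ) :
    1 + 2 * c₀ + c₁ * |z| - η * z ^ 2 / 2 ≤ 1 + 2 * c₀ + c₁ ^ 2 / (2 * η) := by
  have h2 : η / 2 * z ^ 2 - c₁ * |z| + c₁ ^ 2 / (2 * η) = η / 2 * (|z| - c₁ / η) ^ 2 := by
    rw [← sq_abs z]; field_simp; ring
  have h3 : 0 ≤ η / 2 * (|z| - c₁ / η) ^ 2 := by positivity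
  linarith

theorem le_growthBd {c₀ c₁ η : ℝ} (hη : 0 < η) (x : ℝ) :
    1 + 2 * c₀ + c₁ * |x| ≤ growthBd c₀ c₁ η x := by
  have := le_concEnv (concaveOn_const _ convex_univ) (growthBd_const_majorant (c₀ := c₀) (c₁ := c₁) hη) x
  unfold growthBd
  linarith

theorem second_diff_growthBd_le {c₀ c₁ η : ℝ} (hη : 0 < η) (x h : ℝ) :
    growthBd c₀ c₁ η (x + h) + growthBd c₀ c₁ η (x - h) - 2 * growthBd c₀ c₁ η x ≤ η * h ^ 2 := by
  have := second_diff_nonpos_of_concaveOn (concaveOn_concEnv (concaveOn_const _ convex_univ)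
    (growthBd_const_majorant (c₀ := c₀) (c₁ := c₁) hη)) x h
  unfold growthBd
  linarith

/-- For `η |x| ≤ c₁` the constant majorant suffices. For `η |x| ≥ c₁` the tangent at `x` is a global
majorant, so the envelope touches the function there. -/
theorem growthBd_le {c₀ c₁ η : ℝ} (hη : 0 < η) (hc₁ : 0 ≤ c₁) (x : ℝ) :
    growthBd c₀ c₁ η x ≤ 1 + 2 * c₀ + c₁ ^ 2 / η + c₁ * |x| := by
  unfold growthBd
  rcases le_total (η * |x|) c₁ with h | h
  · have h1 := concEnv_le (concaveOn_const _ convex_univ)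
      (growthBd_const_majorant (c₀ := c₀) (c₁ := c₁) hη) x
    have h2 : (η * |x|) ^ 2 ≤ c₁ ^ 2 := pow_le_pow_left₀ (by positivity) h 2
    rw [mul_pow, sq_abs] at h2
    have h3 : η * x ^ 2 ≤ c₁ ^ 2 / η := by rw [le_div_iff₀ hη]; linarith
    have h4 : c₁ ^ 2 / (2 * η) = c₁ ^ 2 / η / 2 := by field_simp
    have h5 : 0 ≤ c₁ * |x| := by positivity
    linarith
  · obtain ⟨s, hs, hsx⟩ : ∃ s : ℝ, |s| = 1 ∧ s * x = |x| := by
      rcases le_total 0 x with h | h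
      · exact ⟨1, by simp, by rw [abs_of_nonneg h, one_mul]⟩
      · exact ⟨-1, by simp, by rw [abs_of_nonpos h]; ring⟩
    have key := concEnv_le (u := fun z => 1 + 2 * c₀ + c₁ * |z| - η * z ^ 2 / 2)
      (concaveOn_affine (1 + 2 * c₀ + c₁ * |x| - η * x ^ 2 / 2 - (c₁ - η * |x|) * |x|)
        ((c₁ - η * |x|) * s)) (fun z => by
          have h1 : s * z ≤ |z| := by
            calc s * z ≤ |s * z| := le_abs_self _
              _ = |z| := by rw [abs_mul, hs, one_mul]
          have h2 : c₁ - η * |x| ≤ 0 := by linarith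
          have h3 := mul_le_mul_of_nonpos_left h1 h2
          have h4 : 0 ≤ η / 2 * (|z| - |x|) ^ 2 := by positivity
          have h5 : (|z| - |x|) ^ 2 = z ^ 2 + x ^ 2 - 2 * (|z| * |x|) := by
            rw [← sq_abs z, ← sq_abs x]; ring
          rw [h5] at h4
          have h6 := sq_abs x
          nlinarith) x
    have h1 : (c₁ - η * |x|) * s * x = (c₁ - η * |x|) * |x| := by rw [mul_assoc, hsx]
    have h2 : 0 ≤ c₁ ^ 2 / η := by positivity
    linarith

end facelift

section data

variable {f σ γ : ℝ → ℝ} {ι : ℝ}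

theorem exists_coeffBounds (hf : Continuous f) (hf_bdd : ∃ C : ℝ, ∀ x, |f x| ≤ C)
    (hf_inf : 0 < ⨅ x, f x) (hσ : Continuous σ) (hσ_bdd : ∃ C : ℝ, ∀ x, |σ x| ≤ C)
    (hσ_inf : 0 < ⨅ x, σ x) (hγ : Continuous γ) (hι : 0 < ι)
    (hγ_bd : ∀ x, ι ≤ γ x ∧ γ x ≤ 1 / f x - ι) : ∃ f₀ s₀, CoeffBounds f σ γ f₀ s₀ ι := by
  obtain ⟨A, hA⟩ := hf_bdd
  obtain ⟨B, hB⟩ := hσ_bdd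
  refine ⟨⨅ x, f x, B, ⟨hf, hσ, hγ, hf_inf, fun x => ciInf_le ⟨-A, ?_⟩ x,
    fun x => hσ_inf.trans_le (ciInf_le ⟨-B, ?_⟩ x), fun x => (abs_le.1 (hB x)).2, hι,
    fun x => (hγ_bd x).1, fun x => (hγ_bd x).2⟩⟩
  · rintro _ ⟨x, rfl⟩; exact (abs_le.1 (hA x)).1
  · rintro _ ⟨x, rfl⟩; exact (abs_le.1 (hB x)).1

theorem lowerBd_le {g : ℝ → ℝ} (hg : ∃ C : ℝ, ∀ x, max (-g x) 0 ≤ C) (x : ℝ) :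
    lowerBd g ≤ g x := by
  obtain ⟨C, hC⟩ := hg
  refine ciInf_le ⟨-C, ?_⟩ x
  rintro _ ⟨x, rfl⟩
  linarith [(le_max_left (-g x) 0).trans (hC x)]

theorem CoeffBounds.nonlin_le_sup {f₀ s₀ : ℝ} (C : CoeffBounds f σ γ f₀ s₀ ι) {x M : ℝ}
    (hM : M ≤ γ x) : σ x ^ 2 * M / (2 * (1 - f x * M)) ≤
      ⨆ x, σ x ^ 2 * γ x / (2 * (1 - f x * γ x)) := by
  refine (C.nonlin_mono hM le_rfl).trans
    (le_ciSup (f := fun x => σ x ^ 2 * γ x / (2 * (1 - f x * γ x)))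
      ⟨(s₀ / (ι * f₀)) ^ 2 / (2 * f₀), ?_⟩ x)
  rintro _ ⟨y, rfl⟩
  exact C.nonlin_le le_rfl

theorem CoeffBounds.nonlin_sup_nonneg {f₀ s₀ : ℝ} (C : CoeffBounds f σ γ f₀ s₀ ι) :
    0 ≤ ⨆ x, σ x ^ 2 * γ x / (2 * (1 - f x * γ x)) := by
  simpa using C.nonlin_le_sup (x := 0) (M := 0) (C.ι_pos.le.trans (C.γ_ge 0))

/-- Under the standing assumptions the truncations of the scheme are inactive. -/
theorem CoeffBounds.isDiscreteSolution {f₀ s₀ : ℝ} (C : CoeffBounds f σ γ f₀ s₀ ι) {G : ℝ → ℝ}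
    {T ht hx xlo xhi wlo c₀ c₁ η : ℝ} {nt nx : ℕ} {u : ℝ × ℝ → ℝ} (hT : 0 < T)
    (hm : IsMesh T ht hx xlo xhi nt nx) (hη : 0 < η) (hηι : η ≤ ι) (hc₀ : 0 < c₀)
    (hG : ∀ x, G x ≤ c₀ + c₁ * |x|) (hlo : ∀ x, wlo ≤ G x)
    (hu : IsSchemeSolution f σ γ G wlo (upperBd T f σ γ c₀ c₁ η) ht hx xlo nt nx u) :
    IsDiscreteSolution f σ γ G T ht hx xlo xhi nt nx u := by
  set Q := ⨆ x, σ x ^ 2 * γ x / (2 * (1 - f x * γ x)) with hQ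
  have hηγ : ∀ x, η ≤ γ x := fun x => hηι.trans (C.γ_ge x)
  have hQ0 : 0 ≤ Q := C.nonlin_sup_nonneg
  have hGE : ∀ x, G x ≤ growthBd c₀ c₁ η x := fun x => by
    linarith [hG x, le_growthBd (c₀ := c₀) (c₁ := c₁) hη x]
  -- The summand `1` provides the strict inequality that keeps the cap inactive.
  have hup : ∀ x, upperBd T f σ γ c₀ c₁ η x = growthBd c₀ c₁ η x + 1 + T * Q := fun _ => rfl
  refine hu.isDiscreteSolution C hm (scheme_solution_ge hm hu hlo fun x => ?_) fun z hz => ?_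
  · rw [hup]
    have : 0 ≤ T * Q := by positivity
    linarith [hlo x, hGE x]
  · rw [hup]
    have h1 := scheme_solution_le C hm hu hQ0 (second_diff_growthBd_le hη) hηγ
      (fun x => C.nonlin_le_sup (hηγ x)) hGE (fun x => (hlo x).trans (hGE x)) z hz
    have h2 : Q * (T - z.1) ≤ Q * T :=
      mul_le_mul_of_nonneg_left (by linarith [(grid_mem_Icc hm hz).1.1]) hQ0
    linarith

/-- Discrete solutions have linear growth, uniformly in the mesh. -/
theorem CoeffBounds.exists_discrete_bound {f₀ s₀ : ℝ} (C : CoeffBounds f σ γ f₀ s₀ ι) {G : ℝ → ℝ}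
    {T c₀ c₁ η : ℝ} (hT : 0 ≤ T) (hc₀ : 0 ≤ c₀) (hc₁ : 0 ≤ c₁) (hη : 0 < η) (hηγ : ∀ x, η ≤ γ x)
    (hG : ∀ x, -c₀ ≤ G x ∧ G x ≤ c₀ + c₁ * |x|) :
    ∃ K : ℝ, ∀ δ S, MeshFn.Fine f σ γ G T δ S → ∀ z ∈ S.nodes, |S.u z| ≤ K * (1 + |z.2|) := by
  set Q := ⨆ x, σ x ^ 2 * γ x / (2 * (1 - f x * γ x)) with hQ
  have hQ0 : 0 ≤ Q := C.nonlin_sup_nonneg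
  set q := s₀ ^ 2 / (2 * f₀) with hq
  have hq0 : 0 ≤ q := by have := C.f₀_pos; positivity
  set K := 1 + 2 * c₀ + c₁ ^ 2 / η + c₁ + Q * T + q * T with hK
  refine ⟨K, fun δ S hS z hz => ?_⟩
  have ht := (grid_mem_Icc hS.mesh hz).1
  have h1 := hS.sol.ge_terminal C hS.mesh z hz
  have h2 := hS.sol.le_of_second_diff C hS.mesh hQ0 (second_diff_growthBd_le hη) hηγ
    (fun x => C.nonlin_le_sup (hηγ x))
    (fun x => by linarith [(hG x).2, le_growthBd (c₀ := c₀) (c₁ := c₁) hη x]) z hz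
  have h3 := growthBd_le (c₀ := c₀) hη hc₁ z.2
  have h4 : Q * (T - z.1) ≤ Q * T := mul_le_mul_of_nonneg_left (by linarith [ht.1]) hQ0
  have h5 : q * (T - z.1) ≤ q * T := mul_le_mul_of_nonneg_left (by linarith [ht.1]) hq0
  have h6 : 0 ≤ c₁ ^ 2 / η := by positivity
  have h7 : 0 ≤ Q * T := by positivity
  have h8 : 0 ≤ q * T := by positivity
  have h9 : 0 ≤ (K - c₁) * |z.2| := by
    refine mul_nonneg ?_ (abs_nonneg _)
    linarith
  have h10 : 0 ≤ c₁ * |z.2| := by positivity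
  rw [← hq] at h1
  rw [abs_le]
  constructor <;> linarith [(hG z.2).1]

end data

end
end GammaHedging

/-! ### Convergence of the discrete solutions, existence and uniqueness. -/

namespace GammaHedging
noncomputable section

open Filter Topology

/-- Fine meshes have nodes close to any given point; the node can be taken at the terminal date if
the point lies there. -/
theorem exists_mesh_near {T : ℝ} (hT : 0 < T) {p : ℝ × ℝ} (hp : p.1 ∈ Icc 0 T) {δ : ℝ}
    (hδ : 0 < δ) : ∃ (ht hx xlo xhi : ℝ) (nt nx : ℕ), IsMesh T ht hx xlo xhi nt nx ∧
      ht / hx ^ 2 < δ ∧ hx < δ ∧ xlo * δ ≤ -1 ∧ 1 ≤ xhi * δ ∧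
      ∃ z ∈ grid ht hx xlo nt nx, dist z p < δ ∧ (p.1 = T → z.1 = T) := by
  obtain ⟨m, hm⟩ := exists_nat_gt (max 1 (1 / δ))
  have hm1 : (1 : ℝ) < m := (le_max_left _ _).trans_lt hm
  have hmδ : 1 / δ < m := (le_max_right _ _).trans_lt hm
  have hm0 : (0 : ℝ) < m := by linarith
  set hx : ℝ := 1 / m with hhx
  have hx0 : 0 < hx := by positivity
  have hx1 : hx < 1 := by rw [hhx, div_lt_one hm0]; exact hm1
  have hxδ : hx < δ := by
    rw [div_lt_iff₀ hδ] at hmδ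
    rw [hhx, div_lt_iff₀ hm0]; linarith
  -- A time step below `κ` is less than one and has ratio `ht / hx²` below `δ`.
  set κ := min 1 δ * hx ^ 2 with hκ
  have hκ0 : 0 < κ := by positivity
  obtain ⟨n, hn⟩ := exists_nat_gt (T / κ)
  have hn0 : (0 : ℝ) < n := (by positivity : (0 : ℝ) < T / κ).trans hn
  set ht : ℝ := T / n with hht
  have ht0 : 0 < ht := by positivity
  have htκ : ht < κ := by
    rw [div_lt_iff₀ hκ0] at hn
    rw [hht, div_lt_iff₀ hn0]; linarith
  have hx2 : hx ^ 2 ≤ 1 := pow_le_one₀ hx0.le hx1.le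
  have hκ1 : κ ≤ 1 := by
    calc κ ≤ 1 * 1 := mul_le_mul (min_le_left _ _) hx2 (by positivity) (by norm_num)
      _ = 1 := by ring
  have hκδ : κ ≤ δ := by
    calc κ ≤ δ * 1 := mul_le_mul (min_le_right _ _) hx2 (by positivity) hδ.le
      _ = δ := by ring
  have hratio : ht / hx ^ 2 < δ := by
    rw [div_lt_iff₀ (by positivity)]
    exact htκ.trans_le (mul_le_mul_of_nonneg_right (min_le_right _ _) (by positivity))
  obtain ⟨N, hN⟩ := exists_nat_gt (max (1 / δ) |p.2|)
  have hNδ : 1 / δ < N := (le_max_left _ _).trans_lt hN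
  have hNp : |p.2| < N := (le_max_right _ _).trans_lt hN
  have hNδ' : 1 < N * δ := by rwa [div_lt_iff₀ hδ] at hNδ
  have hN0 : (0 : ℝ) < N := (abs_nonneg _).trans_lt hNp
  -- Since `hx = 1 / m`, the interval `[-N, N]` holds exactly `2Nm` space steps.
  have hmesh : IsMesh T ht hx (-N) N n (2 * N * m) := by
    refine ⟨ht0, htκ.trans_le hκ1, hx0, hx1, by linarith, ?_, ?_⟩
    · rw [hht]; field_simp
    · rw [hhx]; push_cast; field_simp; ring
  obtain ⟨hp2, hp2'⟩ := abs_lt.1 hNp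
  set a := p.1 / ht with ha
  set b := (p.2 - -N) / hx with hb
  have ha0 : 0 ≤ a := div_nonneg hp.1 ht0.le
  have hb0 : 0 ≤ b := div_nonneg (by linarith) hx0.le
  have han : a ≤ n := by
    rw [ha, div_le_iff₀ ht0, hmesh.time_steps]; exact hp.2
  have hbn : b ≤ (2 * N * m : ℕ) := by
    rw [hb, div_le_iff₀ hx0, hmesh.space_steps]; linarith
  have hpa : p.1 = a * ht := by rw [ha]; field_simp
  have hpb : p.2 = -N + b * hx := by rw [hb]; field_simp; ring
  refine ⟨ht, hx, -N, N, n, 2 * N * m, hmesh, hratio, hxδ, by linarith, hNδ'.le,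
    (⌊a⌋₊ * ht, -N + ⌊b⌋₊ * hx), ⟨⌊a⌋₊, ⌊b⌋₊, Nat.floor_le_of_le han, Nat.floor_le_of_le hbn, rfl⟩,
    ?_, ?_⟩
  · have floor_near : ∀ c k : ℝ, 0 ≤ c → 0 < k → |⌊c⌋₊ * k - c * k| ≤ k := fun c k hc hk => by
      have h1 := Nat.floor_le hc
      have h2 := Nat.lt_floor_add_one c
      rw [← sub_mul, abs_mul, abs_of_pos hk]
      refine mul_le_of_le_one_left hk.le (abs_le.2 ⟨by linarith, by linarith⟩)
    rw [Prod.dist_eq, max_lt_iff, Real.dist_eq, Real.dist_eq, hpa, hpb, add_sub_add_left_eq_sub]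
    exact ⟨(floor_near a ht ha0 ht0).trans_lt (htκ.trans_le hκδ),
      (floor_near b hx hb0 hx0).trans_lt hxδ⟩
  · intro h
    have : a = n := by
      rw [ha, h, div_eq_iff ht0.ne', hmesh.time_steps]
    simp only
    rw [this, Nat.floor_natCast, hmesh.time_steps]

/-- A smooth strict supersolution is a discrete supersolution on fine meshes, uniformly on compact
sets. -/
theorem discrete_pos_on_compact {f σ γ : ℝ → ℝ} {f₀ s₀ ι : ℝ} (C : CoeffBounds f σ γ f₀ s₀ ι)
    {W : ℝ × ℝ → ℝ} (hW : ContDiff ℝ 2 W) {A : Set (ℝ × ℝ)} (hA : IsCompact A)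
    (hpos : ∀ p ∈ A, 0 < pricingOp f σ γ p.2 (dT W p) (dXX W p)) :
    ∃ δ > 0, ∀ t x ht hx : ℝ, (t, x) ∈ A → 0 < ht → 0 < hx → hx < δ → ht / hx ^ 2 < δ →
      0 < pricingOp f σ γ x ((W (t + ht, x) - W (t, x)) / ht) (discG ht hx t x (W (t, x)) W) := by
  refine hA.induction_on (p := fun s => ∃ δ > 0, ∀ t x ht hx : ℝ, (t, x) ∈ s → 0 < ht → 0 < hx →
    hx < δ → ht / hx ^ 2 < δ → 0 < pricingOp f σ γ x ((W (t + ht, x) - W (t, x)) / ht)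
      (discG ht hx t x (W (t, x)) W)) ?_ ?_ ?_ ?_
  · exact ⟨1, one_pos, fun t x _ _ h => absurd h (notMem_empty _)⟩
  · rintro s s' hs ⟨δ, hδ, H⟩
    exact ⟨δ, hδ, fun t x ht hx h => H t x ht hx (hs h)⟩
  · rintro s s' ⟨δ, hδ, H⟩ ⟨δ', hδ', H'⟩
    refine ⟨min δ δ', by positivity, fun t x ht hx h h1 h2 h3 h4 => ?_⟩
    rw [lt_min_iff] at h3 h4
    rcases h with h | h
    · exact H t x ht hx h h1 h2 h3.1 h4.1
    · exact H' t x ht hx h h1 h2 h3.2 h4.2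
  · intro p hp
    obtain ⟨δ, hδ, H⟩ := eventually_jet hW p (C.eventually_pos (hpos p hp))
    exact ⟨Metric.ball p δ, mem_nhdsWithin_of_mem_nhds (Metric.ball_mem_nhds p hδ), δ, hδ,
      fun t x ht hx h h1 h2 h3 h4 => H t x ht hx h h1 h2 h3 h4⟩

section convergence

variable {f σ γ Γ G : ℝ → ℝ} {f₀ s₀ ι T K : ℝ} (C : CoeffBounds f σ γ f₀ s₀ ι) (hT : 0 < T)
  (hΓ : ContDiff ℝ 2 Γ) (hΓγ : ∀ x, iteratedDeriv 2 Γ x = γ x)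
  (hG : ∀ x h, G (x + h) + G (x - h) - 2 * G x ≤ Γ (x + h) + Γ (x - h) - 2 * Γ x)
  (hunif : UniformContinuous G)
  (hbd : ∀ δ S, MeshFn.Fine f σ γ G T δ S → ∀ z ∈ S.nodes, |S.u z| ≤ K * (1 + |z.2|))

include C hT hΓ hΓγ hG hunif in
/-- Smooth barriers for supersolutions attaining the terminal data `G`. -/
theorem exists_barrier_of_terminal {w : ℝ × ℝ → ℝ} (hlsc : LowerSemicontinuousOn w (Icc 0 T ×ˢ univ))
    (hsup : IsInteriorSuper f σ γ T w) (hgr : HasLinearGrowth T w) (hwT : ∀ x, w (T, x) = G x)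
    {p : ℝ × ℝ} (hp : p.1 ∈ Icc 0 T) {ε : ℝ} (hε : 0 < ε) (K' : ℝ) :
    ∃ (W : ℝ × ℝ → ℝ) (R : ℝ), ContDiff ℝ 2 W ∧ |p.2| < R - 1 ∧ W p < w p + ε ∧
      (∀ t ∈ Icc 0 T, ∀ x, |x| ≤ R → 0 < pricingOp f σ γ x (dT W (t, x)) (dXX W (t, x))) ∧
      (∀ x, |x| ≤ R → G x ≤ W (T, x)) ∧
      ∀ t ∈ Icc 0 T, ∀ x, R - 1 ≤ |x| → |x| ≤ R → K' * (1 + |x|) ≤ W (t, x) := by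
  obtain ⟨K₁, hK₁⟩ := hgr
  have h := exists_barrier C hT hlsc hsup hK₁ hΓ hΓγ (by simpa only [hwT] using hG)
    (by simpa only [hwT] using hunif) hp hε K'
  simpa only [hwT] using h

include C hT hΓ hΓγ hG hunif hbd in
/-- Discrete solutions on fine meshes lie below every supersolution attaining the terminal data. -/
theorem discrete_lt_of_super {w : ℝ × ℝ → ℝ} (hlsc : LowerSemicontinuousOn w (Icc 0 T ×ˢ univ))
    (hsup : IsInteriorSuper f σ γ T w) (hgr : HasLinearGrowth T w) (hwT : ∀ x, w (T, x) = G x)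
    {p : ℝ × ℝ} (hp : p.1 ∈ Icc 0 T) {ε : ℝ} (hε : 0 < ε) :
    ∃ δ > 0, ∀ S, MeshFn.Fine f σ γ G T δ S → ∀ z ∈ S.nodes, dist z p < δ → S.u z < w p + ε := by
  -- The prescribed slope is `K`, the mesh-independent growth constant, so that `W` dominates the
  -- discrete solutions on the lateral strip.
  obtain ⟨W, R, hW, hR, hWp, hWpos, hWT, hWlat⟩ :=
    exists_barrier_of_terminal C hT hΓ hΓγ hG hunif hlsc hsup hgr hwT hp hε K
  have hR0 : 1 < R := by linarith [abs_nonneg p.2]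
  obtain ⟨δ₁, hδ₁, H₁⟩ := discrete_pos_on_compact C hW
    (isCompact_Icc.prod isCompact_Icc : IsCompact (Icc 0 T ×ˢ Icc (-R) R))
    (fun q hq => hWpos q.1 hq.1 q.2 (abs_le.2 hq.2))
  obtain ⟨δ₂, hδ₂, H₂⟩ := Metric.continuous_iff.1 hW.continuous p (w p + ε - W p) (by linarith)
  refine ⟨min (1 / (2 * R)) (min 1 (min δ₁ δ₂)), by positivity, fun S hS z hz hd => ?_⟩
  obtain ⟨b1, b2, b3, b4⟩ : dist z p < 1 / (2 * R) ∧ dist z p < 1 ∧ dist z p < δ₁ ∧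
      dist z p < δ₂ := by simpa only [lt_min_iff] using hd
  obtain ⟨c1, c2⟩ := (hS.mono (min_le_left _ _)).wide (R := R) (by
    rw [mul_one_div, div_lt_one (by positivity)]; linarith)
  have hS₁ : S.Fine f σ γ G T δ₁ := hS.mono ((min_le_right _ _).trans
    ((min_le_right _ _).trans (min_le_left _ _)))
  have hzR : |z.2| ≤ R := by
    rw [Prod.dist_eq, max_lt_iff, Real.dist_eq] at b2
    have := b2.2
    rw [Real.dist_eq] at this
    linarith [abs_sub_abs_le_abs_sub z.2 p.2]
  have key := hS.sol.le_of_barrier C hS.mesh c1.le c2.le hWT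
    (fun q hq h1 h2 => ((le_abs_self _).trans (hbd _ S hS q hq)).trans
      (hWlat q.1 (grid_mem_Icc hS.mesh hq).1 q.2 h1 h2))
    (fun t x h1 h2 h3 => (H₁ t x S.ht S.hx
      ⟨⟨h1, by linarith [hS.mesh.ht_pos]⟩, abs_le.1 h3⟩ hS.mesh.ht_pos hS.mesh.hx_pos
      hS₁.space hS₁.ratio).le) z hz hzR
  have := H₂ z b4
  rw [Real.dist_eq, abs_lt] at this
  linarith

include C hT hΓ hΓγ hG hunif in
/-- Comparison of a subsolution with a solution. -/
theorem IsPricingSolution.sub_le {v v' : ℝ × ℝ → ℝ} (hv : IsPricingSolution T f σ γ G v)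
    (hvT : ∀ x, v (T, x) = G x) (hc : ContinuousOn v' (Icc 0 T ×ˢ univ))
    (hgr : HasLinearGrowth T v') (hsub : IsViscSubsolution T f σ γ G v') {p : ℝ × ℝ}
    (hp : p.1 ∈ Icc 0 T) : v' p ≤ v p := by
  refine le_of_forall_pos_lt_add fun ε hε => ?_
  obtain ⟨K', hK'⟩ := hgr
  obtain ⟨W, R, hW, hR, hWp, hWpos, hWT, hWlat⟩ :=
    exists_barrier_of_terminal C hT hΓ hΓγ hG hunif hv.continuousOn.lowerSemicontinuousOn
      hv.super.interior hv.linearGrowth hvT hp hε K'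
  refine lt_of_le_of_lt ?_ hWp
  by_contra hcon
  push Not at hcon
  have hA : IsCompact (Icc 0 T ×ˢ Icc (-R) R) := isCompact_Icc.prod isCompact_Icc
  have hpA : p ∈ Icc 0 T ×ˢ Icc (-R) R := ⟨hp, abs_le.1 (by linarith)⟩
  -- The maximum of `v' - W` is positive; the terminal data exclude time `T` and the growth of `W`
  -- excludes the lateral strip. What remains contradicts strict positivity of the operator, time
  -- zero included.
  obtain ⟨z, hz, hzmax⟩ := hA.exists_isMaxOn (f := fun q => v' q - W q) ⟨p, hpA⟩
    ((hc.mono fun q hq => ⟨hq.1, mem_univ _⟩).sub hW.continuous.continuousOn)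
  have hzp : v' p - W p ≤ v' z - W z := hzmax hpA
  have hz2 : |z.2| ≤ R := abs_le.2 hz.2
  have hzT : z.1 < T := by
    refine hz.1.2.lt_of_ne fun h => ?_
    have h1 := hsub.terminal z.2
    have h2 := hWT z.2 hz2
    have h3 : z = (T, z.2) := Prod.ext h rfl
    rw [← h3] at h1 h2
    linarith
  have hzR : |z.2| < R - 1 := by
    by_contra h
    push Not at h
    have h1 := hWlat z.1 hz.1 z.2 h hz2
    have h2 := (abs_le.1 (hK' z.1 hz.1 z.2)).2
    change _ ≤ W z at h1
    change v' z ≤ _ at h2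
    linarith
  have hloc : IsLocalMaxOn (fun q => v' q - W q) (Ico 0 T ×ˢ univ) (z.1, z.2) := by
    have h1 : ∀ᶠ q : ℝ × ℝ in 𝓝 z, |q.2| < R :=
      (continuous_snd.abs.tendsto z).eventually_lt_const (by linarith)
    filter_upwards [mem_nhdsWithin_of_mem_nhds h1, self_mem_nhdsWithin] with q hq hq'
    exact hzmax ⟨⟨hq'.1.1, hq'.1.2.le⟩, abs_le.1 (le_of_lt hq)⟩
  have h1 := hsub.interior W hW z.1 z.2 hz.1.1 hzT hloc
  rw [pricingOpOn_eq] at h1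
  exact absurd h1 (not_le.2 (hWpos z.1 hz.1 z.2 hz2))

variable (hex : ∀ ht hx xlo xhi nt nx, IsMesh T ht hx xlo xhi nt nx →
  ∃ u, IsDiscreteSolution f σ γ G T ht hx xlo xhi nt nx u)

include hT hex in
theorem exists_fine_near {p : ℝ × ℝ} (hp : p.1 ∈ Icc 0 T) {δ : ℝ} (hδ : 0 < δ) :
    ∃ S, MeshFn.Fine f σ γ G T δ S ∧ ∃ z ∈ S.nodes, dist z p < δ ∧ (p.1 = T → z.1 = T) := by
  obtain ⟨ht, hx, xlo, xhi, nt, nx, hm, h1, h2, h3, h4, hz⟩ := exists_mesh_near hT hp hδ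
  obtain ⟨u, hu⟩ := hex ht hx xlo xhi nt nx hm
  exact ⟨⟨ht, hx, xlo, xhi, nt, nx, u⟩, ⟨hm, hu, h1, h2, h3, h4⟩, hz⟩

include C hT hunif hex in
/-- The lower relaxed limit attains the terminal data. -/
theorem IsLowerLimit.terminal_eq {w : ℝ × ℝ → ℝ} (h : IsLowerLimit (MeshFn.Fine f σ γ G T)
    MeshFn.nodes MeshFn.u (Icc 0 T ×ˢ univ) w) (x : ℝ) : w (T, x) = G x := by
  have hmem : (T, x) ∈ Icc 0 T ×ˢ (univ : Set ℝ) := ⟨⟨hT.le, le_rfl⟩, mem_univ _⟩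
  have hcont : ∀ ε > 0, ∃ r > 0, ∀ z : ℝ × ℝ, dist z (T, x) < r → |G z.2 - G x| < ε := by
    intro ε hε
    obtain ⟨r, hr, H⟩ := Metric.continuous_iff.1 hunif.continuous x ε hε
    refine ⟨r, hr, fun z hz => ?_⟩
    rw [Prod.dist_eq, max_lt_iff] at hz
    simpa [Real.dist_eq] using H z.2 hz.2
  apply le_antisymm
  · refine le_of_forall_pos_le_add fun ε hε => ?_
    obtain ⟨δ, hδ, H⟩ := h.lower _ hmem (ε / 2) (by positivity)
    obtain ⟨r, hr, H'⟩ := hcont (ε / 2) (by positivity)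
    -- A node exactly at time `T` carries the terminal data, which bounds the lower limit from
    -- above. For the reverse bound `ge_terminal` covers earlier nodes.
    obtain ⟨S, hS, z, hz, hd, hzT⟩ := exists_fine_near hT hex (p := (T, x)) hmem.1
      (show 0 < min δ r by positivity)
    rw [lt_min_iff] at hd
    have h1 := H S (hS.mono (min_le_left _ _)) z hz hd.1
    rw [hS.sol.boundary z hz (Or.inl (hzT rfl))] at h1
    linarith [(abs_lt.1 (H' z hd.2)).2]
  · refine le_of_forall_pos_le_add fun ε hε => ?_
    obtain ⟨r, hr, H'⟩ := hcont (ε / 3) (by positivity)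
    set Q := s₀ ^ 2 / (2 * f₀) with hQ
    have hQ0 : 0 ≤ Q := by have := C.f₀_pos; positivity
    obtain ⟨S, hS, z, hz, hd, hv⟩ := h.attained _ hmem (ε / 3) (by positivity)
      (min r (ε / (3 * (Q + 1)))) (by positivity)
    rw [lt_min_iff] at hd
    have h1 := hS.sol.ge_terminal C hS.mesh z hz
    have h2 := abs_lt.1 (H' z hd.1)
    have h3 : T - z.1 ≤ ε / (3 * (Q + 1)) := by
      have := hd.2
      rw [Prod.dist_eq, max_lt_iff, Real.dist_eq, abs_lt] at this
      linarith [this.1.1]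
    rw [le_div_iff₀ (by positivity)] at h3
    have h4 := (grid_mem_Icc hS.mesh hz).1.2
    rw [← hQ] at h1
    linarith

include C hT hΓ hΓγ hG hunif hbd hex in
/-- Well-posedness of the pricing equation and convergence of the discretised equation. -/
theorem exists_unique_limit : ∃ v : ℝ × ℝ → ℝ, IsPricingSolution T f σ γ G v ∧
    (∀ v', IsPricingSolution T f σ γ G v' → EqOn v' v (Icc 0 T ×ˢ univ)) ∧
    ∀ R ε : ℝ, 0 < ε → ∃ δ > 0, ∀ S, MeshFn.Fine f σ γ G T δ S → ∀ z ∈ S.nodes, |z.2| ≤ R →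
      |S.u z - v z| < ε := by
  have hmono : ∀ δ δ' S, δ ≤ δ' → MeshFn.Fine f σ γ G T δ S → MeshFn.Fine f σ γ G T δ' S :=
    fun δ δ' S hd hS => hS.mono hd
  obtain ⟨w, hw, hwb⟩ := exists_lowerLimit (nodes := MeshFn.nodes) (val := MeshFn.u)
    (K := Icc 0 T ×ˢ univ) (fun p hp δ hδ => by
      obtain ⟨S, hS, z, hz, hd, -⟩ := exists_fine_near hT hex hp.1 hδ
      exact ⟨S, hS, z, hz, hd⟩) hmono
    (lo := fun z => -(K * (1 + |z.2|))) (hi := fun z => K * (1 + |z.2|)) (by fun_prop) (by fun_prop)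
    (fun S hS z hz => abs_le.1 (hbd _ S hS z hz))
  have hlsc := hw.lowerSemicontinuousOn hmono
  have hsup : IsInteriorSuper f σ γ T w := hw.isInteriorSuper C
  have hgr : HasLinearGrowth T w :=
    ⟨K, fun t ht x => abs_le.2 (hwb (t, x) ⟨ht, mem_univ _⟩)⟩
  have hwT := hw.terminal_eq C hT hunif hex
  -- The function `w` is the upper relaxed limit as well: the upper bound is `discrete_lt_of_super`
  -- applied to `w` itself, and attainment follows since fine discrete solutions already exceed `w -
  -- ε`.
  have hw' : IsLowerLimit (MeshFn.Fine f σ γ G T) MeshFn.nodes (fun S z => -S.u z)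
      (Icc 0 T ×ˢ univ) (fun z => -w z) := by
    refine ⟨fun p hp ε hε => ?_, fun p hp ε hε δ hδ => ?_⟩
    · obtain ⟨δ, hδ, H⟩ := discrete_lt_of_super C hT hΓ hΓγ hG hunif hbd hlsc hsup hgr hwT hp.1 hε
      exact ⟨δ, hδ, fun S hS z hz hd => by linarith [H S hS z hz hd]⟩
    · obtain ⟨δ', hδ', H⟩ := hw.lower p hp ε hε
      obtain ⟨S, hS, z, hz, hd, -⟩ := exists_fine_near hT hex hp.1
        (show 0 < min δ δ' by positivity)
      rw [lt_min_iff] at hd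
      exact ⟨S, hS.mono (min_le_left _ _), z, hz, hd.1,
        by linarith [H S (hS.mono (min_le_right _ _)) z hz hd.2]⟩
  have husc : UpperSemicontinuousOn w (Icc 0 T ×ˢ univ) := by
    intro p hp y hy
    filter_upwards [hw'.lowerSemicontinuousOn hmono p hp (-y) (neg_lt_neg hy)] with q hq
    exact neg_lt_neg_iff.1 hq
  have hcont : ContinuousOn w (Icc 0 T ×ˢ univ) :=
    continuousOn_iff_lower_upperSemicontinuousOn.2 ⟨hlsc, husc⟩
  have hsol : IsPricingSolution T f σ γ G w :=
    ⟨hcont, hgr, ⟨fun φ hφ t x h0 hT' hmax => hw'.interior_sub C hφ h0 hT' hmax,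
      fun x => by rw [hwT, sub_self]⟩, ⟨hsup, fun x => by rw [hwT, sub_self]⟩⟩
  refine ⟨w, hsol, fun v' hv' p hp => ?_, fun R ε hε => ?_⟩
  · refine le_antisymm (hsol.sub_le C hT hΓ hΓγ hG hunif hwT hv'.continuousOn hv'.linearGrowth
      hv'.sub hp.1) (le_of_forall_pos_le_add fun ε hε => ?_)
    have hvT : ∀ x, v' (T, x) = G x := fun x => by
      linarith [hv'.sub.terminal x, hv'.super.terminal x]
    -- At one node near `p`, a discrete solution is below `v' p + ε/2` and above `w p - ε/2`.
    obtain ⟨δ, hδ, H⟩ := discrete_lt_of_super C hT hΓ hΓγ hG hunif hbd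
      hv'.continuousOn.lowerSemicontinuousOn hv'.super.interior hv'.linearGrowth hvT hp.1
      (half_pos hε)
    obtain ⟨δ', hδ', H'⟩ := hw.lower p hp (ε / 2) (half_pos hε)
    obtain ⟨S, hS, z, hz, hd, -⟩ := exists_fine_near hT hex hp.1
      (show 0 < min δ δ' by positivity)
    rw [lt_min_iff] at hd
    linarith [H S (hS.mono (min_le_left _ _)) z hz hd.1,
      H' S (hS.mono (min_le_right _ _)) z hz hd.2]
  · have hA : IsCompact (Icc 0 T ×ˢ Icc (-R) R) := isCompact_Icc.prod isCompact_Icc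
    have hAK : Icc 0 T ×ˢ Icc (-R) R ⊆ Icc 0 T ×ˢ univ := fun q hq => ⟨hq.1, mem_univ _⟩
    obtain ⟨δ₁, hδ₁, H₁⟩ := hw.compact_lower hmono hA hAK (ψ := fun q => w q - ε)
      ((hcont.mono hAK).sub continuousOn_const) (fun q _ => by linarith)
    obtain ⟨δ₂, hδ₂, H₂⟩ := hw'.compact_lower hmono hA hAK (ψ := fun q => -w q - ε)
      ((hcont.mono hAK).neg.sub continuousOn_const) (fun q _ => by linarith)
    refine ⟨min δ₁ δ₂, by positivity, fun S hS z hz hR => ?_⟩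
    have hzA : z ∈ Icc 0 T ×ˢ Icc (-R) R := ⟨(grid_mem_Icc hS.mesh hz).1, abs_le.1 hR⟩
    have h1 := H₁ S (hS.mono (min_le_left _ _)) z hz hzA
    have h2 := H₂ S (hS.mono (min_le_right _ _)) z hz hzA
    rw [abs_lt]
    constructor <;> linarith

end convergence

end
end GammaHedging

/-! ### The theorem under the stated hypotheses. -/

theorem mainTheorem8
    (T : ℝ) (hT : 0 < T)
    -- impact function: `f ∈ C²_b`, `inf f > 0`
    (f : ℝ → ℝ) (hf : ContDiff ℝ 2 f)
    (hf_bdd : ∃ C : ℝ, ∀ x, |f x| ≤ C ∧ |deriv f x| ≤ C ∧ |iteratedDeriv 2 f x| ≤ C)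
    (hf_inf : 0 < ⨅ x, f x)
    -- volatility: Lipschitz, bounded, `inf σ > 0`
    (σ : ℝ → ℝ) (hσ_lip : ∃ K : NNReal, LipschitzWith K σ)
    (hσ_bdd : ∃ C : ℝ, ∀ x, |σ x| ≤ C) (hσ_inf : 0 < ⨅ x, σ x)
    -- gamma bound: continuous with `ι ≤ γ ≤ 1/f - ι`
    (γ : ℝ → ℝ) (hγ : Continuous γ) (ι : ℝ) (hι : 0 < ι)
    (hγ_bd : ∀ x, ι ≤ γ x ∧ γ x ≤ 1 / f x - ι)
    -- a primitive of second order of `γ`, used to define the face-lift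
    (Γ : ℝ → ℝ) (hΓ : ContDiff ℝ 2 Γ) (hΓγ : ∀ x, iteratedDeriv 2 Γ x = γ x)
    -- payoff
    (g : ℝ → ℝ) (hg_lsc : LowerSemicontinuous g)
    (hg_neg : ∃ C : ℝ, ∀ x, max (-g x) 0 ≤ C)
    (hg_pos : ∃ C : ℝ, ∀ x, max (g x) 0 ≤ C * (1 + |x|))
    (hg_hat : UniformContinuous (GammaHedging.faceLift Γ g))
    -- constants entering the upper bound
    (c₀ c₁ η : ℝ) (hc₀ : 0 < c₀) (hc₁ : 0 ≤ c₁)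
    (hc : ∀ x, -c₀ ≤ GammaHedging.faceLift Γ g x ∧
      GammaHedging.faceLift Γ g x ≤ c₀ + c₁ * |x|)
    (hη : 0 < η) (hη' : η < min ι (⨅ x, (f x)⁻¹)) :
    -- existence and uniqueness of the solution of the scheme, for every mesh
    (∀ (ht hx xlo xhi : ℝ) (nt nx : ℕ), GammaHedging.IsMesh T ht hx xlo xhi nt nx →
      ∃ u : ℝ × ℝ → ℝ,
        GammaHedging.IsSchemeSolution f σ γ (GammaHedging.faceLift Γ g)
          (GammaHedging.lowerBd g) (GammaHedging.upperBd T f σ γ c₀ c₁ η)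
          ht hx xlo nt nx u ∧
        ∀ u' : ℝ × ℝ → ℝ,
          GammaHedging.IsSchemeSolution f σ γ (GammaHedging.faceLift Γ g)
            (GammaHedging.lowerBd g) (GammaHedging.upperBd T f σ γ c₀ c₁ η)
            ht hx xlo nt nx u' →
          Set.EqOn u' u (GammaHedging.grid ht hx xlo nt nx)) ∧
    -- the pricing equation has a unique continuous viscosity solution with linear growth, and the
    -- solutions of the scheme converge to it locally uniformly
    (∃ v : ℝ × ℝ → ℝ,
      GammaHedging.IsPricingSolution T f σ γ (GammaHedging.faceLift Γ g) v ∧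
      (∀ v' : ℝ × ℝ → ℝ,
        GammaHedging.IsPricingSolution T f σ γ (GammaHedging.faceLift Γ g) v' →
        Set.EqOn v' v (Set.Icc 0 T ×ˢ Set.univ)) ∧
      ∀ R ε : ℝ, 0 < R → 0 < ε → ∃ δ L : ℝ, 0 < δ ∧ 0 < L ∧
        ∀ (ht hx xlo xhi : ℝ) (nt nx : ℕ), GammaHedging.IsMesh T ht hx xlo xhi nt nx →
          ht / hx ^ 2 < δ → hx < δ → xlo ≤ -L → L ≤ xhi →
          ∀ u : ℝ × ℝ → ℝ,
            GammaHedging.IsSchemeSolution f σ γ (GammaHedging.faceLift Γ g)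
              (GammaHedging.lowerBd g) (GammaHedging.upperBd T f σ γ c₀ c₁ η)
              ht hx xlo nt nx u →
            ∀ p ∈ GammaHedging.grid ht hx xlo nt nx, |p.2| ≤ R → |u p - v p| < ε) := by
  obtain ⟨f₀, s₀, C⟩ := GammaHedging.exists_coeffBounds hf.continuous
    (hf_bdd.imp fun _ h x => (h x).1) hf_inf hσ_lip.choose_spec.continuous hσ_bdd hσ_inf hγ hι hγ_bd
  obtain ⟨K, hK⟩ := hg_pos
  have hgK : ∀ x, g x ≤ K * (1 + |x|) := fun x => (le_max_left _ _).trans (hK x)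
  have hΓι : ∀ x, ι ≤ iteratedDeriv 2 Γ x := fun x => (hΓγ x).symm ▸ (hγ_bd x).1
  have hηι : η ≤ ι := hη'.le.trans (min_le_left _ _)
  have hηγ : ∀ x, η ≤ γ x := fun x => hηι.trans (hγ_bd x).1
  have hlo : ∀ x, GammaHedging.lowerBd g ≤ GammaHedging.faceLift Γ g x := fun x =>
    (GammaHedging.lowerBd_le hg_neg x).trans (GammaHedging.le_faceLift hι hΓ hΓι hgK x)
  have hdisc : ∀ ht hx xlo xhi nt nx u, GammaHedging.IsMesh T ht hx xlo xhi nt nx →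
      GammaHedging.IsSchemeSolution f σ γ (GammaHedging.faceLift Γ g) (GammaHedging.lowerBd g)
        (GammaHedging.upperBd T f σ γ c₀ c₁ η) ht hx xlo nt nx u →
      GammaHedging.IsDiscreteSolution f σ γ (GammaHedging.faceLift Γ g) T ht hx xlo xhi nt nx u :=
    fun ht hx xlo xhi nt nx u hm hu =>
      C.isDiscreteSolution hT hm hη hηι hc₀ (fun x => (hc x).2) hlo hu
  obtain ⟨K', hbd⟩ := C.exists_discrete_bound hT.le hc₀.le hc₁ hη hηγ hc
  refine ⟨fun ht hx xlo xhi nt nx hm => ?_, ?_⟩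
  · obtain ⟨u, hu⟩ := GammaHedging.exists_scheme_solution C hm (GammaHedging.faceLift Γ g)
      (GammaHedging.lowerBd g) (GammaHedging.upperBd T f σ γ c₀ c₁ η)
    exact ⟨u, hu, fun u' hu' => GammaHedging.scheme_solution_unique C hm hu hu'⟩
  obtain ⟨v, hv, huniq, hconv⟩ := GammaHedging.exists_unique_limit C hT hΓ hΓγ
    (GammaHedging.second_diff_faceLift_le hι hΓ hΓι hgK) hg_hat hbd
    (fun ht hx xlo xhi nt nx hm => by
      obtain ⟨u, hu⟩ := GammaHedging.exists_scheme_solution C hm (GammaHedging.faceLift Γ g)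
        (GammaHedging.lowerBd g) (GammaHedging.upperBd T f σ γ c₀ c₁ η)
      exact ⟨u, hdisc ht hx xlo xhi nt nx u hm hu⟩)
  refine ⟨v, hv, huniq, fun R ε _ hε => ?_⟩
  obtain ⟨δ, hδ, H⟩ := hconv R ε hε
  -- `L = 1 / δ` translates the lateral conditions of `MeshFn.Fine`.
  refine ⟨δ, 1 / δ, hδ, by positivity, fun ht hx xlo xhi nt nx hm h1 h2 h3 h4 u hu p hp hpR => ?_⟩
  have hL : 1 / δ * δ = 1 := by field_simp
  refine H ⟨ht, hx, xlo, xhi, nt, nx, u⟩ ⟨hm, hdisc ht hx xlo xhi nt nx u hm hu, h1, h2, ?_, ?_⟩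
    p hp hpR
  · have := mul_le_mul_of_nonneg_right h3 hδ.le
    simp only
    linarith
  · have := mul_le_mul_of_nonneg_right h4 hδ.le
    simp only
    linarith
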